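/- Let $1<\alpha<2$, $0\le r\le 1$, and let $\beta\in[\alpha-1,1]$ be determined by $$ r=\frac{\sin(\pi\beta)}{\sin(\pi(\alpha-\beta))+\sin(\pi\beta)} . $$ For real $a,b$ put $\omega^{(a,b)}(x)=(1-x)^a x^b$ on $(0,1)$, let $\|v\|_{\omega^{(a,b)}}=\bigl(\int_0^1\omega^{(a,b)}(x)\,v(x)^2\,dx\bigr)^{1/2}$, and let $L^2_{\omega^{(a,b)}}(0,1)$ be the space of measurable $v:(0,1)\to\mathbb R$ with $\|v\|_{\omega^{(a,b)}}<\infty$. For $0<\sigma<1$ put $$ {}_0I_x^{\sigma}v(x)=\frac1{\Gamma(\sigma)}\int_0^x v(s)(x-s)^{\sigma-1}\,ds,\qquad {}_xI_1^{\sigma}v(x)=\frac1{\Gamma(\sigma)}\int_x^1 v(s)(s-x)^{\sigma-1}\,ds . $$ Let $0<K_m\le K_M<\infty$. Then there is a constant $C>0$, depending only on $\alpha,r,K_m,K_M$, such that the following holds. Let $K$ be measurable with $K_m\le K(x)\le K_M$ on $(0,1)$, let $f\in L^2_{\omega^{(\beta,\alpha-\beta)}}(0,1)$ be integrable on $(0,x)$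 for every $x<1$ (this is automatic if $0<r<1$), and let $u\in L^2_{\omega^{(-(\alpha-\beta),-\beta)}}(0,1)$ be a solution of $$ -\bigl(r\,{}_0I_x^{2-\alpha}+(1-r)\,{}_xI_1^{2-\alpha}\bigr)Du(x)=\frac1{K(x)}\int_0^x f(y)\,dy-\frac{A}{K(x)},\quad x\in(0,1),\qquad u(0)=u(1)=0, $$ where $A$ is the boundary value at $x=0$ of $K\,\bigl(r\,{}_0I_x^{2-\alpha}+(1-r)\,{}_xI_1^{2-\alpha}\bigr)Du$. Then $$ \|u\|_{\omega^{(-(\alpha-\beta),-\beta)}}\le C\,\|f\|_{\omega^{(\beta,\alpha-\beta)}} . $$ Here the equation is understood weakly: $w=\bigl(r\,{}_0I_x^{2-\alpha}+(1-r)\,{}_xI_1^{2-\alpha}\bigr)Du$ means that $w$ is locally integrable on $(0,1)$ and, for all $\varphi\in C_c^\infty(0,1)$, $$ \int_0^1 w\varphi\,dx=u(1)\psi(1)-u(0)\psi(0)-\int_0^1u\,\psi'\,dx,\qquad \psi=r\,{}_xI_1^{2-\alpha}\varphi+(1-r)\,{}_0I_x^{2-\alpha}\varphi, $$ with $u(0)=u(1)=0$;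 for absolutely continuous $u$ this is the pointwise a.e. definition. -/

import Mathlib

open MeasureTheory Set Filter Topology
open scoped ContDiff

noncomputable section

/-- The weight `ω^{(a,b)}(x) = (1 - x)^a x^b` on the interval `(0,1)`. -/
def jacobiWeight (a b x : ℝ) : ℝ := (1 - x) ^ a * x ^ b

/-- `f` belongs to the weighted space `L²_{ω^{(a,b)}}(0,1)`. -/
def MemWeightedL2 (a b : ℝ) (f : ℝ → ℝ) : Prop :=
  AEStronglyMeasurable f (volume.restrict (Ioo 0 1)) ∧
    IntegrableOn (fun x => jacobiWeight a b x * f x ^ 2) (Ioo 0 1)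

/-- The norm `‖f‖_{ω^{(a,b)}} = (∫₀¹ ω^{(a,b)} f²)^{1/2}`. -/
def weightedNorm (a b : ℝ) (f : ℝ → ℝ) : ℝ :=
  Real.sqrt (∫ x in Ioo (0 : ℝ) 1, jacobiWeight a b x * f x ^ 2)

/-- The left fractional integral `₀I_x^σ w (x)` of order `σ`. -/
def leftFracInt (σ : ℝ) (w : ℝ → ℝ) (x : ℝ) : ℝ :=
  1 / Real.Gamma σ * ∫ s in (0 : ℝ)..x, w s * (x - s) ^ (σ - 1)

/-- The right fractional integral `ₓI_1^σ w (x)` of order `σ`. -/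
def rightFracInt (σ : ℝ) (w : ℝ → ℝ) (x : ℝ) : ℝ :=
  1 / Real.Gamma σ * ∫ s in x..(1 : ℝ), w s * (s - x) ^ (σ - 1)

/-- The two-sided fractional integral `r ₀I_x^σ + (1 - r) ₓI_1^σ`. Its formal adjoint for the
`L²(0,1)` pairing is the same operator with `r` replaced by `1 - r`. -/
def twoSidedFracInt (r σ : ℝ) (w : ℝ → ℝ) (x : ℝ) : ℝ :=
  r * leftFracInt σ w x + (1 - r) * rightFracInt σ w x

/-- The pairing `⟨Du, ψ⟩` of the weak derivative of `u` on `[0,1]`, with boundary values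
`u 0` and `u 1`, with a function `ψ` that is `C¹` on `[0,1]`: for absolutely continuous `u` it is
`∫₀¹ u' ψ`, by integration by parts. -/
def derivPairing (u ψ : ℝ → ℝ) : ℝ :=
  u 1 * ψ 1 - u 0 * ψ 0 - ∫ x in Ioo (0 : ℝ) 1, u x * deriv ψ x

/-- `w = (r ₀I_x^{2-α} + (1 - r) ₓI_1^{2-α}) Du` on `(0,1)` in the weak sense: `w` is locally
integrable, and `∫ w φ = ⟨Du, ((1 - r) ₀I_x^{2-α} + r ₓI_1^{2-α}) φ⟩` for every test
function `φ ∈ C_c^∞(0,1)`. -/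
def IsWeakFlux (α r : ℝ) (u w : ℝ → ℝ) : Prop :=
  IntegrableOn u (Ioo 0 1) ∧ LocallyIntegrableOn w (Ioo 0 1) ∧
    ∀ φ : ℝ → ℝ, ContDiff ℝ ∞ φ → HasCompactSupport φ → tsupport φ ⊆ Ioo 0 1 →
      ∫ x in Ioo (0 : ℝ) 1, w x * φ x = derivPairing u (twoSidedFracInt (1 - r) (2 - α) φ)

/-- `u` solves
`-(r ₀I_x^{2-α} + (1 - r) ₓI_1^{2-α}) Du = f₁ - A f₂` on `(0,1)`, `u(0) = u(1) = 0`,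
where `f₁(x) = K(x)⁻¹ ∫₀ˣ f`, `f₂(x) = K(x)⁻¹`, and `A` is the value at `x = 0` of
`K (r ₀I_x^{2-α} + (1 - r) ₓI_1^{2-α}) Du` (a limit up to null sets, since this quantity is
given almost everywhere). The first clause says that `∫₀ˣ f` is meaningful. -/
def IsSolution (α r : ℝ) (K f u : ℝ → ℝ) : Prop :=
  (∀ x ∈ Ioo (0 : ℝ) 1, IntegrableOn f (Ioo 0 x)) ∧
  u 0 = 0 ∧ u 1 = 0 ∧
  ∃ (w : ℝ → ℝ) (A : ℝ), IsWeakFlux α r u w ∧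
    Tendsto (fun x => K x * w x) (𝓝[>] 0 ⊓ ae volume) (𝓝 A) ∧
    ∀ᵐ x ∂(volume.restrict (Ioo (0 : ℝ) 1)),
      - w x = 1 / K x * (∫ y in (0 : ℝ)..x, f y) - A * (1 / K x)

end

/-! Write a = α − β, b = β, s = a + b, and let k(y) be (1 − r) y^(1−s) for y > 0 and r |y|^(1−s) for
y < 0: up to 1/Γ(2−s), this is the kernel that acts on test functions. The relation between r and β
makes the potential of (1−t)^(b−1) t^(a−1) constant on (0,1) (`exists_lintegral_kernel_weight`). By
homogeneity of k, the potential of this weight times a polynomial q of degree n is then a polynomial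
Q q of degree at most n, whose coefficient of x^n is explicit (`exists_isPotentialMap`).

Let S q = (Q q)', from L²(ω^(b−1,a−1)) to L²(ω^(a,b)). Its adjoint on polynomials is −Q' ∘ M, with
Q' the potential map of the reflected kernel and M the weighted derivative. So S*S is symmetric and
preserves degrees: orthogonal polynomials diagonalise it, and its eigenvalues are its leading
coefficients c c' n(n+s−1) π_n², where π_n is `potentialCoeff s n`. For n ≥ 1 they are at least c c'
(s−1)², so S is bounded below on polynomials of mean zero (`le_polyInt_derivative_potential`);
moreover S maps onto all polynomials.

Testing the equation with φ = ω^(b−1,a−1) q gives ⟨w, q⟩ + ⟨v, S q⟩ = 0, where v = γ ω^(−a,−b) u and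
γ = 1/Γ(2−s). Duality and the lower bound for S control ‖v‖, which is γ‖u‖, by ‖w‖. The choice q = 1
shows that w has mean zero. Since K w is a constant minus the primitive G of f based at 1/2, testing
against w removes the unknown constant and gives K_m ‖w‖ ≤ ‖G‖; finally ‖G‖ ≤ C ‖f‖ by
Cauchy–Schwarz, with only a logarithmic loss at the endpoints.

The delicate point is that these φ are not in C_c^∞(0,1). Truncation reaches the q divisible by
x²(1−x)² (`pairing_eq_zero_of_weak`), so the pairing can depend only on q and q' at 0 and 1. Along q
= x^k and q = (1−x)^k the pair (q, S q) tends weakly to zero (`tendsto_pairing_zero`), and this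
kills the four remaining parameters (`eq_zero_of_tendsto_eval_pow`). -/

/-! ### Beta integrals and one-sided potentials of the weight -/

theorem lintegral_beta {a c : ℝ} (ha : 0 < a) (hc : 0 < c) :
    ∫⁻ y in Ioo (0 : ℝ) 1, ENNReal.ofReal (y ^ (a - 1) * (1 - y) ^ (c - 1)) =
      ENNReal.ofReal (ProbabilityTheory.beta a c) := by
  have hB := ProbabilityTheory.beta_pos ha hc
  have h := ProbabilityTheory.lintegral_betaPDF_eq_one ha hc
  rw [ProbabilityTheory.lintegral_betaPDF] at h
  calc ∫⁻ y in Ioo (0 : ℝ) 1, ENNReal.ofReal (y ^ (a - 1) * (1 - y) ^ (c - 1))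
      = ∫⁻ y in Ioo (0 : ℝ) 1, ENNReal.ofReal (ProbabilityTheory.beta a c) *
          ENNReal.ofReal (1 / ProbabilityTheory.beta a c * y ^ (a - 1) * (1 - y) ^ (c - 1)) := by
        refine lintegral_congr fun y => ?_
        rw [← ENNReal.ofReal_mul hB.le]
        congr 1
        field_simp
    _ = _ := by rw [lintegral_const_mul _ (by fun_prop), h, mul_one]

/-- The Möbius map y = u/(1 − s + s u) of (0,1) onto itself reduces this to Euler's beta integral;
−(a + c) is the exponent for which the powers of the denominator cancel. -/
theorem lintegral_beta_mobius {a c s : ℝ} (ha : 0 < a) (hc : 0 < c) (hs0 : 0 < s) (hs1 : s < 1) :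
    ∫⁻ y in Ioo (0 : ℝ) 1,
        ENNReal.ofReal (y ^ (a - 1) * (1 - y) ^ (c - 1) * (1 - s * y) ^ (-(a + c))) =
      ENNReal.ofReal ((1 - s) ^ (-a) * ProbabilityTheory.beta a c) := by
  have hD : ∀ u ∈ Ioo (0 : ℝ) 1, 0 < 1 - s + s * u := fun u hu => by nlinarith [hu.1, hu.2]
  have himg : (fun u : ℝ => u / (1 - s + s * u)) '' Ioo 0 1 = Ioo 0 1 := by
    ext y
    constructor
    · rintro ⟨u, hu, rfl⟩
      have := hD u hu
      exact ⟨div_pos hu.1 this, by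
        simp only
        rw [div_lt_one this]; nlinarith [hu.1, hu.2]⟩
    · intro hy
      have h1 : 0 < 1 - s * y := by nlinarith [hy.1, hy.2]
      refine ⟨(1 - s) * y / (1 - s * y), ⟨div_pos (mul_pos (by linarith) hy.1) h1, ?_⟩, ?_⟩
      · rw [div_lt_one h1]; nlinarith [hy.1, hy.2]
      · have h2 : 1 - s + s * ((1 - s) * y / (1 - s * y)) = (1 - s) / (1 - s * y) := by
          field_simp; ring
        simp only
        rw [h2]
        have : (1 - s) ≠ 0 := by linarith
        field_simp
  have hinj : InjOn (fun u : ℝ => u / (1 - s + s * u)) (Ioo 0 1) := by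
    intro u hu v hv huv
    have h1 := hD u hu
    have h2 := hD v hv
    simp only at huv
    rw [div_eq_div_iff h1.ne' h2.ne'] at huv
    have : (1 - s) * (u - v) = 0 := by linarith
    rcases mul_eq_zero.1 this with h | h <;> linarith
  have hder : ∀ u ∈ Ioo (0 : ℝ) 1, HasDerivWithinAt (fun u : ℝ => u / (1 - s + s * u))
      ((1 - s) / (1 - s + s * u) ^ 2) (Ioo 0 1) u := by
    intro u hu
    have h1 := hD u hu
    have h : HasDerivAt (fun u : ℝ => 1 - s + s * u) s u := by
      simpa using ((hasDerivAt_id u).const_mul s).const_add (1 - s)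
    refine (((hasDerivAt_id u).div h h1.ne').congr_deriv ?_).hasDerivWithinAt
    simp only [id]
    congr 1
    ring
  have key := lintegral_image_eq_lintegral_abs_deriv_mul measurableSet_Ioo hder hinj
    (fun y => ENNReal.ofReal (y ^ (a - 1) * (1 - y) ^ (c - 1) * (1 - s * y) ^ (-(a + c))))
  rw [himg] at key
  rw [key, ENNReal.ofReal_mul (Real.rpow_nonneg (by linarith) _), ← lintegral_beta ha hc,
    ← lintegral_const_mul _ (by fun_prop)]
  refine setLIntegral_congr_fun measurableSet_Ioo fun u hu => ?_
  have h1 := hD u hu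
  have hs : 0 < 1 - s := by linarith
  have hu1 : 0 < 1 - u := by linarith [hu.2]
  rw [← ENNReal.ofReal_mul (abs_nonneg _), ← ENNReal.ofReal_mul (Real.rpow_nonneg hs.le _),
    abs_of_pos (by positivity)]
  congr 1
  have e1 : 1 - u / (1 - s + s * u) = (1 - s) * (1 - u) / (1 - s + s * u) := by
    rw [eq_div_iff h1.ne', sub_mul, div_mul_cancel₀ _ h1.ne']; ring
  have e2 : 1 - s * (u / (1 - s + s * u)) = (1 - s) / (1 - s + s * u) := by
    rw [eq_div_iff h1.ne', sub_mul, mul_assoc, div_mul_cancel₀ _ h1.ne']; ring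
  rw [e1, e2, ← Real.rpow_natCast (1 - s + s * u) 2]
  generalize 1 - s + s * u = D at h1
  generalize 1 - s = m at hs
  generalize 1 - u = n at hu1
  rw [← Real.exp_log h1, ← Real.exp_log hs, ← Real.exp_log hu1, ← Real.exp_log hu.1]
  simp only [← Real.exp_sub, ← Real.exp_add, ← Real.exp_mul]
  congr 1
  push_cast
  ring

/-- The integrand is the s-derivative of s^(1−b) (1 − s y)^(b−1), which vanishes at s = 0 because b
< 1. -/
theorem lintegral_deriv_rpow_mul {b x y : ℝ} (hb : b < 1) (hx0 : 0 < x) (hx1 : x < 1)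
    (hy0 : 0 < y) (hy1 : y < 1) :
    ∫⁻ s in Ioo (0 : ℝ) x, ENNReal.ofReal ((1 - b) * s ^ (-b) * (1 - s * y) ^ (b - 2)) =
      ENNReal.ofReal (x ^ (1 - b) * (1 - x * y) ^ (b - 1)) := by
  have hp : ∀ s ∈ Icc (0 : ℝ) x, 0 < 1 - s * y := fun s hs => by nlinarith [hs.1, hs.2]
  have hc : ContinuousOn (fun s : ℝ => s ^ (1 - b) * (1 - s * y) ^ (b - 1)) (Icc 0 x) := by
    refine ContinuousOn.mul (continuousOn_id.rpow_const fun s _ => Or.inr (by linarith)) ?_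
    exact ContinuousOn.rpow_const (by fun_prop) fun s hs => Or.inl (hp s hs).ne'
  have hd : ∀ s ∈ Ioo 0 x, HasDerivAt (fun s : ℝ => s ^ (1 - b) * (1 - s * y) ^ (b - 1))
      ((1 - b) * s ^ (-b) * (1 - s * y) ^ (b - 2)) s := by
    intro s hs
    have h1 := hp s ⟨hs.1.le, hs.2.le⟩
    have h2 : HasDerivAt (fun s : ℝ => 1 - s * y) (-y) s := by
      simpa using ((hasDerivAt_id s).mul_const y).const_sub 1
    have h3 := (Real.hasDerivAt_rpow_const (x := s) (p := 1 - b) (Or.inl hs.1.ne')).mul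
      (h2.rpow_const (p := b - 1) (Or.inl h1.ne'))
    refine h3.congr_deriv ?_
    have e1 : s ^ (1 - b) = s ^ (-b) * s := by
      rw [← Real.rpow_add_one hs.1.ne']; ring_nf
    have e2 : (1 - s * y) ^ (b - 1) = (1 - s * y) ^ (b - 2) * (1 - s * y) := by
      rw [← Real.rpow_add_one h1.ne']; ring_nf
    have e3 : (1 - b - 1 : ℝ) = -b := by ring
    have e4 : (b - 1 - 1 : ℝ) = b - 2 := by ring
    rw [e3, e4, e1, e2]
    ring
  have hn : ∀ s ∈ Ioo 0 x, 0 ≤ (1 - b) * s ^ (-b) * (1 - s * y) ^ (b - 2) := fun s hs =>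
    mul_nonneg (mul_nonneg (by linarith) (Real.rpow_nonneg hs.1.le _))
      (Real.rpow_nonneg (hp s ⟨hs.1.le, hs.2.le⟩).le _)
  have hi := intervalIntegral.integrableOn_deriv_of_nonneg hc hd hn
  have hF := intervalIntegral.integral_eq_sub_of_hasDerivAt_of_le hx0.le hc hd
    ((intervalIntegrable_iff_integrableOn_Ioc_of_le hx0.le).2 hi)
  rw [intervalIntegral.integral_of_le hx0.le, integral_Ioc_eq_integral_Ioo,
    Real.zero_rpow (by linarith), zero_mul, sub_zero] at hF
  rw [← hF, ofReal_integral_eq_lintegral_ofReal (hi.mono_set Ioo_subset_Ioc_self)]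
  filter_upwards [ae_restrict_mem measurableSet_Ioo] with s hs using hn s hs

theorem lintegral_scale {a b c x : ℝ} (hx0 : 0 < x) (e : a + b + c = 2) :
    ∫⁻ t in Ioo (0 : ℝ) x, ENNReal.ofReal ((x - t) ^ (c - 1) * (t ^ (a - 1) * (1 - t) ^ (b - 1))) =
      ∫⁻ y in Ioo (0 : ℝ) 1, ENNReal.ofReal (y ^ (a - 1) * (1 - y) ^ (c - 1)) *
        ENNReal.ofReal (x ^ (1 - b) * (1 - x * y) ^ (b - 1)) := by
  have himg : (fun y : ℝ => x * y) '' Ioo 0 1 = Ioo 0 x := by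
    rw [image_mul_left_Ioo hx0]; simp
  have key := lintegral_image_eq_lintegral_abs_deriv_mul (f := fun y : ℝ => x * y)
    (f' := fun _ => x) (measurableSet_Ioo (a := (0 : ℝ)) (b := 1))
    (fun y _ => by simpa using ((hasDerivAt_id y).const_mul x).hasDerivWithinAt)
    (fun u _ v _ h => mul_left_cancel₀ hx0.ne' h)
    (fun t => ENNReal.ofReal ((x - t) ^ (c - 1) * (t ^ (a - 1) * (1 - t) ^ (b - 1))))
  rw [himg] at key
  rw [key]
  refine setLIntegral_congr_fun measurableSet_Ioo fun y hy => ?_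
  have hy1 : 0 < 1 - y := by linarith [hy.2]
  rw [abs_of_pos hx0, ← ENNReal.ofReal_mul hx0.le, ← ENNReal.ofReal_mul
    (mul_nonneg (Real.rpow_nonneg hy.1.le _) (Real.rpow_nonneg hy1.le _))]
  congr 1
  have e1 : x - x * y = x * (1 - y) := by ring
  have e2 : x ^ (1 - b) = x * x ^ (c - 1) * x ^ (a - 1) := by
    nth_rewrite 2 [← Real.rpow_one x]
    rw [← Real.rpow_add hx0, ← Real.rpow_add hx0]
    congr 1; linarith
  rw [e1, Real.mul_rpow hx0.le hy1.le, Real.mul_rpow hx0.le hy.1.le, e2]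
  ring

/-- After the scaling t = x y, the factor x^(1−b) (1 − x y)^(b−1) is written as an integral over s
in (0,x). Exchanging the integrals leaves a Möbius beta integral in y, since b − 2 = −(a + c). All
dependence on x is now in the limit of integration, and the same integrand occurs for the right-hand
potential. -/
theorem lintegral_left_part {a b c x : ℝ} (ha : 0 < a) (hb : b < 1) (hc : 0 < c)
    (e : a + b + c = 2) (hx0 : 0 < x) (hx1 : x < 1) :
    ∫⁻ t in Ioo (0 : ℝ) x, ENNReal.ofReal ((x - t) ^ (c - 1) * (t ^ (a - 1) * (1 - t) ^ (b - 1))) =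
      ENNReal.ofReal ((1 - b) * ProbabilityTheory.beta a c) *
        ∫⁻ s in Ioo (0 : ℝ) x, ENNReal.ofReal (s ^ (-b) * (1 - s) ^ (-a)) := by
  rw [lintegral_scale hx0 e]
  calc _ = ∫⁻ y in Ioo (0 : ℝ) 1, ∫⁻ s in Ioo (0 : ℝ) x,
        ENNReal.ofReal (y ^ (a - 1) * (1 - y) ^ (c - 1)) *
          ENNReal.ofReal ((1 - b) * s ^ (-b) * (1 - s * y) ^ (b - 2)) := by
        refine setLIntegral_congr_fun measurableSet_Ioo fun y hy => ?_
        rw [← lintegral_deriv_rpow_mul hb hx0 hx1 hy.1 hy.2, lintegral_const_mul _ (by fun_prop)]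
    _ = ∫⁻ s in Ioo (0 : ℝ) x, ∫⁻ y in Ioo (0 : ℝ) 1,
        ENNReal.ofReal (y ^ (a - 1) * (1 - y) ^ (c - 1)) *
          ENNReal.ofReal ((1 - b) * s ^ (-b) * (1 - s * y) ^ (b - 2)) := by
        refine lintegral_lintegral_swap (Measurable.aemeasurable ?_)
        simp only [Function.uncurry_def]
        fun_prop
    _ = ∫⁻ s in Ioo (0 : ℝ) x, ENNReal.ofReal ((1 - b) * ProbabilityTheory.beta a c) *
          ENNReal.ofReal (s ^ (-b) * (1 - s) ^ (-a)) := by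
        refine setLIntegral_congr_fun measurableSet_Ioo fun s hs => ?_
        have hs1 : s < 1 := hs.2.trans hx1
        have hsb := Real.rpow_nonneg hs.1.le (-b)
        have hB := (ProbabilityTheory.beta_pos ha hc).le
        rw [← ENNReal.ofReal_mul (mul_nonneg (by linarith) hB)]
        have e1 : (1 - b) * ProbabilityTheory.beta a c * (s ^ (-b) * (1 - s) ^ (-a)) =
            ((1 - b) * s ^ (-b)) * ((1 - s) ^ (-a) * ProbabilityTheory.beta a c) := by ring
        rw [e1, ENNReal.ofReal_mul (mul_nonneg (by linarith) hsb),
          ← lintegral_beta_mobius ha hc hs.1 hs1, ← lintegral_const_mul _ (by fun_prop)]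
        refine setLIntegral_congr_fun measurableSet_Ioo fun y hy => ?_
        have hy1 : 0 < 1 - y := by linarith [hy.2]
        rw [← ENNReal.ofReal_mul (mul_nonneg (Real.rpow_nonneg hy.1.le _)
          (Real.rpow_nonneg hy1.le _)), ← ENNReal.ofReal_mul (mul_nonneg (by linarith) hsb)]
        have e2 : (b - 2 : ℝ) = -(a + c) := by linarith
        rw [e2]
        congr 1
        ring
    _ = _ := lintegral_const_mul _ (by fun_prop)

theorem lintegral_reflect (f : ℝ → ENNReal) (p q : ℝ) :
    ∫⁻ t in Ioo p q, f t = ∫⁻ t in Ioo (1 - q) (1 - p), f (1 - t) := by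
  have h := (Measure.measurePreserving_sub_left (volume : Measure ℝ) 1).setLIntegral_comp_preimage_emb
    (Homeomorph.subLeft (1 : ℝ)).measurableEmbedding f (Ioo p q)
  rw [← h]
  simp

theorem lintegral_right_part {a b c x : ℝ} (ha : a < 1) (hb : 0 < b) (hc : 0 < c)
    (e : a + b + c = 2) (hx0 : 0 < x) (hx1 : x < 1) :
    ∫⁻ t in Ioo x 1, ENNReal.ofReal ((t - x) ^ (c - 1) * (t ^ (a - 1) * (1 - t) ^ (b - 1))) =
      ENNReal.ofReal ((1 - a) * ProbabilityTheory.beta b c) *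
        ∫⁻ s in Ioo x 1, ENNReal.ofReal (s ^ (-b) * (1 - s) ^ (-a)) := by
  have h := lintegral_left_part hb ha hc (x := 1 - x) (by linarith) (by linarith) (by linarith)
  rw [lintegral_reflect, lintegral_reflect (fun s => ENNReal.ofReal (s ^ (-b) * (1 - s) ^ (-a)))]
  simp only [sub_self, sub_sub_cancel]
  convert h using 4 with t t
  · rw [sub_right_comm, mul_comm ((1 - t) ^ (a - 1))]
  · rw [mul_comm]

/-! ### The two-sided kernel and its constant potential -/

/-- The kernel of the two-sided fractional integral of order `2 - a - b`, up to `Γ(2 - a - b)`. -/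
noncomputable def twoSidedKernel (a b r y : ℝ) : ℝ :=
  if 0 < y then (1 - r) * y ^ (1 - a - b) else r * (-y) ^ (1 - a - b)

/-- The relation between the weight exponents `a = α - β`, `b = β` and the parameter `r`. -/
structure Admissible (a b r : ℝ) : Prop where
  a_pos : 0 < a
  a_le : a ≤ 1
  b_pos : 0 < b
  b_le : b ≤ 1
  one_lt : 1 < a + b
  lt_two : a + b < 2
  r_nonneg : 0 ≤ r
  r_le : r ≤ 1
  sin_eq : r * Real.sin (Real.pi * a) = (1 - r) * Real.sin (Real.pi * b)

theorem Admissible.symm {a b r : ℝ} (h : Admissible a b r) : Admissible b a (1 - r) where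
  a_pos := h.b_pos
  a_le := h.b_le
  b_pos := h.a_pos
  b_le := h.a_le
  one_lt := by linarith [h.one_lt]
  lt_two := by linarith [h.lt_two]
  r_nonneg := by linarith [h.r_le]
  r_le := by linarith [h.r_nonneg]
  sin_eq := by linarith [h.sin_eq]

theorem sin_pi_mul_pos {x : ℝ} (h0 : 0 < x) (h1 : x < 1) : 0 < Real.sin (Real.pi * x) :=
  Real.sin_pos_of_pos_of_lt_pi (mul_pos Real.pi_pos h0) (by nlinarith [Real.pi_pos])

theorem Admissible.r_eq_zero {a r : ℝ} (h : Admissible a 1 r) : r = 0 := by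
  have h1 := h.sin_eq
  have h2 := sin_pi_mul_pos h.a_pos (by linarith [h.lt_two])
  rw [mul_one, Real.sin_pi, mul_zero] at h1
  exact (mul_eq_zero.1 h1).resolve_right h2.ne'

theorem Admissible.r_lt_one {a b r : ℝ} (h : Admissible a b r) (ha : a < 1) : r < 1 := by
  refine lt_of_le_of_ne h.r_le fun hr => ?_
  have h1 := h.sin_eq
  have h2 := sin_pi_mul_pos h.a_pos ha
  rw [hr] at h1
  linarith

theorem twoSidedKernel_nonneg {a b r : ℝ} (h : Admissible a b r) (y : ℝ) :
    0 ≤ twoSidedKernel a b r y := by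
  unfold twoSidedKernel
  split_ifs with hy
  · exact mul_nonneg (by linarith [h.r_le]) (Real.rpow_nonneg hy.le _)
  · exact mul_nonneg h.r_nonneg (Real.rpow_nonneg (by linarith) _)

@[fun_prop]
theorem measurable_twoSidedKernel (a b r : ℝ) : Measurable (twoSidedKernel a b r) :=
  Measurable.ite measurableSet_Ioi (by fun_prop) (by fun_prop)

theorem twoSidedKernel_neg {a b r : ℝ} (h : 1 < a + b) (y : ℝ) :
    twoSidedKernel a b r (-y) = twoSidedKernel b a (1 - r) y := by
  have e : (1 - b - a : ℝ) = 1 - a - b := by ring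
  -- The exponent is negative, so the value 0 assigned to this power makes the two branches agree at
  -- y = 0.
  have h0 : (0 : ℝ) ^ (1 - a - b) = 0 := Real.zero_rpow (by linarith)
  unfold twoSidedKernel
  rw [e]
  rcases lt_trichotomy y 0 with hy | rfl | hy
  · rw [if_pos (by linarith), if_neg (by linarith)]
  · simp [h0]
  · rw [if_neg (by linarith), if_pos hy]; simp

theorem lintegral_kernel_split (a b r : ℝ) (hr0 : 0 ≤ r) (hr1 : r ≤ 1) {x : ℝ} (hx0 : 0 < x)
    (hx1 : x < 1) (g : ℝ → ℝ) (hg : Measurable g) :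
    ∫⁻ t in Ioo (0 : ℝ) 1, ENNReal.ofReal (twoSidedKernel a b r (x - t) * g t) =
      ENNReal.ofReal (1 - r) * (∫⁻ t in Ioo (0 : ℝ) x, ENNReal.ofReal ((x - t) ^ (1 - a - b) * g t)) +
      ENNReal.ofReal r * ∫⁻ t in Ioo x 1, ENNReal.ofReal ((t - x) ^ (1 - a - b) * g t) := by
  have hs : Ioo (0 : ℝ) 1 = Ioo 0 x ∪ Ico x 1 := (Ioo_union_Ico_eq_Ioo hx0 hx1.le).symm
  rw [hs, lintegral_union measurableSet_Ico
    (disjoint_left.2 fun t h1 h2 => absurd h1.2 (not_lt.2 h2.1)),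
    setLIntegral_congr (Ioo_ae_eq_Ico (μ := volume) (a := x) (b := (1 : ℝ))).symm,
    ← lintegral_const_mul _ (by fun_prop), ← lintegral_const_mul _ (by fun_prop)]
  congr 1
  · refine setLIntegral_congr_fun measurableSet_Ioo fun t ht => ?_
    simp only [twoSidedKernel]
    rw [if_pos (by linarith [ht.2]), mul_assoc, ENNReal.ofReal_mul (by linarith)]
  · refine setLIntegral_congr_fun measurableSet_Ioo fun t ht => ?_
    simp only [twoSidedKernel]
    rw [if_neg (by linarith [ht.1]), mul_assoc, ENNReal.ofReal_mul hr0, neg_sub]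

@[fun_prop]
theorem measurable_jacobiWeight (a b : ℝ) : Measurable (jacobiWeight a b) := by
  unfold jacobiWeight; fun_prop

theorem jacobiWeight_pos (a b : ℝ) {x : ℝ} (hx : x ∈ Ioo (0 : ℝ) 1) : 0 < jacobiWeight a b x :=
  mul_pos (Real.rpow_pos_of_pos (by linarith [hx.2]) _) (Real.rpow_pos_of_pos hx.1 _)

theorem jacobiWeight_reflect (a b x : ℝ) : jacobiWeight a b (1 - x) = jacobiWeight b a x := by
  simp [jacobiWeight, mul_comm]

theorem lintegral_kernel_reflect {a b r : ℝ} (h : 1 < a + b) (x : ℝ) :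
    ∫⁻ t in Ioo (0 : ℝ) 1, ENNReal.ofReal
        (twoSidedKernel a b r (x - t) * jacobiWeight (b - 1) (a - 1) t) =
      ∫⁻ t in Ioo (0 : ℝ) 1, ENNReal.ofReal
        (twoSidedKernel b a (1 - r) (1 - x - t) * jacobiWeight (a - 1) (b - 1) t) := by
  rw [lintegral_reflect]
  simp only [sub_self, sub_zero, jacobiWeight_reflect]
  refine lintegral_congr fun t => ?_
  rw [← twoSidedKernel_neg h]
  congr 3
  ring

/-- The left and right potentials are multiples of the integrals of s^(−b) (1 − s)^(−a) over (0,x)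
and (x,1). The sine relation makes the two multiples equal, so the sum is a full beta integral,
independent of x. That integral diverges when a or b is 1; the kernel is then one-sided and scaling
alone gives the constant. -/
theorem exists_lintegral_kernel_weight {a b r : ℝ} (h : Admissible a b r) :
    ∃ c : ℝ, 0 < c ∧ ∀ x ∈ Ioo (0 : ℝ) 1, ∫⁻ t in Ioo (0 : ℝ) 1, ENNReal.ofReal
      (twoSidedKernel a b r (x - t) * jacobiWeight (b - 1) (a - 1) t) = ENNReal.ofReal c := by
  have endpoint : ∀ {a r : ℝ}, Admissible a 1 r → ∃ c : ℝ, 0 < c ∧ ∀ x ∈ Ioo (0 : ℝ) 1,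
      ∫⁻ t in Ioo (0 : ℝ) 1, ENNReal.ofReal
        (twoSidedKernel a 1 r (x - t) * jacobiWeight (1 - 1) (a - 1) t) = ENNReal.ofReal c := by
    intro a r h
    obtain rfl := h.r_eq_zero
    have hc : 0 < 1 - a := by linarith [h.lt_two]
    refine ⟨ProbabilityTheory.beta a (1 - a), ProbabilityTheory.beta_pos h.a_pos hc,
      fun x hx => ?_⟩
    rw [lintegral_kernel_split a 1 0 le_rfl zero_le_one hx.1 hx.2 _ (by fun_prop)]
    have h1 := lintegral_scale (a := a) (b := 1) (c := 1 - a) hx.1 (by ring)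
    have e1 : (1 - a - 1 : ℝ) = -a := by ring
    simp only [e1] at h1
    simp only [jacobiWeight, e1]
    simp only [sub_zero, ENNReal.ofReal_one, one_mul, ENNReal.ofReal_zero, zero_mul, add_zero]
    rw [← lintegral_beta h.a_pos hc, e1]
    simpa [mul_comm] using h1
  rcases h.b_le.eq_or_lt with rfl | hb
  · exact endpoint h
  rcases h.a_le.eq_or_lt with rfl | ha
  · obtain ⟨c, hc, H⟩ := endpoint h.symm
    refine ⟨c, hc, fun x hx => ?_⟩
    rw [lintegral_kernel_reflect h.one_lt]
    exact H (1 - x) ⟨by linarith [hx.2], by linarith [hx.1]⟩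
  have hc : 0 < 2 - a - b := by linarith [h.lt_two]
  have hr1 := h.r_lt_one ha
  have hB := ProbabilityTheory.beta_pos h.a_pos hc
  -- Both sides are ratios of Gamma values; Γ(z)Γ(1−z) = π/sin(πz) turns their equality into the
  -- sine relation.
  have hbal : r * ((1 - a) * ProbabilityTheory.beta b (2 - a - b)) =
      (1 - r) * ((1 - b) * ProbabilityTheory.beta a (2 - a - b)) := by
    have g1 : (1 - b) * ProbabilityTheory.beta a (2 - a - b) =
        Real.Gamma a * Real.Gamma (2 - a - b) / Real.Gamma (1 - b) := by
      have e : a + (2 - a - b) = 1 - b + 1 := by ring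
      have : Real.Gamma (1 - b) ≠ 0 := (Real.Gamma_pos_of_pos (by linarith)).ne'
      have : (1 - b) ≠ 0 := by linarith
      rw [ProbabilityTheory.beta, e, Real.Gamma_add_one (by linarith)]
      field_simp
    have g2 : (1 - a) * ProbabilityTheory.beta b (2 - a - b) =
        Real.Gamma b * Real.Gamma (2 - a - b) / Real.Gamma (1 - a) := by
      have e : b + (2 - a - b) = 1 - a + 1 := by ring
      have : Real.Gamma (1 - a) ≠ 0 := (Real.Gamma_pos_of_pos (by linarith)).ne'
      have : (1 - a) ≠ 0 := by linarith
      rw [ProbabilityTheory.beta, e, Real.Gamma_add_one (by linarith)]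
      field_simp
    have s1 := Real.Gamma_mul_Gamma_one_sub a
    have s2 := Real.Gamma_mul_Gamma_one_sub b
    have p1 := sin_pi_mul_pos h.a_pos ha
    have p2 := sin_pi_mul_pos h.b_pos hb
    rw [eq_div_iff p1.ne'] at s1
    rw [eq_div_iff p2.ne'] at s2
    have q1 : 0 < Real.Gamma (1 - a) := Real.Gamma_pos_of_pos (by linarith)
    have q2 : 0 < Real.Gamma (1 - b) := Real.Gamma_pos_of_pos (by linarith)
    have q3 := Real.Gamma_pos_of_pos h.a_pos
    have q4 := Real.Gamma_pos_of_pos h.b_pos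
    rw [g1, g2, mul_div_assoc', mul_div_assoc', div_eq_div_iff q1.ne' q2.ne']
    have key : r * (Real.Gamma b * Real.Gamma (1 - b)) =
        (1 - r) * (Real.Gamma a * Real.Gamma (1 - a)) := by
      have hs := h.sin_eq
      have : (r * (Real.Gamma b * Real.Gamma (1 - b))) *
          (Real.sin (Real.pi * a) * Real.sin (Real.pi * b)) =
          ((1 - r) * (Real.Gamma a * Real.Gamma (1 - a))) *
          (Real.sin (Real.pi * a) * Real.sin (Real.pi * b)) := by
        calc _ = (r * Real.sin (Real.pi * a)) *
              (Real.Gamma b * Real.Gamma (1 - b) * Real.sin (Real.pi * b)) := by ring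
          _ = ((1 - r) * Real.sin (Real.pi * b)) *
              (Real.Gamma a * Real.Gamma (1 - a) * Real.sin (Real.pi * a)) := by
                rw [hs, s1, s2]
          _ = _ := by ring
      exact mul_right_cancel₀ (mul_pos p1 p2).ne' this
    linear_combination Real.Gamma (2 - a - b) * key
  have hκ : 0 < (1 - r) * ((1 - b) * ProbabilityTheory.beta a (2 - a - b)) :=
    mul_pos (by linarith) (mul_pos (by linarith) hB)
  have hB2 := ProbabilityTheory.beta_pos (α := 1 - b) (β := 1 - a) (by linarith) (by linarith)
  refine ⟨_, mul_pos hκ hB2, fun x hx => ?_⟩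
  rw [lintegral_kernel_split a b r h.r_nonneg h.r_le hx.1 hx.2 _ (by fun_prop)]
  have h1 := lintegral_left_part h.a_pos hb hc (by ring) hx.1 hx.2
  have h2 := lintegral_right_part ha h.b_pos hc (by ring) hx.1 hx.2
  have e1 : (2 - a - b - 1 : ℝ) = 1 - a - b := by ring
  rw [e1] at h1 h2
  simp only [jacobiWeight, mul_comm ((1 - _ : ℝ) ^ (b - 1))]
  rw [h1, h2, ← mul_assoc, ← mul_assoc, ← ENNReal.ofReal_mul (by linarith),
    ← ENNReal.ofReal_mul h.r_nonneg, hbal, ← mul_add, ENNReal.ofReal_mul hκ.le,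
    ← lintegral_beta (by linarith) (by linarith)]
  congr 1
  have hs : Ioo (0 : ℝ) 1 = Ioo 0 x ∪ Ico x 1 := (Ioo_union_Ico_eq_Ioo hx.1 hx.2.le).symm
  rw [hs, lintegral_union measurableSet_Ico
    (disjoint_left.2 fun t h1 h2 => absurd h1.2 (not_lt.2 h2.1)),
    setLIntegral_congr (Ioo_ae_eq_Ico (μ := volume) (a := x) (b := (1 : ℝ))).symm]
  have e2 : (1 - b - 1 : ℝ) = -b := by ring
  have e3 : (1 - a - 1 : ℝ) = -a := by ring
  rw [e2, e3]

/-! ### Primitive of the kernel and Fubini -/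

theorem intervalIntegrable_twoSidedKernel {a b r : ℝ} (h1 : 1 < a + b) (h2 : a + b < 2) (p q : ℝ) :
    IntervalIntegrable (twoSidedKernel a b r) volume p q := by
  have hpos : ∀ {a b r R : ℝ}, a + b < 2 → 0 ≤ R →
      IntervalIntegrable (twoSidedKernel a b r) volume 0 R := by
    intro a b r R h2 hR
    refine ((intervalIntegral.intervalIntegrable_rpow' (r := 1 - a - b)
      (by linarith)).const_mul (1 - r)).congr ?_
    intro y hy
    rw [uIoc_of_le hR] at hy
    simp [twoSidedKernel, hy.1]
  have hzero : ∀ R : ℝ, IntervalIntegrable (twoSidedKernel a b r) volume 0 R := by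
    intro R
    rcases le_total 0 R with hR | hR
    · exact hpos h2 hR
    · rw [IntervalIntegrable.iff_comp_neg]
      simp only [twoSidedKernel_neg h1, neg_zero]
      exact hpos (by linarith) (by linarith)
  exact (hzero p).symm.trans (hzero q)

theorem locallyIntegrable_twoSidedKernel {a b r : ℝ} (h1 : 1 < a + b) (h2 : a + b < 2) :
    LocallyIntegrable (twoSidedKernel a b r) := by
  rw [locallyIntegrable_iff]
  intro k hk
  obtain ⟨R, hR⟩ := hk.isBounded.subset_closedBall 0
  rw [Real.closedBall_eq_Icc] at hR
  have hle : -|R| ≤ |R| := by linarith [abs_nonneg R]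
  refine ((intervalIntegrable_iff_integrableOn_Icc_of_le hle).1
    (intervalIntegrable_twoSidedKernel h1 h2 _ _)).mono_set (hR.trans (Icc_subset_Icc ?_ ?_))
  · linarith [le_abs_self R]
  · linarith [le_abs_self R]

/-- Euler's identity for the homogeneous kernel: (y k(y))' = (2 − a − b) k(y) off 0, and y k(y) is
continuous across the singularity. -/
theorem integral_twoSidedKernel {a b r : ℝ} (h1 : 1 < a + b) (h2 : a + b < 2) (p q : ℝ) :
    (2 - a - b) * ∫ y in p..q, twoSidedKernel a b r y =
      q * twoSidedKernel a b r q - p * twoSidedKernel a b r p := by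
  have hF : ∀ y : ℝ, y * twoSidedKernel a b r y =
      (1 - r) * (max y 0) ^ (2 - a - b) - r * (max (-y) 0) ^ (2 - a - b) := by
    intro y
    have h0 : (0 : ℝ) ^ (2 - a - b) = 0 := Real.zero_rpow (by linarith)
    have e : (2 - a - b : ℝ) = 1 - a - b + 1 := by ring
    rcases lt_trichotomy y 0 with hy | rfl | hy
    · rw [max_eq_right hy.le, max_eq_left (by linarith), h0, twoSidedKernel, if_neg (by linarith),
        e, Real.rpow_add_one (by linarith)]
      ring
    · simp [h0]
    · rw [max_eq_left hy.le, max_eq_right (by linarith), h0, twoSidedKernel, if_pos hy,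
        e, Real.rpow_add_one (by linarith)]
      ring
  rw [← intervalIntegral.integral_const_mul]
  refine integral_eq_of_hasDerivAt_off_countable (fun y => y * twoSidedKernel a b r y) _
    (countable_singleton (0 : ℝ)) ?_ ?_ ((intervalIntegrable_twoSidedKernel h1 h2 p q).const_mul _)
  · simp only [hF]
    have : 0 ≤ 2 - a - b := by linarith
    have c1 : Continuous fun y : ℝ => (max y 0) ^ (2 - a - b) :=
      (continuous_id.max continuous_const).rpow_const fun _ => Or.inr this
    have c2 : Continuous fun y : ℝ => (max (-y) 0) ^ (2 - a - b) :=
      (continuous_neg.max continuous_const).rpow_const fun _ => Or.inr this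
    exact ((c1.const_mul _).sub (c2.const_mul _)).continuousOn
  · intro y hy
    have e : (2 - a - b - 1 : ℝ) = 1 - a - b := by ring
    rcases lt_or_gt_of_ne hy.2 with hneg | hpos
    · have hd := (((hasDerivAt_id y).neg).rpow_const (p := 2 - a - b)
        (Or.inl (by simpa using hneg.ne))).const_mul (-r)
      refine (hd.congr_of_eventuallyEq ?_).congr_deriv ?_
      · filter_upwards [eventually_lt_nhds hneg] with z hz
        rw [hF, max_eq_right hz.le, max_eq_left (by linarith), Real.zero_rpow (by linarith)]
        simp
      · rw [twoSidedKernel, if_neg (by linarith), e]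
        simp only [Pi.neg_apply, id]
        ring
    · have hd := (Real.hasDerivAt_rpow_const (x := y) (p := 2 - a - b)
        (Or.inl hpos.ne')).const_mul (1 - r)
      refine (hd.congr_of_eventuallyEq ?_).congr_deriv ?_
      · filter_upwards [eventually_gt_nhds hpos] with z hz
        rw [hF, max_eq_left hz.le, max_eq_right (by linarith), Real.zero_rpow (by linarith)]
        simp
      · rw [twoSidedKernel, if_pos hpos, e]
        ring

theorem exists_integral_kernel_weight {a b r : ℝ} (h : Admissible a b r) :
    ∃ c : ℝ, 0 < c ∧ ∀ x ∈ Ioo (0 : ℝ) 1,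
      IntegrableOn (fun t => twoSidedKernel a b r (x - t) * jacobiWeight (b - 1) (a - 1) t)
        (Ioo 0 1) ∧
      ∫ t in Ioo (0 : ℝ) 1, twoSidedKernel a b r (x - t) * jacobiWeight (b - 1) (a - 1) t = c := by
  obtain ⟨c, hc, H⟩ := exists_lintegral_kernel_weight h
  refine ⟨c, hc, fun x hx => ?_⟩
  have hnn : 0 ≤ᵐ[volume.restrict (Ioo (0 : ℝ) 1)] fun t =>
      twoSidedKernel a b r (x - t) * jacobiWeight (b - 1) (a - 1) t := by
    filter_upwards [ae_restrict_mem measurableSet_Ioo] with t ht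
    exact mul_nonneg (twoSidedKernel_nonneg h _) (jacobiWeight_pos _ _ ht).le
  have hm : AEStronglyMeasurable (fun t => twoSidedKernel a b r (x - t) *
      jacobiWeight (b - 1) (a - 1) t) (volume.restrict (Ioo (0 : ℝ) 1)) := by
    refine Measurable.aestronglyMeasurable ?_
    fun_prop
  have hi : Integrable (fun t => twoSidedKernel a b r (x - t) *
      jacobiWeight (b - 1) (a - 1) t) (volume.restrict (Ioo (0 : ℝ) 1)) := by
    refine ⟨hm, ?_⟩
    rw [hasFiniteIntegral_iff_ofReal hnn, H x hx]
    exact ENNReal.ofReal_lt_top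
  refine ⟨hi, ?_⟩
  rw [integral_eq_lintegral_of_nonneg_ae hnn hm, H x hx, ENNReal.toReal_ofReal hc.le]

/-- Since the potential of the weight is the constant c, the absolute double integral is at most C c
‖f‖₁. -/
theorem integrable_kernel_prod {a b r : ℝ} (h : Admissible a b r) {f g : ℝ → ℝ}
    (hf : IntegrableOn f (Ioo 0 1)) (hfm : Measurable f) (hg : Measurable g) {C : ℝ}
    (hC : ∀ t ∈ Ioo (0 : ℝ) 1, |g t| ≤ C) :
    Integrable (Function.uncurry fun x t => f x * (twoSidedKernel a b r (x - t) *
        (jacobiWeight (b - 1) (a - 1) t * g t)))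
      ((volume.restrict (Ioo (0 : ℝ) 1)).prod (volume.restrict (Ioo (0 : ℝ) 1))) := by
  obtain ⟨c, hc, H⟩ := exists_integral_kernel_weight h
  have h0 : Integrable (fun z : ℝ × ℝ => f z.1 * (twoSidedKernel a b r (z.1 - z.2) *
        jacobiWeight (b - 1) (a - 1) z.2))
      ((volume.restrict (Ioo (0 : ℝ) 1)).prod (volume.restrict (Ioo (0 : ℝ) 1))) := by
    rw [integrable_prod_iff (Measurable.aestronglyMeasurable (by fun_prop))]
    constructor
    · filter_upwards [ae_restrict_mem measurableSet_Ioo] with x hx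
      exact (H x hx).1.const_mul _
    · refine (hf.norm.mul_const c).congr ?_
      filter_upwards [ae_restrict_mem measurableSet_Ioo] with x hx
      simp only [norm_mul, integral_const_mul]
      congr 1
      rw [← (H x hx).2]
      refine setIntegral_congr_fun measurableSet_Ioo fun t ht => ?_
      rw [Real.norm_of_nonneg (twoSidedKernel_nonneg h _),
        Real.norm_of_nonneg (jacobiWeight_pos _ _ ht).le]
  have h2 := h0.mul_bdd (g := fun z : ℝ × ℝ => g z.2) (c := C)
    (Measurable.aestronglyMeasurable (by fun_prop)) (by
      have hq : ∀ᵐ z ∂((volume.restrict (Ioo (0 : ℝ) 1)).prod (volume.restrict (Ioo (0 : ℝ) 1))),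
          z.2 ∈ Ioo (0 : ℝ) 1 :=
        Measure.quasiMeasurePreserving_snd.ae (ae_restrict_mem measurableSet_Ioo)
      filter_upwards [hq] with z hz using hC _ hz)
  refine h2.congr (ae_of_all _ fun z => ?_)
  simp only [Function.uncurry]
  ring

theorem integral_kernel_swap {a b r : ℝ} (h : Admissible a b r) {f g : ℝ → ℝ}
    (hf : IntegrableOn f (Ioo 0 1)) (hfm : Measurable f) (hg : Measurable g) {C : ℝ}
    (hC : ∀ t ∈ Ioo (0 : ℝ) 1, |g t| ≤ C) :
    ∫ x in Ioo (0 : ℝ) 1, f x * (∫ t in Ioo (0 : ℝ) 1, twoSidedKernel a b r (x - t) *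
        (jacobiWeight (b - 1) (a - 1) t * g t)) =
      ∫ t in Ioo (0 : ℝ) 1, jacobiWeight (b - 1) (a - 1) t * g t *
        ∫ x in Ioo (0 : ℝ) 1, twoSidedKernel a b r (x - t) * f x := by
  have := integral_integral_swap (integrable_kernel_prod h hf hfm hg hC)
  simp only [← integral_const_mul]
  rw [this]
  refine integral_congr_ae (ae_of_all _ fun t => integral_congr_ae (ae_of_all _ fun x => ?_))
  simp only
  ring

/-! ### Potentials of weighted polynomials -/

open Polynomial

theorem integrableOn_kernel_weight_mul {a b r : ℝ} (h : Admissible a b r) {x : ℝ}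
    (hx : x ∈ Ioo (0 : ℝ) 1) {g : ℝ → ℝ} (hg : Measurable g) {C : ℝ}
    (hC : ∀ t ∈ Ioo (0 : ℝ) 1, |g t| ≤ C) :
    IntegrableOn (fun t => twoSidedKernel a b r (x - t) * (jacobiWeight (b - 1) (a - 1) t * g t))
      (Ioo 0 1) := by
  obtain ⟨c, hc, H⟩ := exists_integral_kernel_weight h
  have h2 := Integrable.mul_bdd (g := g) (c := C) (H x hx).1 hg.aestronglyMeasurable (by
    filter_upwards [ae_restrict_mem measurableSet_Ioo] with t ht using hC _ ht)
  refine h2.congr (ae_of_all _ fun z => ?_)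
  simp only
  ring

theorem abs_pow_le_one_of_mem_Ioo {t : ℝ} (ht : t ∈ Ioo (0 : ℝ) 1) (n : ℕ) : |t ^ n| ≤ 1 := by
  rw [abs_of_nonneg (pow_nonneg ht.1.le _)]
  exact pow_le_one₀ ht.1.le ht.2.le

/-- Writing t = x − (x − t), the new potential is x j(x) − E(x), where E has kernel (x − t) k(x −
t). By homogeneity E' should be (2 − a − b) j. Because k is singular this is proved for increments:
the n-th potential is integrated over (c,d] and the integrals are exchanged. -/
theorem exists_potential_step {a b r : ℝ} (h : Admissible a b r) (n : ℕ) (j A : ℝ[X])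
    (hj : ∀ x ∈ Ioo (0 : ℝ) 1, ∫ t in Ioo (0 : ℝ) 1, twoSidedKernel a b r (x - t) *
        (jacobiWeight (b - 1) (a - 1) t * t ^ n) = j.eval x)
    (hA : derivative A = j) :
    ∃ κ : ℝ, ∀ x ∈ Ioo (0 : ℝ) 1, ∫ t in Ioo (0 : ℝ) 1, twoSidedKernel a b r (x - t) *
        (jacobiWeight (b - 1) (a - 1) t * t ^ (n + 1)) =
      (X * j - C (2 - a - b) * A + C κ).eval x := by
  set E : ℝ → ℝ := fun x => ∫ t in Ioo (0 : ℝ) 1, jacobiWeight (b - 1) (a - 1) t * t ^ n *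
    ((x - t) * twoSidedKernel a b r (x - t)) with hE
  have hint : ∀ m : ℕ, ∀ x ∈ Ioo (0 : ℝ) 1, IntegrableOn (fun t => twoSidedKernel a b r (x - t) *
        (jacobiWeight (b - 1) (a - 1) t * t ^ m)) (Ioo 0 1) := fun m x hx =>
    integrableOn_kernel_weight_mul h hx (by fun_prop) fun t ht => abs_pow_le_one_of_mem_Ioo ht m
  have hE1 : ∀ x ∈ Ioo (0 : ℝ) 1, E x = x * j.eval x - ∫ t in Ioo (0 : ℝ) 1,
      twoSidedKernel a b r (x - t) * (jacobiWeight (b - 1) (a - 1) t * t ^ (n + 1)) := by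
    intro x hx
    rw [← hj x hx, ← integral_const_mul, ← integral_sub ((hint n x hx).const_mul x)
      (hint (n + 1) x hx)]
    refine integral_congr_ae (ae_of_all _ fun t => ?_)
    simp only
    ring
  have hEi : ∀ x ∈ Ioo (0 : ℝ) 1, IntegrableOn (fun t => jacobiWeight (b - 1) (a - 1) t * t ^ n *
    ((x - t) * twoSidedKernel a b r (x - t))) (Ioo 0 1) := by
    intro x hx
    refine (((hint n x hx).const_mul x).sub (hint (n + 1) x hx)).congr (ae_of_all _ fun t => ?_)
    simp only [Pi.sub_apply]
    ring
  have key : ∀ c ∈ Ioo (0 : ℝ) 1, ∀ d ∈ Ioo (0 : ℝ) 1, c ≤ d →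
      E d - (2 - a - b) * A.eval d = E c - (2 - a - b) * A.eval c := by
    intro c hc d hd hcd
    have hsub : Ioc c d ⊆ Ioo 0 1 := fun y hy => ⟨hc.1.trans hy.1, hy.2.trans_lt hd.2⟩
    have hf : IntegrableOn ((Ioc c d).indicator fun _ => (1 : ℝ)) (Ioo 0 1) :=
      (integrable_const (1 : ℝ)).indicator measurableSet_Ioc
    have hsw := integral_kernel_swap h hf (measurable_const.indicator measurableSet_Ioc)
      (g := fun t => t ^ n) (by fun_prop) fun t ht => abs_pow_le_one_of_mem_Ioo ht n
    have hl : ∫ x in Ioo (0 : ℝ) 1, (Ioc c d).indicator (fun _ => (1 : ℝ)) x *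
        (∫ t in Ioo (0 : ℝ) 1, twoSidedKernel a b r (x - t) *
        (jacobiWeight (b - 1) (a - 1) t * t ^ n)) = A.eval d - A.eval c := by
      have e1 : ∫ x in c..d, j.eval x = A.eval d - A.eval c := by
        refine intervalIntegral.integral_eq_sub_of_hasDerivAt (f := fun x => A.eval x) (fun x _ => ?_)
          (j.continuous.intervalIntegrable _ _)
        rw [← hA]
        exact A.hasDerivAt x
      rw [← e1, intervalIntegral.integral_of_le hcd]
      rw [setIntegral_congr_fun (g := (Ioc c d).indicator fun x => j.eval x) measurableSet_Ioo]
      · rw [setIntegral_indicator measurableSet_Ioc, inter_eq_right.2 hsub]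
      · intro x hx
        simp only
        rw [hj x hx]
        by_cases hxc : x ∈ Ioc c d <;> simp [hxc]
    have hr : ∀ t, ∫ x in Ioo (0 : ℝ) 1, twoSidedKernel a b r (x - t) *
        (Ioc c d).indicator (fun _ => (1 : ℝ)) x = ∫ y in (c - t)..(d - t),
          twoSidedKernel a b r y := by
      intro t
      rw [← intervalIntegral.integral_comp_sub_right, intervalIntegral.integral_of_le hcd,
        ← inter_eq_right.2 hsub, ← setIntegral_indicator measurableSet_Ioc]
      refine integral_congr_ae (ae_of_all _ fun x => ?_)
      by_cases hxc : x ∈ Ioc c d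
      · simp only [inter_eq_right.2 hsub, indicator_of_mem hxc, mul_one]
      · simp only [inter_eq_right.2 hsub, indicator_of_notMem hxc, mul_zero]
    simp only [hr] at hsw
    rw [hl] at hsw
    have : E d - E c = (2 - a - b) * (A.eval d - A.eval c) := by
      rw [hsw, ← integral_const_mul, hE]
      simp only
      rw [← integral_sub (hEi d hd) (hEi c hc)]
      refine integral_congr_ae (ae_of_all _ fun t => ?_)
      have := integral_twoSidedKernel (r := r) h.one_lt h.lt_two (c - t) (d - t)
      simp only
      linear_combination (-jacobiWeight (b - 1) (a - 1) t * t ^ n) * this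
    linarith
  have hhalf : (1 / 2 : ℝ) ∈ Ioo (0 : ℝ) 1 := by norm_num
  -- E − (2 − a − b) A is constant on (0,1); its value is read off at 1/2.
  refine ⟨-(E (1 / 2) - (2 - a - b) * A.eval (1 / 2)) , fun x hx => ?_⟩
  have h1 : E x - (2 - a - b) * A.eval x = E (1 / 2) - (2 - a - b) * A.eval (1 / 2) := by
    rcases le_total (1 / 2) x with hle | hle
    · exact key _ hhalf _ hx hle
    · exact (key _ hx _ hhalf hle).symm
  have h2 := hE1 x hx
  simp only [eval_add, eval_sub, eval_mul, eval_X, eval_C]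
  linarith

theorem exists_derivative_eq (q : ℝ[X]) : ∃ A : ℝ[X], derivative A = q := by
  induction q using Polynomial.induction_on' with
  | add p q hp hq =>
    obtain ⟨A, rfl⟩ := hp
    obtain ⟨B, rfl⟩ := hq
    exact ⟨A + B, by simp⟩
  | monomial n c =>
    refine ⟨monomial (n + 1) (c / (n + 1)), ?_⟩
    rw [derivative_monomial]
    have : (n + 1 : ℝ) ≠ 0 := by positivity
    simp [this]

/-- The leading coefficients of the potentials of the weighted monomials, for unit mass. -/
noncomputable def potentialCoeff (s : ℝ) : ℕ → ℝ
  | 0 => 1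
  | n + 1 => potentialCoeff s n * ((n + s - 1) / (n + 1))

/-- `Q` describes the potential of `(1 - t)^(b - 1) t^(a - 1) q(t)`, a polynomial on `(0,1)`. -/
structure IsPotentialMap (a b r c : ℝ) (Q : ℝ[X] →ₗ[ℝ] ℝ[X]) : Prop where
  eval_eq : ∀ q : ℝ[X], ∀ x ∈ Ioo (0 : ℝ) 1, (Q q).eval x =
    ∫ t in Ioo (0 : ℝ) 1, twoSidedKernel a b r (x - t) *
      (jacobiWeight (b - 1) (a - 1) t * q.eval t)
  natDegree_le : ∀ n, (Q (X ^ n)).natDegree ≤ n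
  coeff_eq : ∀ n, (Q (X ^ n)).coeff n = c * potentialCoeff (a + b) n

theorem exists_abs_eval_le (q : ℝ[X]) : ∃ C : ℝ, ∀ t ∈ Ioo (0 : ℝ) 1, |q.eval t| ≤ C := by
  obtain ⟨C, hC⟩ := (isCompact_Icc (a := (0 : ℝ)) (b := 1)).exists_bound_of_continuousOn
    q.continuous.continuousOn
  exact ⟨C, fun t ht => hC t ⟨ht.1.le, ht.2.le⟩⟩

/-- In the recursion x j − (2 − s) A + κ, with s = a + b, the primitive A contributes j_n/(n + 1) at
the top degree. Each step therefore multiplies the leading coefficient by 1 − (2 − s)/(n + 1) = (n +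
s − 1)/(n + 1). -/
theorem exists_isPotentialMap {a b r : ℝ} (h : Admissible a b r) :
    ∃ c : ℝ, 0 < c ∧ ∃ Q : ℝ[X] →ₗ[ℝ] ℝ[X], IsPotentialMap a b r c Q := by
  obtain ⟨c, hc, H⟩ := exists_integral_kernel_weight h
  have hJ : ∀ n : ℕ, ∃ j : ℝ[X], (∀ x ∈ Ioo (0 : ℝ) 1, ∫ t in Ioo (0 : ℝ) 1,
      twoSidedKernel a b r (x - t) * (jacobiWeight (b - 1) (a - 1) t * t ^ n) = j.eval x) ∧
      j.natDegree ≤ n ∧ j.coeff n = c * potentialCoeff (a + b) n := by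
    intro n
    induction n with
    | zero =>
      refine ⟨C c, fun x hx => ?_, by simp, by simp [potentialCoeff]⟩
      simpa using (H x hx).2
    | succ n ih =>
      obtain ⟨j, hj, hdeg, hco⟩ := ih
      obtain ⟨A, hA⟩ := exists_derivative_eq j
      obtain ⟨κ, hκ⟩ := exists_potential_step h n j A hj hA
      have hn : (n + 1 : ℝ) ≠ 0 := by positivity
      have hAc : ∀ k, A.coeff (k + 1) * (k + 1) = j.coeff k := fun k => by
        rw [← hA, coeff_derivative]
      have hAdeg : A.natDegree ≤ n + 1 := by
        rw [natDegree_le_iff_coeff_eq_zero]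
        intro N hN
        obtain ⟨k, rfl⟩ : ∃ k, N = k + 1 := ⟨N - 1, by omega⟩
        have h1 := hAc k
        rw [coeff_eq_zero_of_natDegree_lt (p := j) (by omega)] at h1
        exact (mul_eq_zero.1 h1).resolve_right (by positivity)
      refine ⟨_, hκ, ?_, ?_⟩
      · refine (natDegree_add_le _ _).trans (max_le ((natDegree_sub_le _ _).trans
          (max_le ?_ ?_)) (by simp))
        · refine natDegree_mul_le.trans ?_
          rw [natDegree_X]; omega
        · exact (natDegree_C_mul_le _ _).trans hAdeg
      · have h1 := hAc n
        rw [hco] at h1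
        simp only [coeff_add, coeff_sub, coeff_X_mul, coeff_C_mul, coeff_C_succ, potentialCoeff,
          add_zero, hco]
        have h2 : A.coeff (n + 1) = c * potentialCoeff (a + b) n / (n + 1) := by
          rw [← h1]; field_simp
        rw [h2]
        field_simp
        ring
  choose J hJ1 hJ2 hJ3 using hJ
  have hQX : ∀ n, (basisMonomials ℝ).constr ℝ J (X ^ n) = J n := fun n => by
    rw [← (basisMonomials ℝ).constr_basis ℝ J n, coe_basisMonomials]
    simp only [monomial_one_right_eq_X_pow]
  refine ⟨c, hc, (basisMonomials ℝ).constr ℝ J, ?_, ?_, ?_⟩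
  · intro q x hx
    have hi : ∀ p : ℝ[X], IntegrableOn (fun t => twoSidedKernel a b r (x - t) *
      (jacobiWeight (b - 1) (a - 1) t * p.eval t)) (Ioo 0 1) := fun p => by
      obtain ⟨C, hC⟩ := exists_abs_eval_le p
      exact integrableOn_kernel_weight_mul h hx p.continuous.measurable hC
    induction q using Polynomial.induction_on' with
    | add p q hp hq =>
      rw [map_add, eval_add, hp, hq, ← integral_add (hi p) (hi q)]
      refine integral_congr_ae (ae_of_all _ fun t => ?_)
      simp only [eval_add]
      ring
    | monomial n k =>
      have e : (monomial n k : ℝ[X]) = k • X ^ n := by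
        rw [smul_X_eq_monomial]
      rw [e, map_smul, hQX, eval_smul, ← hJ1 n x hx, smul_eq_mul, ← integral_const_mul]
      refine integral_congr_ae (ae_of_all _ fun t => ?_)
      simp only [eval_smul, eval_pow, eval_X, smul_eq_mul]
      ring
  · exact fun n => by rw [hQX]; exact hJ2 n
  · exact fun n => by rw [hQX]; exact hJ3 n

/-! ### Weighted integration by parts and the adjoint -/

theorem integrableOn_jacobiWeight {p q : ℝ} (hp : -1 < p) (hq : -1 < q) :
    IntegrableOn (jacobiWeight p q) (Ioo 0 1) := by
  refine ⟨(measurable_jacobiWeight p q).aestronglyMeasurable, ?_⟩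
  rw [hasFiniteIntegral_iff_ofReal]
  · have h := lintegral_beta (a := q + 1) (c := p + 1) (by linarith) (by linarith)
    simp only [add_sub_cancel_right] at h
    simp only [jacobiWeight, mul_comm ((1 - _ : ℝ) ^ p), h]
    exact ENNReal.ofReal_lt_top
  · filter_upwards [ae_restrict_mem measurableSet_Ioo] with t ht using (jacobiWeight_pos _ _ ht).le

theorem integrableOn_jacobiWeight_mul {p q : ℝ} (hp : -1 < p) (hq : -1 < q) {g : ℝ → ℝ}
    (hg : Measurable g) {C : ℝ} (hC : ∀ t ∈ Ioo (0 : ℝ) 1, |g t| ≤ C) :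
    IntegrableOn (fun t => jacobiWeight p q t * g t) (Ioo 0 1) :=
  Integrable.mul_bdd (integrableOn_jacobiWeight hp hq) hg.aestronglyMeasurable (by
    filter_upwards [ae_restrict_mem measurableSet_Ioo] with t ht using hC _ ht)

theorem integrableOn_jacobiWeight_mul_eval {p q : ℝ} (hp : -1 < p) (hq : -1 < q) (f : ℝ[X]) :
    IntegrableOn (fun t => jacobiWeight p q t * f.eval t) (Ioo 0 1) := by
  obtain ⟨C, hC⟩ := exists_abs_eval_le f
  exact integrableOn_jacobiWeight_mul hp hq f.continuous.measurable hC

/-- Integration of polynomials against the weight `(1 - x)^p x^q` on `(0,1)`. -/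
noncomputable def polyInt (p q : ℝ) : ℝ[X] →ₗ[ℝ] ℝ :=
  (basisMonomials ℝ).constr ℝ fun n => ∫ x in Ioo (0 : ℝ) 1, jacobiWeight p q x * x ^ n

theorem constr_basisMonomials_X_pow {M : Type*} [AddCommGroup M] [Module ℝ M] (J : ℕ → M) (n : ℕ) :
    (basisMonomials ℝ).constr ℝ J (X ^ n) = J n := by
  rw [← (basisMonomials ℝ).constr_basis ℝ J n, coe_basisMonomials]
  simp only [monomial_one_right_eq_X_pow]

theorem polyInt_eq {p q : ℝ} (hp : -1 < p) (hq : -1 < q) (f : ℝ[X]) :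
    polyInt p q f = ∫ x in Ioo (0 : ℝ) 1, jacobiWeight p q x * f.eval x := by
  induction f using Polynomial.induction_on' with
  | add f g hf hg =>
    rw [map_add, hf, hg, ← integral_add (integrableOn_jacobiWeight_mul_eval hp hq f)
      (integrableOn_jacobiWeight_mul_eval hp hq g)]
    simp only [eval_add, mul_add]
  | monomial n k =>
    rw [← smul_X_eq_monomial, map_smul, polyInt, constr_basisMonomials_X_pow, smul_eq_mul,
      ← integral_const_mul]
    refine integral_congr_ae (ae_of_all _ fun t => ?_)
    simp only [eval_smul, eval_pow, eval_X, smul_eq_mul]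
    ring

theorem polyInt_mul_self_pos {p q : ℝ} (hp : -1 < p) (hq : -1 < q) {f : ℝ[X]} (hf : f ≠ 0) :
    0 < polyInt p q (f * f) := by
  rw [polyInt_eq hp hq, setIntegral_pos_iff_support_of_nonneg_ae]
  · have hsup : Ioo (0 : ℝ) 1 \ (f.roots.toFinset : Set ℝ) ⊆
        (Function.support fun x => jacobiWeight p q x * (f * f).eval x) ∩ Ioo 0 1 := by
      intro x hx
      refine ⟨?_, hx.1⟩
      have hx2 : f.eval x ≠ 0 := fun h => hx.2 (by simpa [hf] using h)
      simp [(jacobiWeight_pos p q hx.1).ne', hx2]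
    refine lt_of_lt_of_le ?_ (measure_mono hsup)
    rw [measure_sdiff_null ((Finset.countable_toSet _).measure_zero _)]
    simp
  · filter_upwards [ae_restrict_mem measurableSet_Ioo] with t ht
    rw [eval_mul]
    exact mul_nonneg (jacobiWeight_pos _ _ ht).le (mul_self_nonneg _)
  · exact integrableOn_jacobiWeight_mul_eval hp hq _

/-- The polynomial `M p` with `((1 - x)^a x^b p)' = (1 - x)^(a - 1) x^(b - 1) (M p)`. -/
noncomputable def weightedDeriv (a b : ℝ) : ℝ[X] →ₗ[ℝ] ℝ[X] :=
  LinearMap.mulLeft ℝ (C b - C (a + b) * X) + LinearMap.mulLeft ℝ (X - X ^ 2) ∘ₗ derivative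

theorem weightedDeriv_apply (a b : ℝ) (p : ℝ[X]) :
    weightedDeriv a b p = (C b - C (a + b) * X) * p + (X - X ^ 2) * derivative p := rfl

theorem jacobiWeight_eq_mul (a b : ℝ) {x : ℝ} (hx : x ∈ Ioo (0 : ℝ) 1) :
    jacobiWeight a b x = jacobiWeight (a - 1) (b - 1) x * (x * (1 - x)) := by
  have h1 : 0 < 1 - x := by linarith [hx.2]
  rw [jacobiWeight, jacobiWeight, Real.rpow_sub_one h1.ne', Real.rpow_sub_one hx.1.ne']
  have := h1.ne'
  have := hx.1.ne'
  field_simp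

theorem hasDerivAt_jacobiWeight_mul (a b : ℝ) (p : ℝ[X]) {x : ℝ} (hx : x ∈ Ioo (0 : ℝ) 1) :
    HasDerivAt (fun x => jacobiWeight a b x * p.eval x)
      (jacobiWeight (a - 1) (b - 1) x * (weightedDeriv a b p).eval x) x := by
  have h1 : 0 < 1 - x := by linarith [hx.2]
  have d1 := ((hasDerivAt_id x).const_sub 1).rpow_const (p := a) (Or.inl h1.ne')
  have d2 := Real.hasDerivAt_rpow_const (x := x) (p := b) (Or.inl hx.1.ne')
  refine ((d1.mul d2).mul (p.hasDerivAt x)).congr_deriv ?_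
  have e1 : (1 - x) ^ a = (1 - x) ^ (a - 1) * (1 - x) := by
    rw [← Real.rpow_add_one h1.ne']; ring_nf
  have e2 : x ^ b = x ^ (b - 1) * x := by
    rw [← Real.rpow_add_one hx.1.ne']; ring_nf
  simp only [weightedDeriv_apply, jacobiWeight, eval_add, eval_sub, eval_mul, eval_C, eval_X,
    eval_pow, id, Pi.mul_apply]
  rw [e1, e2]
  ring

theorem continuousOn_jacobiWeight {a b : ℝ} (ha : 0 ≤ a) (hb : 0 ≤ b) (s : Set ℝ) :
    ContinuousOn (jacobiWeight a b) s := by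
  unfold jacobiWeight
  exact (ContinuousOn.rpow_const (by fun_prop) fun _ _ => Or.inr ha).mul
    (ContinuousOn.rpow_const (by fun_prop) fun _ _ => Or.inr hb)

/-- Integration by parts; there are no boundary terms because (1 − x)^a x^b vanishes at both ends.
-/
theorem polyInt_mul_derivative {a b : ℝ} (ha : 0 < a) (hb : 0 < b) (p g : ℝ[X]) :
    polyInt a b (p * derivative g) = -polyInt (a - 1) (b - 1) (weightedDeriv a b p * g) := by
  have hi := integrableOn_jacobiWeight_mul_eval (p := a - 1) (q := b - 1) (by linarith)
    (by linarith) (weightedDeriv a b (p * g))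
  have hF := intervalIntegral.integral_eq_sub_of_hasDerivAt_of_le zero_le_one
    (f := fun x => jacobiWeight a b x * (p * g).eval x)
    ((continuousOn_jacobiWeight ha.le hb.le _).mul (p * g).continuous.continuousOn)
    (fun x hx => hasDerivAt_jacobiWeight_mul a b (p * g) hx)
    ((intervalIntegrable_iff_integrableOn_Ioo_of_le zero_le_one).2 hi)
  have h0 : jacobiWeight a b 0 = 0 := by simp [jacobiWeight, Real.zero_rpow hb.ne']
  have h1 : jacobiWeight a b 1 = 0 := by simp [jacobiWeight, Real.zero_rpow ha.ne']
  rw [intervalIntegral.integral_of_le zero_le_one, integral_Ioc_eq_integral_Ioo, h0, h1,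
    ← polyInt_eq (by linarith) (by linarith)] at hF
  have e : weightedDeriv a b (p * g) = weightedDeriv a b p * g + (X - X ^ 2) * (p * derivative g) := by
    simp only [weightedDeriv_apply, derivative_mul]
    ring
  have e2 : polyInt (a - 1) (b - 1) ((X - X ^ 2) * (p * derivative g)) =
      polyInt a b (p * derivative g) := by
    rw [polyInt_eq (by linarith) (by linarith), polyInt_eq (by linarith) (by linarith)]
    refine setIntegral_congr_fun measurableSet_Ioo fun x hx => ?_
    simp only [jacobiWeight_eq_mul a b hx, eval_mul, eval_sub, eval_X, eval_pow]
    ring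
  rw [e, map_add, e2] at hF
  linarith

/-- The adjoint of q ↦ (Q q)': integration by parts puts the derivative on the weighted p, Fubini
transposes the kernel, and the transposed kernel is the one of Q'. -/
theorem polyInt_potential_adjoint {a b r c c' : ℝ} (h : Admissible a b r) {Q Q' : ℝ[X] →ₗ[ℝ] ℝ[X]}
    (hQ : IsPotentialMap a b r c Q) (hQ' : IsPotentialMap b a (1 - r) c' Q') (q p : ℝ[X]) :
    polyInt a b (derivative (Q q) * p) =
      polyInt (b - 1) (a - 1) (q * -Q' (weightedDeriv a b p)) := by
  have ha := h.a_pos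
  have hb := h.b_pos
  rw [mul_comm, polyInt_mul_derivative ha hb, mul_neg, map_neg,
    polyInt_eq (by linarith) (by linarith), polyInt_eq (by linarith) (by linarith)]
  congr 1
  set m := weightedDeriv a b p
  obtain ⟨K, hK⟩ := exists_abs_eval_le q
  have hsw := integral_kernel_swap h (f := fun x => jacobiWeight (a - 1) (b - 1) x * m.eval x)
    (integrableOn_jacobiWeight_mul_eval (by linarith) (by linarith) m)
    (by have := m.continuous.measurable; fun_prop) q.continuous.measurable hK
  calc _ = ∫ x in Ioo (0 : ℝ) 1, jacobiWeight (a - 1) (b - 1) x * m.eval x *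
        (∫ t in Ioo (0 : ℝ) 1, twoSidedKernel a b r (x - t) *
        (jacobiWeight (b - 1) (a - 1) t * q.eval t)) := by
        refine setIntegral_congr_fun measurableSet_Ioo fun x hx => ?_
        simp only [← hQ.eval_eq q x hx, eval_mul]
        ring
    _ = _ := by
        rw [hsw]
        refine setIntegral_congr_fun measurableSet_Ioo fun t ht => ?_
        simp only [eval_mul, hQ'.eval_eq m t ht, ← twoSidedKernel_neg h.one_lt, neg_sub]
        ring

/-! ### Triangular operators and positivity -/

/-- `T` raises degrees by `s`, acting on leading coefficients by `τ`. -/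
def IsTriangular (T : ℝ[X] →ₗ[ℝ] ℝ[X]) (s : ℕ) (τ : ℕ → ℝ) : Prop :=
  ∀ n, (T (X ^ n)).natDegree ≤ n + s ∧ (T (X ^ n)).coeff (n + s) = τ n

theorem IsTriangular.apply {T : ℝ[X] →ₗ[ℝ] ℝ[X]} {s : ℕ} {τ : ℕ → ℝ} (hT : IsTriangular T s τ)
    {m : ℕ} {p : ℝ[X]} (hp : p.natDegree ≤ m) :
    (T p).natDegree ≤ m + s ∧ (T p).coeff (m + s) = τ m * p.coeff m := by
  have hsum : T p = ∑ i ∈ Finset.range (m + 1), p.coeff i • T (X ^ i) := by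
    conv_lhs => rw [p.as_sum_range' (m + 1) (by omega)]
    simp only [map_sum, ← smul_X_eq_monomial, map_smul]
  rw [hsum]
  constructor
  · refine natDegree_sum_le_of_forall_le _ _ fun i hi => (natDegree_smul_le _ _).trans ?_
    have := (hT i).1
    have := Finset.mem_range.1 hi
    omega
  · rw [finsetSum_coeff, Finset.sum_range_succ, Finset.sum_eq_zero, zero_add, coeff_smul,
      (hT m).2, smul_eq_mul, mul_comm]
    intro i hi
    have h1 := (hT i).1
    have h2 := Finset.mem_range.1 hi
    rw [coeff_smul, coeff_eq_zero_of_natDegree_lt (p := T (X ^ i)) (by omega), smul_zero]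

/-- Positivity makes the form L(p q) nondegenerate on the finite-dimensional space of polynomials of
degree below n, so X^n has a projection there. -/
theorem exists_orthogonal_monic (L : ℝ[X] →ₗ[ℝ] ℝ) (hL : ∀ q : ℝ[X], q ≠ 0 → 0 < L (q * q))
    (n : ℕ) : ∃ p ∈ degreeLT ℝ n, ∀ s ∈ degreeLT ℝ n, L ((X ^ n - p) * s) = 0 := by
  let φ : degreeLT ℝ n →ₗ[ℝ] Module.Dual ℝ (degreeLT ℝ n) :=
    (((LinearMap.mul ℝ ℝ[X]).compr₂ L).domRestrict₁₂ (degreeLT ℝ n) (degreeLT ℝ n))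
  have hφ : ∀ v w, φ v w = L ((v : ℝ[X]) * w) := fun v w => rfl
  have hinj : Function.Injective φ := by
    rw [← LinearMap.ker_eq_bot, LinearMap.ker_eq_bot']
    intro v hv
    by_contra hne
    have h1 := hL v (fun h => hne (Subtype.ext h))
    rw [← hφ, hv] at h1
    simp at h1
  have hfin : Module.Finite ℝ (degreeLT ℝ n) := Module.Finite.equiv (degreeLTEquiv ℝ n).symm
  have hsurj : Function.Surjective φ :=
    (LinearMap.injective_iff_surjective_of_finrank_eq_finrank
      Subspace.dual_finrank_eq.symm).1 hinj
  obtain ⟨v, hv⟩ := hsurj ((L ∘ₗ LinearMap.mulLeft ℝ (X ^ n)).domRestrict (degreeLT ℝ n))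
  refine ⟨v, v.2, fun s hs => ?_⟩
  have := LinearMap.congr_fun hv ⟨s, hs⟩
  rw [hφ] at this
  rw [sub_mul, map_sub, this]
  simp

/-- The monic orthogonal polynomial e of degree n is an eigenvector with eigenvalue μ n: A e − μ n e
has degree below n and, by symmetry, is orthogonal to all such polynomials. Hence the form is
diagonal with nonnegative entries. -/
theorem nonneg_of_isTriangular (L : ℝ[X] →ₗ[ℝ] ℝ) (hL : ∀ q : ℝ[X], q ≠ 0 → 0 < L (q * q))
    (A : ℝ[X] →ₗ[ℝ] ℝ[X]) (hsym : ∀ p q, L (p * A q) = L (A p * q)) {μ : ℕ → ℝ}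
    (hμ : ∀ n, 0 ≤ μ n) (hA : IsTriangular A 0 μ) (q : ℝ[X]) : 0 ≤ L (q * A q) := by
  have hmaps : ∀ n, ∀ p ∈ degreeLT ℝ n, A p ∈ degreeLT ℝ n := by
    intro n p hp
    rcases eq_or_ne p 0 with rfl | hp0
    · simp
    rcases eq_or_ne (A p) 0 with hA0 | hA0
    · rw [hA0]; exact zero_mem _
    rw [mem_degreeLT] at hp ⊢
    have h1 := (hA.apply le_rfl (p := p)).1
    exact (natDegree_lt_iff_degree_lt hA0).1
      (lt_of_le_of_lt h1 ((natDegree_lt_iff_degree_lt hp0).2 hp))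
  have main : ∀ n, ∀ q ∈ degreeLT ℝ n, 0 ≤ L (q * A q) := by
    intro n
    induction n with
    | zero =>
      intro q hq
      have : q = 0 := by
        rw [mem_degreeLT] at hq
        simpa using hq
      simp [this]
    | succ n ih =>
      intro q hq
      obtain ⟨v, hv, hvo⟩ := exists_orthogonal_monic L hL n
      set e : ℝ[X] := X ^ n - v with he
      have hvn : v.natDegree ≤ n := by
        rw [mem_degreeLT] at hv
        exact natDegree_le_of_degree_le hv.le
      have hvc : v.coeff n = 0 := by
        rw [mem_degreeLT] at hv
        exact coeff_eq_zero_of_degree_lt hv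
      have hen : e.natDegree ≤ n := (natDegree_sub_le _ _).trans (max_le (by simp) hvn)
      have hec : e.coeff n = 1 := by simp [he, hvc]
      have mem_of : ∀ p : ℝ[X], p.natDegree ≤ n → p.coeff n = 0 → p ∈ degreeLT ℝ n := by
        intro p h1 h2
        rw [mem_degreeLT, degree_lt_iff_coeff_zero]
        intro m hm
        rcases hm.eq_or_lt with rfl | hm
        · exact h2
        · exact coeff_eq_zero_of_natDegree_lt (by omega)
      have hqn : q.natDegree ≤ n := by
        rw [mem_degreeLT] at hq
        exact natDegree_le_of_degree_le (Order.le_of_lt_succ (by exact_mod_cast hq))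
      have hAe : A e = μ n • e := by
        have h1 := hA.apply hen
        have hmem : A e - μ n • e ∈ degreeLT ℝ n := by
          refine mem_of _ ((natDegree_sub_le _ _).trans
            (max_le h1.1 ((natDegree_smul_le _ _).trans hen))) ?_
          rw [coeff_sub, coeff_smul, hec]
          have := h1.2
          rw [add_zero, hec] at this
          simp [this]
        by_contra hne
        have hpos := hL _ (sub_ne_zero.2 hne)
        have h0 : L ((A e - μ n • e) * (A e - μ n • e)) = 0 := by
          rw [sub_mul, map_sub, ← hsym, smul_mul_assoc, map_smul, hvo _ hmem,
            hvo _ (hmaps n _ hmem)]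
          simp
        exact hpos.ne' h0
      set c := q.coeff n
      have hr : q - c • e ∈ degreeLT ℝ n := by
        refine mem_of _ ((natDegree_sub_le _ _).trans
          (max_le hqn ((natDegree_smul_le _ _).trans hen))) ?_
        rw [coeff_sub, coeff_smul, hec]
        simp [c]
      set w := q - c • e
      have hqe : q = c • e + w := by simp [w]
      have hee : 0 ≤ L (e * e) := by
        rcases eq_or_ne e 0 with h | h
        · simp [h]
        · exact (hL e h).le
      have h1 : L (e * w) = 0 := hvo _ hr
      have h2 : L (e * A w) = 0 := hvo _ (hmaps n _ hr)
      have h3 : L (w * e) = 0 := by rw [mul_comm]; exact h1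
      rw [hqe, map_add, map_smul, hAe, add_mul, mul_add, mul_add]
      simp only [map_add, smul_mul_assoc, mul_smul_comm, map_smul, h2, h3, smul_eq_mul]
      have := ih w hr
      have h4 := hμ n
      have : 0 ≤ c * (c * (μ n * L (e * e))) := by
        rw [← mul_assoc]
        exact mul_nonneg (mul_self_nonneg c) (mul_nonneg h4 hee)
      linarith
  refine main (q.natDegree + 1) q ?_
  rw [mem_degreeLT]
  exact lt_of_le_of_lt degree_le_natDegree (by exact_mod_cast Nat.lt_succ_self _)

/-! ### Removing the factor x²(1−x)² -/

/-- Modulo multiples of x²(1−x)² only values and slopes at 0 and 1 remain. The values of Λ on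
x^(k+2) have zero second difference, hence are affine in k; having limit 0, they vanish. The same
holds for (1−x)^(k+2). -/
theorem eq_zero_of_tendsto_eval_pow (Λ : ℝ[X] →ₗ[ℝ] ℝ)
    (h0 : ∀ p : ℝ[X], Λ (X ^ 2 * (1 - X) ^ 2 * p) = 0)
    (h1 : Tendsto (fun k : ℕ => Λ (X ^ k)) atTop (𝓝 0))
    (h2 : Tendsto (fun k : ℕ => Λ ((1 - X) ^ k)) atTop (𝓝 0)) : Λ = 0 := by
  have arith : ∀ s : ℕ → ℝ, (∀ k, s (k + 2) - 2 * s (k + 1) + s k = 0) →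
      Tendsto s atTop (𝓝 0) → ∀ k, s k = 0 := by
    intro s hs ht k
    have hd : ∀ n, s (n + 1) - s n = s 1 - s 0 := by
      intro n
      induction n with
      | zero => rfl
      | succ n ih => linarith [hs n]
    have hlim : s 1 - s 0 = 0 := by
      have h3 := ((tendsto_add_atTop_iff_nat 1).2 ht).sub ht
      simp only [hd, sub_self] at h3
      exact tendsto_nhds_unique tendsto_const_nhds h3
    have hconst : ∀ n, s n = s 0 := by
      intro n
      induction n with
      | zero => rfl
      | succ n ih => linarith [hd n]
    have hs0 : s = fun _ => s 0 := funext hconst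
    rw [hs0] at ht
    rw [hconst k]
    exact tendsto_nhds_unique tendsto_const_nhds ht
  have hX : ∀ k, Λ (X ^ (k + 2)) = 0 := by
    refine arith (fun k => Λ (X ^ (k + 2))) (fun k => ?_) ((tendsto_add_atTop_iff_nat 2).2 h1)
    rw [← h0 (X ^ k), show (X ^ 2 * (1 - X) ^ 2 * X ^ k : ℝ[X]) =
      X ^ (k + 2 + 2) - (2 : ℝ) • X ^ (k + 1 + 2) + X ^ (k + 2) by
        rw [smul_eq_C_mul, map_ofNat]; ring]
    simp
  have hY : ∀ k, Λ ((1 - X) ^ (k + 2)) = 0 := by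
    refine arith (fun k => Λ ((1 - X) ^ (k + 2))) (fun k => ?_)
      ((tendsto_add_atTop_iff_nat 2).2 h2)
    rw [← h0 ((1 - X) ^ k), show (X ^ 2 * (1 - X) ^ 2 * (1 - X) ^ k : ℝ[X]) =
      (1 - X) ^ (k + 2 + 2) - (2 : ℝ) • (1 - X) ^ (k + 1 + 2) + (1 - X) ^ (k + 2) by
        rw [smul_eq_C_mul, map_ofNat]; ring]
    simp
  -- As Λ(X²) = Λ(X³) = 0, expanding (1−X)² and (1−X)³ gives Λ(1) = 2 Λ(X) and Λ(1) = 3 Λ(X).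
  have e2 := hY 0
  have e3 := hY 1
  rw [show ((1 - X) ^ (0 + 2) : ℝ[X]) = X ^ 0 - (2 : ℝ) • X ^ 1 + X ^ (0 + 2) by
    rw [smul_eq_C_mul, map_ofNat]; ring] at e2
  rw [show ((1 - X) ^ (1 + 2) : ℝ[X]) =
    X ^ 0 - (3 : ℝ) • X ^ 1 + (3 : ℝ) • X ^ (0 + 2) - X ^ (1 + 2) by
      rw [smul_eq_C_mul, smul_eq_C_mul, map_ofNat]; ring] at e3
  simp only [map_add, map_sub, map_smul, hX, smul_eq_mul] at e2 e3
  refine (basisMonomials ℝ).ext fun n => ?_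
  rw [coe_basisMonomials]
  simp only [monomial_one_right_eq_X_pow, LinearMap.zero_apply]
  match n with
  | 0 => linarith
  | 1 => linarith
  | k + 2 => exact hX k

/-! ### Growth of the leading coefficients -/

theorem potentialCoeff_pos {s : ℝ} (hs : 1 < s) (n : ℕ) : 0 < potentialCoeff s n := by
  induction n with
  | zero => simp [potentialCoeff]
  | succ n ih =>
    rw [potentialCoeff]
    have : (0 : ℝ) ≤ n := n.cast_nonneg
    exact mul_pos ih (div_pos (by linarith) (by linarith))

/-- The recursion (n + 1) π_(n+1) = (n + s − 1) π_n makes n π_n nondecreasing from its value s − 1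
at n = 1. -/
theorem le_mul_potentialCoeff {s : ℝ} (hs : 1 < s) (n : ℕ) :
    s - 1 ≤ (n + 1 : ℝ) * potentialCoeff s (n + 1) := by
  have hstep : ∀ n : ℕ, (n + 1 : ℝ) * potentialCoeff s (n + 1) =
      potentialCoeff s n * (n + s - 1) := by
    intro n
    rw [potentialCoeff]
    have : (n + 1 : ℝ) ≠ 0 := by positivity
    field_simp
  induction n with
  | zero => rw [hstep]; simp [potentialCoeff]
  | succ n ih =>
    rw [hstep]
    have h1 := potentialCoeff_pos hs (n + 1)
    push_cast
    nlinarith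

/-- With x = (2 − s)/(n + 1), the recursion factor is 1 − x, Bernoulli bounds ((n+2)/(n+1))^(2−s) by
1 + x, and (1 − x)(1 + x) ≤ 1. -/
theorem potentialCoeff_le {s : ℝ} (hs : 1 < s) (hs2 : s < 2) (n : ℕ) :
    potentialCoeff s n ≤ (n + 1 : ℝ) ^ (s - 2) := by
  induction n with
  | zero => simp [potentialCoeff]
  | succ n ih =>
    have hn : (0 : ℝ) ≤ n := n.cast_nonneg
    have hn1 : (0 : ℝ) < n + 1 := by linarith
    have hn2 : (0 : ℝ) < n + 2 := by linarith
    rw [potentialCoeff]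
    push_cast
    have e : (n + 1 + 1 : ℝ) = n + 2 := by ring
    rw [e]
    have hq : 0 ≤ (n + s - 1) / (n + 1 : ℝ) := div_nonneg (by linarith) hn1.le
    refine (mul_le_mul_of_nonneg_right ih hq).trans ?_
    have hb : (1 + 1 / (n + 1 : ℝ)) ^ (2 - s) ≤ 1 + (2 - s) * (1 / (n + 1 : ℝ)) :=
      rpow_one_add_le_one_add_mul_self (by
        have : (0 : ℝ) ≤ 1 / (n + 1 : ℝ) := by positivity
        linarith) (by linarith) (by linarith)
    have e1 : (1 + 1 / (n + 1 : ℝ)) = (n + 2) / (n + 1) := by field_simp; ring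
    rw [e1, Real.div_rpow hn2.le hn1.le] at hb
    have p1 : 0 < (n + 1 : ℝ) ^ (2 - s) := Real.rpow_pos_of_pos hn1 _
    have p2 : 0 < (n + 2 : ℝ) ^ (2 - s) := Real.rpow_pos_of_pos hn2 _
    have e2 : (s - 2 : ℝ) = -(2 - s) := by ring
    rw [e2, Real.rpow_neg hn1.le, Real.rpow_neg hn2.le]
    rw [div_le_iff₀ p1] at hb
    rw [inv_mul_le_iff₀ p1, ← div_eq_mul_inv, le_div_iff₀ p2]
    calc (n + s - 1) / (n + 1 : ℝ) * (n + 2) ^ (2 - s)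
        ≤ (n + s - 1) / (n + 1 : ℝ) * ((1 + (2 - s) * (1 / (n + 1 : ℝ))) * (n + 1) ^ (2 - s)) :=
          mul_le_mul_of_nonneg_left hb hq
      _ = ((1 - (2 - s) * (1 / (n + 1 : ℝ))) * (1 + (2 - s) * (1 / (n + 1 : ℝ)))) *
            (n + 1) ^ (2 - s) := by
          have : (n + s - 1) / (n + 1 : ℝ) = 1 - (2 - s) * (1 / (n + 1 : ℝ)) := by
            field_simp; ring
          rw [this]; ring
      _ ≤ 1 * (n + 1 : ℝ) ^ (2 - s) := by
          refine mul_le_mul_of_nonneg_right ?_ p1.le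
          nlinarith [sq_nonneg ((2 - s) * (1 / (n + 1 : ℝ)))]
      _ = _ := one_mul _

/-- For z = n(n + s − 1) > 0 the left side is at most z^(s−1), which is at most k^(s−1) if z ≤ k and
at most k^(s−2) z otherwise. The scale k is free, to be matched with the power x^k later. -/
theorem mul_potentialCoeff_sq_le {s k : ℝ} (hs : 1 < s) (hs2 : s < 2) (hk : 0 < k) (n : ℕ) :
    n * (n + s - 1) * potentialCoeff s n ^ 2 ≤ k ^ (s - 1) + k ^ (s - 2) * (n * (n + s - 1)) := by
  rcases Nat.eq_zero_or_pos n with rfl | hn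
  · simpa using Real.rpow_nonneg hk.le _
  have hn1 : (1 : ℝ) ≤ n := by exact_mod_cast hn
  set z : ℝ := n * (n + s - 1) with hz
  have hz0 : 0 < z := mul_pos (by linarith) (by linarith)
  have hzle : z ≤ ((n + 1 : ℝ)) ^ 2 := by rw [hz]; nlinarith
  have hπ : potentialCoeff s n ^ 2 ≤ z ^ (s - 2) := by
    have h1 := potentialCoeff_le hs hs2 n
    have h2 := potentialCoeff_pos hs n
    have hp : (0 : ℝ) < n + 1 := by linarith
    calc potentialCoeff s n ^ 2 ≤ ((n + 1 : ℝ) ^ (s - 2)) ^ 2 := by gcongr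
      _ = (((n + 1 : ℝ)) ^ 2) ^ (s - 2) := by
          rw [← Real.rpow_natCast, ← Real.rpow_natCast, ← Real.rpow_mul hp.le,
            ← Real.rpow_mul hp.le, mul_comm]
      _ ≤ z ^ (s - 2) := Real.rpow_le_rpow_of_nonpos hz0 hzle (by linarith)
  have h3 : z * potentialCoeff s n ^ 2 ≤ z * z ^ (s - 2) :=
    mul_le_mul_of_nonneg_left hπ hz0.le
  have hk1 := Real.rpow_nonneg hk.le (s - 1)
  have hk2 := Real.rpow_nonneg hk.le (s - 2)
  rcases le_total z k with hle | hle
  · have e : z * z ^ (s - 2) = z ^ (s - 1) := by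
      rw [mul_comm, ← Real.rpow_add_one hz0.ne']; ring_nf
    have := Real.rpow_le_rpow hz0.le hle (z := s - 1) (by linarith)
    nlinarith
  · have := Real.rpow_le_rpow_of_nonpos hk hle (z := s - 2) (by linarith)
    nlinarith

/-! ### Two-sided bounds for the differentiated potential -/

theorem IsPotentialMap.isTriangular {a b r c : ℝ} {Q : ℝ[X] →ₗ[ℝ] ℝ[X]}
    (hQ : IsPotentialMap a b r c Q) : IsTriangular Q 0 fun n => c * potentialCoeff (a + b) n :=
  fun n => ⟨hQ.natDegree_le n, hQ.coeff_eq n⟩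

theorem isTriangular_weightedDeriv (a b : ℝ) :
    IsTriangular (weightedDeriv a b) 1 fun n => -(n + a + b) := by
  intro n
  have e : weightedDeriv a b (X ^ n) = C (b + n) * X ^ n - C (n + a + b) * X ^ (n + 1) := by
    rw [weightedDeriv_apply]
    rcases n with _ | n
    · simp
    · simp only [derivative_X_pow, Nat.add_sub_cancel, map_add, map_natCast]
      push_cast
      ring
  rw [e]
  constructor
  · refine (natDegree_sub_le _ _).trans (max_le ?_ ?_)
    · exact (natDegree_C_mul_X_pow_le _ _).trans (by omega)
    · exact natDegree_C_mul_X_pow_le _ _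
  · rw [coeff_sub, coeff_C_mul, coeff_C_mul, coeff_X_pow, coeff_X_pow]
    simp

/-- At n = 0 the truncated difference n − 1 is harmless because of the factor n. -/
theorem isTriangular_derivative_comp {c : ℕ → ℝ} {T U : ℝ[X] →ₗ[ℝ] ℝ[X]} {τ : ℕ → ℝ}
    (hU : IsTriangular U 0 c) (hT : IsTriangular T 1 τ) :
    IsTriangular (T ∘ₗ derivative ∘ₗ U) 0 fun n => n * τ (n - 1) * c n := by
  intro n
  obtain ⟨h1, h2⟩ := hU n
  rcases n with _ | n
  · have : derivative (U (X ^ 0)) = 0 := by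
      rw [eq_C_of_natDegree_le_zero h1, derivative_C]
    simp only [LinearMap.comp_apply, this]
    simp
  · have h3 : (derivative (U (X ^ (n + 1)))).natDegree ≤ n :=
      (natDegree_derivative_le _).trans (by omega)
    obtain ⟨h4, h5⟩ := hT.apply h3
    refine ⟨h4, ?_⟩
    simp only [LinearMap.comp_apply, add_zero, Nat.add_sub_cancel]
    rw [add_zero] at h2
    rw [h5, coeff_derivative, h2]
    push_cast
    ring

theorem IsTriangular.comp {T U : ℝ[X] →ₗ[ℝ] ℝ[X]} {s : ℕ} {τ υ : ℕ → ℝ}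
    (hT : IsTriangular T 0 τ) (hU : IsTriangular U s υ) :
    IsTriangular (T ∘ₗ U) s fun n => τ (n + s) * υ n := by
  intro n
  obtain ⟨h1, h2⟩ := hU n
  obtain ⟨h3, h4⟩ := hT.apply h1
  exact ⟨h3, by rw [h2] at h4; exact h4⟩

theorem IsTriangular.smul {T : ℝ[X] →ₗ[ℝ] ℝ[X]} {s : ℕ} {τ : ℕ → ℝ} (k : ℝ)
    (hT : IsTriangular T s τ) : IsTriangular (k • T) s fun n => k * τ n := fun n =>
  ⟨(natDegree_smul_le _ _).trans (hT n).1, by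
    rw [LinearMap.smul_apply, coeff_smul, (hT n).2, smul_eq_mul]⟩

theorem IsTriangular.add {T U : ℝ[X] →ₗ[ℝ] ℝ[X]} {s : ℕ} {τ υ : ℕ → ℝ}
    (hT : IsTriangular T s τ) (hU : IsTriangular U s υ) :
    IsTriangular (T + U) s fun n => τ n + υ n := fun n =>
  ⟨(natDegree_add_le _ _).trans (max_le (hT n).1 (hU n).1), by
    rw [LinearMap.add_apply, coeff_add, (hT n).2, (hU n).2]⟩

theorem isTriangular_id : IsTriangular LinearMap.id 0 fun _ => 1 := fun n => by simp

section Bounds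

variable {a b r c c' : ℝ} {Q Q' : ℝ[X] →ₗ[ℝ] ℝ[X]}

/-- The Gram operator of `q ↦ (Q q)'`. -/
noncomputable def gramMap (a b : ℝ) (Q Q' : ℝ[X] →ₗ[ℝ] ℝ[X]) : ℝ[X] →ₗ[ℝ] ℝ[X] :=
  ((-1 : ℝ) • Q') ∘ₗ weightedDeriv a b ∘ₗ derivative ∘ₗ Q

theorem polyInt_mul_gramMap (h : Admissible a b r) (hQ : IsPotentialMap a b r c Q)
    (hQ' : IsPotentialMap b a (1 - r) c' Q') (p q : ℝ[X]) :
    polyInt (b - 1) (a - 1) (p * gramMap a b Q Q' q) =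
      polyInt a b (derivative (Q p) * derivative (Q q)) := by
  rw [polyInt_potential_adjoint h hQ hQ']
  simp [gramMap]

theorem isTriangular_gramMap (hQ : IsPotentialMap a b r c Q)
    (hQ' : IsPotentialMap b a (1 - r) c' Q') :
    IsTriangular (gramMap a b Q Q') 0 fun n =>
      c * c' * (n * (n + (a + b) - 1) * potentialCoeff (a + b) n ^ 2) := by
  have h1 := isTriangular_derivative_comp hQ.isTriangular
    ((hQ'.isTriangular.smul (-1)).comp (isTriangular_weightedDeriv a b))
  intro n
  obtain ⟨h2, h3⟩ := h1 n
  refine ⟨h2, h3.trans ?_⟩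
  rcases n with _ | n
  · simp
  · rw [add_comm b a]
    simp only [Nat.add_sub_cancel]
    push_cast
    ring

theorem isTriangular_neg_weightedDeriv_derivative (a b : ℝ) :
    IsTriangular ((-1 : ℝ) • (weightedDeriv b a ∘ₗ derivative)) 0 fun n =>
      n * (n + (a + b) - 1) := by
  have h1 := (isTriangular_derivative_comp isTriangular_id (isTriangular_weightedDeriv b a)).smul (-1)
  intro n
  obtain ⟨h2, h3⟩ := h1 n
  refine ⟨h2, h3.trans ?_⟩
  rcases n with _ | n
  · simp
  · simp only [Nat.add_sub_cancel]
    push_cast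
    ring

/-- The Gram operator, the identity and the Jacobi operator D, whose form is the weighted Dirichlet
integral and whose eigenvalues are n(n + a + b − 1), are all symmetric and triangular. The
eigenvalue inequality `mul_potentialCoeff_sq_le` therefore passes to the forms. -/
theorem polyInt_derivative_potential_le (h : Admissible a b r) (hQ : IsPotentialMap a b r c Q)
    (hQ' : IsPotentialMap b a (1 - r) c' Q') (hc : 0 < c) (hc' : 0 < c') {k : ℝ} (hk : 0 < k)
    (q : ℝ[X]) :
    polyInt a b (derivative (Q q) * derivative (Q q)) ≤
      c * c' * (k ^ (a + b - 1) * polyInt (b - 1) (a - 1) (q * q) +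
        k ^ (a + b - 2) * polyInt b a (derivative q * derivative q)) := by
  have ha := h.a_pos
  have hb := h.b_pos
  set D : ℝ[X] →ₗ[ℝ] ℝ[X] := (-1 : ℝ) • (weightedDeriv b a ∘ₗ derivative) with hD
  have hDs : ∀ p q, polyInt (b - 1) (a - 1) (p * D q) = polyInt b a (derivative q * derivative p) := by
    intro p q
    rw [polyInt_mul_derivative hb ha, hD]
    simp [mul_comm]
  have key := nonneg_of_isTriangular (polyInt (b - 1) (a - 1))
    (fun q hq => polyInt_mul_self_pos (by linarith) (by linarith) hq)
    ((c * c' * k ^ (a + b - 1)) • LinearMap.id + (c * c' * k ^ (a + b - 2)) • D +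
      (-1 : ℝ) • gramMap a b Q Q') (fun p q => by
        simp only [LinearMap.add_apply, LinearMap.smul_apply, LinearMap.id_apply, mul_add, add_mul,
          map_add, mul_smul_comm, smul_mul_assoc, map_smul, hDs, polyInt_mul_gramMap h hQ hQ',
          mul_comm (D p), mul_comm (gramMap a b Q Q' p), mul_comm (derivative q),
          mul_comm (derivative (Q q))])
      (fun n => by
        have h1 := mul_potentialCoeff_sq_le h.one_lt h.lt_two hk n
        have h2 := mul_le_mul_of_nonneg_left h1 (mul_pos hc hc').le
        have : 0 ≤ c * c' * k ^ (a + b - 1) * 1 +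
            c * c' * k ^ (a + b - 2) * (n * (n + (a + b) - 1)) +
            -1 * (c * c' * (n * (n + (a + b) - 1) * potentialCoeff (a + b) n ^ 2)) := by linarith
        exact this)
      (((isTriangular_id.smul _).add ((isTriangular_neg_weightedDeriv_derivative a b).smul _)).add
        ((isTriangular_gramMap hQ hQ').smul _)) q
  simp only [LinearMap.add_apply, LinearMap.smul_apply, LinearMap.id_apply, mul_add,
    map_add, mul_smul_comm, map_smul, hDs, polyInt_mul_gramMap h hQ hQ', smul_eq_mul] at key
  linarith

/-- The Gram operator kills constants, so κP is added, P being the projection onto constants: κP − κ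
+ Gram has eigenvalue 0 at n = 0 and nonnegative ones after that. On q of mean zero P drops out. -/
theorem le_polyInt_derivative_potential (h : Admissible a b r) (hQ : IsPotentialMap a b r c Q)
    (hQ' : IsPotentialMap b a (1 - r) c' Q') (hc : 0 < c) (hc' : 0 < c')
    {q : ℝ[X]} (hq : polyInt (b - 1) (a - 1) q = 0) :
    c * c' * (a + b - 1) ^ 2 * polyInt (b - 1) (a - 1) (q * q) ≤
      polyInt a b (derivative (Q q) * derivative (Q q)) := by
  have ha := h.a_pos
  have hb := h.b_pos
  set L := polyInt (b - 1) (a - 1) with hL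
  set κ := c * c' * (a + b - 1) ^ 2 with hκ
  have hκ0 : 0 ≤ κ := mul_nonneg (mul_pos hc hc').le (sq_nonneg _)
  have hL1 : 0 < L 1 := by
    have := polyInt_mul_self_pos (p := b - 1) (q := a - 1) (f := 1) (by linarith) (by linarith)
      one_ne_zero
    rwa [mul_one] at this
  let P : ℝ[X] →ₗ[ℝ] ℝ[X] := Polynomial.CAlgHom.toLinearMap ∘ₗ ((L 1)⁻¹ • L)
  have hP : ∀ q, P q = ((L 1)⁻¹ * L q) • (1 : ℝ[X]) := fun q => by
    simp only [P, LinearMap.comp_apply, LinearMap.smul_apply, smul_eq_mul, smul_eq_C_mul, mul_one]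
    rfl
  have hR : IsTriangular (κ • P + (-κ) • LinearMap.id + gramMap a b Q Q') 0 fun n =>
      (if n = 0 then κ else 0) + -κ * 1 +
        c * c' * (n * (n + (a + b) - 1) * potentialCoeff (a + b) n ^ 2) := by
    refine IsTriangular.add (IsTriangular.add ?_ (isTriangular_id.smul _))
      (isTriangular_gramMap hQ hQ')
    intro n
    rw [LinearMap.smul_apply, hP, smul_smul]
    refine ⟨(natDegree_smul_le _ _).trans (by simp), ?_⟩
    rw [coeff_smul, coeff_one]
    rcases n with _ | n
    · simp [hL1.ne']
    · simp
  have key := nonneg_of_isTriangular L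
    (fun q hq => polyInt_mul_self_pos (by linarith) (by linarith) hq) _ (fun p q => by
        simp only [LinearMap.add_apply, LinearMap.smul_apply, LinearMap.id_apply, mul_add, add_mul,
          map_add, mul_smul_comm, smul_mul_assoc, map_smul, hL, polyInt_mul_gramMap h hQ hQ',
          mul_comm (gramMap a b Q Q' p), mul_comm (derivative (Q q)), hP, mul_one, one_mul,
          smul_eq_mul]
        ring)
      (fun n => by
        rcases n with _ | n
        · simp
        · have h1 := le_mul_potentialCoeff h.one_lt n
          have h2 := potentialCoeff_pos h.one_lt (n + 1)
          have hs : 0 < a + b - 1 := by linarith [h.one_lt]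
          simp only [Nat.succ_ne_zero, if_false, mul_one, zero_add]
          have h3 : (a + b - 1) ^ 2 ≤ ((n + 1 : ℝ) * potentialCoeff (a + b) (n + 1)) ^ 2 := by
            gcongr
          have h4 : ((n + 1 : ℝ) * potentialCoeff (a + b) (n + 1)) ^ 2 ≤
              ((n + 1 : ℕ) : ℝ) * ((n + 1 : ℕ) + (a + b) - 1) * potentialCoeff (a + b) (n + 1) ^ 2 := by
            push_cast
            have : (0 : ℝ) ≤ n := n.cast_nonneg
            rw [mul_pow]
            refine mul_le_mul_of_nonneg_right ?_ (sq_nonneg _)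
            nlinarith
          have h5 := mul_le_mul_of_nonneg_left (h3.trans h4) (mul_pos hc hc').le
          linarith) hR q
  simp only [LinearMap.add_apply, LinearMap.smul_apply, LinearMap.id_apply, mul_add,
    map_add, mul_smul_comm, map_smul, hL, polyInt_mul_gramMap h hQ hQ', hP, smul_eq_mul] at key
  rw [← hL, hq] at key
  simp only [mul_zero, zero_mul, zero_add] at key
  linarith

end Bounds

/-! ### Weighted L² spaces and density of polynomials -/

/-- The measure `(1 - x)^p x^q dx` on `(0,1)`. -/
noncomputable def jacobiMeasure (p q : ℝ) : Measure ℝ :=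
  (volume.restrict (Ioo 0 1)).withDensity fun x => ((jacobiWeight p q x).toNNReal : ENNReal)

theorem integral_jacobiMeasure (p q : ℝ) (g : ℝ → ℝ) :
    ∫ x, g x ∂(jacobiMeasure p q) = ∫ x in Ioo (0 : ℝ) 1, jacobiWeight p q x * g x := by
  rw [jacobiMeasure, integral_withDensity_eq_integral_smul (by fun_prop)]
  refine setIntegral_congr_fun measurableSet_Ioo fun x hx => ?_
  simp [NNReal.smul_def, (jacobiWeight_pos p q hx).le]

theorem integrable_jacobiMeasure_iff (p q : ℝ) (g : ℝ → ℝ) :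
    Integrable g (jacobiMeasure p q) ↔ IntegrableOn (fun x => jacobiWeight p q x * g x) (Ioo 0 1) := by
  rw [jacobiMeasure, integrable_withDensity_iff_integrable_smul (by fun_prop)]
  refine integrableOn_congr_fun (fun x hx => ?_) measurableSet_Ioo
  simp [NNReal.smul_def, (jacobiWeight_pos p q hx).le]

theorem memLp_jacobiMeasure {p q : ℝ} {g : ℝ → ℝ}
    (hg : AEStronglyMeasurable g (volume.restrict (Ioo 0 1)))
    (hi : IntegrableOn (fun x => jacobiWeight p q x * g x ^ 2) (Ioo 0 1)) :
    MemLp g 2 (jacobiMeasure p q) := by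
  refine (memLp_two_iff_integrable_sq
    (hg.mono_ac (withDensity_absolutelyContinuous _ _))).2 ?_
  exact (integrable_jacobiMeasure_iff p q _).2 hi

theorem isFiniteMeasure_jacobiMeasure {p q : ℝ} (hp : -1 < p) (hq : -1 < q) :
    IsFiniteMeasure (jacobiMeasure p q) :=
  isFiniteMeasure_withDensity_ofReal (integrableOn_jacobiWeight hp hq).2

theorem memLp_eval {p q : ℝ} (hp : -1 < p) (hq : -1 < q) (f : ℝ[X]) :
    MemLp (fun x => f.eval x) 2 (jacobiMeasure p q) := by
  refine memLp_jacobiMeasure f.continuous.aestronglyMeasurable ?_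
  simp only [pow_two, ← eval_mul]
  exact integrableOn_jacobiWeight_mul_eval hp hq (f * f)

theorem polyInt_mul_eq {p q : ℝ} (hp : -1 < p) (hq : -1 < q) (f g : ℝ[X]) :
    polyInt p q (f * g) = ∫ x, f.eval x * g.eval x ∂(jacobiMeasure p q) := by
  rw [integral_jacobiMeasure, polyInt_eq hp hq]
  simp only [eval_mul]

theorem sq_integral_mul_le {μ : Measure ℝ} {f g : ℝ → ℝ} (hf : MemLp f 2 μ) (hg : MemLp g 2 μ) :
    (∫ x, f x * g x ∂μ) ^ 2 ≤ (∫ x, f x ^ 2 ∂μ) * ∫ x, g x ^ 2 ∂μ := by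
  have hff := hf.integrable_sq
  have hgg := hg.integrable_sq
  have hfg : Integrable (fun x => f x * g x) μ := hf.integrable_mul hg
  have h := discrim_le_zero (a := ∫ x, g x ^ 2 ∂μ) (b := 2 * ∫ x, f x * g x ∂μ)
    (c := ∫ x, f x ^ 2 ∂μ) fun t => by
      have h0 : 0 ≤ ∫ x, (t * g x + f x) ^ 2 ∂μ := integral_nonneg fun x => sq_nonneg _
      have e : ∫ x, (t * g x + f x) ^ 2 ∂μ = ∫ x, ((t * t) * g x ^ 2 + (2 * t) * (f x * g x)) +
          f x ^ 2 ∂μ := integral_congr_ae (ae_of_all _ fun x => by simp only; ring)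
      have hsum : Integrable (fun x => (t * t) * g x ^ 2 + (2 * t) * (f x * g x)) μ :=
        (hgg.const_mul _).add (hfg.const_mul _)
      rw [e, integral_add hsum hff,
        integral_add (hgg.const_mul _) (hfg.const_mul _), integral_const_mul,
        integral_const_mul] at h0
      linarith
  rw [discrim] at h
  nlinarith

/-- Bounded continuous functions are dense in L², and Weierstrass approximates them uniformly on
[0,1], which suffices for a finite measure. -/
theorem exists_polynomial_integral_sq_sub_le {p q : ℝ} (hp : -1 < p) (hq : -1 < q) {v : ℝ → ℝ}
    (hv : MemLp v 2 (jacobiMeasure p q)) {ε : ℝ} (hε : 0 < ε) :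
    ∃ f : ℝ[X], ∫ x, (v x - f.eval x) ^ 2 ∂(jacobiMeasure p q) ≤ ε := by
  have hfin := isFiniteMeasure_jacobiMeasure hp hq
  set μ := jacobiMeasure p q with hμ
  obtain ⟨g, hg, hgL⟩ := MemLp.exists_boundedContinuous_integral_rpow_sub_le (p := 2)
    two_pos (μ := μ) (f := v) (by simpa using hv) (ε := ε / 4) (by linarith)
  have hgL' : MemLp (g : ℝ → ℝ) 2 μ := by simpa using hgL
  have hg' : ∫ x, (v x - g x) ^ 2 ∂μ ≤ ε / 4 := by
    refine le_trans (le_of_eq ?_) hg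
    refine integral_congr_ae (ae_of_all _ fun x => ?_)
    simp
  set M : ℝ := μ.real univ
  have hM : 0 ≤ M := measureReal_nonneg
  -- Chosen so that M δ² ≤ ε/4, even if M = 0; (x + y)² ≤ 2x² + 2y² then adds two errors ε/4 to at
  -- most ε.
  set δ := Real.sqrt (ε / (4 * (M + 1))) with hδ
  have hδ0 : 0 < δ := Real.sqrt_pos.2 (by positivity)
  have hδ2 : δ ^ 2 = ε / (4 * (M + 1)) := Real.sq_sqrt (by positivity)
  obtain ⟨f, hf⟩ := exists_polynomial_near_of_continuousOn 0 1 g g.continuous.continuousOn δ hδ0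
  have hfL : MemLp (fun x => f.eval x) 2 μ := memLp_eval hp hq f
  refine ⟨f, ?_⟩
  have hae : ∀ᵐ x ∂μ, x ∈ Ioo (0 : ℝ) 1 :=
    (withDensity_absolutelyContinuous _ _).ae_le (ae_restrict_mem measurableSet_Ioo)
  have h2 : ∫ x, (g x - f.eval x) ^ 2 ∂μ ≤ ε / 4 := by
    calc ∫ x, (g x - f.eval x) ^ 2 ∂μ ≤ ∫ _, δ ^ 2 ∂μ := by
          refine integral_mono_ae (hgL'.sub hfL).integrable_sq (integrable_const _) ?_
          filter_upwards [hae] with x hx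
          have h1 := hf x ⟨hx.1.le, hx.2.le⟩
          rw [abs_sub_comm] at h1
          exact sq_le_sq' (by linarith [(abs_lt.1 h1).1]) (abs_lt.1 h1).2.le
      _ = M * (ε / (4 * (M + 1))) := by rw [integral_const, hδ2, smul_eq_mul]
      _ ≤ ε / 4 := by
          rw [← mul_div_assoc, div_le_div_iff₀ (by positivity) (by norm_num)]
          nlinarith
  have i1 : Integrable (fun x => (v x - g x) ^ 2) μ := (hv.sub hgL').integrable_sq
  have i2 : Integrable (fun x => (g x - f.eval x) ^ 2) μ := (hgL'.sub hfL).integrable_sq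
  calc ∫ x, (v x - f.eval x) ^ 2 ∂μ ≤ ∫ x, 2 * (v x - g x) ^ 2 + 2 * (g x - f.eval x) ^ 2 ∂μ := by
        refine integral_mono (hv.sub hfL).integrable_sq ((i1.const_mul 2).add (i2.const_mul 2)) ?_
        intro x
        simp only
        nlinarith [sq_nonneg ((v x - g x) - (g x - f.eval x))]
    _ = 2 * (∫ x, (v x - g x) ^ 2 ∂μ) + 2 * ∫ x, (g x - f.eval x) ^ 2 ∂μ := by
        rw [integral_add (i1.const_mul 2) (i2.const_mul 2), integral_const_mul, integral_const_mul]
    _ ≤ ε := by linarith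

/-! ### Norms of x^k and (1−x)^k -/

/-- The inequality 1 − x ≤ exp(−x) gives comparison with the Gamma integral of x^(a−1) exp(−k x). -/
theorem integral_jacobiWeight_le {a e k : ℝ} (ha : 0 < a) (hk : 0 < k) (he : k ≤ e) :
    ∫ x in Ioo (0 : ℝ) 1, jacobiWeight e (a - 1) x ≤ (1 / k) ^ a * Real.Gamma a := by
  rw [← Real.integral_rpow_mul_exp_neg_mul_Ioi ha hk]
  have hi : IntegrableOn (fun t : ℝ => t ^ (a - 1) * Real.exp (-(k * t))) (Ioi 0) := by
    refine Integrable.of_integral_ne_zero ?_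
    rw [Real.integral_rpow_mul_exp_neg_mul_Ioi ha hk]
    have := Real.Gamma_pos_of_pos ha
    positivity
  refine le_trans ?_ (setIntegral_mono_set hi ?_ (LE.le.eventuallyLE (Ioo_subset_Ioi_self (b := (0 : ℝ)) (a := 1))))
  · refine setIntegral_mono_on (integrableOn_jacobiWeight (by linarith) (by linarith))
      (hi.mono_set Ioo_subset_Ioi_self) measurableSet_Ioo fun x hx => ?_
    have h1 : 0 < 1 - x := by linarith [hx.2]
    rw [jacobiWeight, mul_comm]
    refine mul_le_mul_of_nonneg_left ?_ (Real.rpow_nonneg hx.1.le _)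
    calc (1 - x) ^ e ≤ (1 - x) ^ k :=
          Real.rpow_le_rpow_of_exponent_ge h1 (by linarith [hx.1]) he
      _ ≤ (Real.exp (-x)) ^ k := Real.rpow_le_rpow h1.le (Real.one_sub_le_exp_neg x) hk.le
      _ = Real.exp (-(k * x)) := by rw [← Real.exp_mul]; ring_nf
  · filter_upwards [ae_restrict_mem measurableSet_Ioi] with x hx
    exact mul_nonneg (Real.rpow_nonneg (le_of_lt hx) _) (Real.exp_pos _).le

theorem polyInt_reflect {p q : ℝ} (hp : -1 < p) (hq : -1 < q) (f : ℝ[X]) :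
    polyInt p q (f.comp (1 - X)) = polyInt q p f := by
  rw [polyInt_eq hp hq, polyInt_eq hq hp]
  have h := (Measure.measurePreserving_sub_left (volume : Measure ℝ) 1).setIntegral_preimage_emb
    (Homeomorph.subLeft (1 : ℝ)).measurableEmbedding (fun x => jacobiWeight q p x * f.eval x)
    (Ioo 0 1)
  rw [← h]
  simp only [preimage_const_sub_Ioo, sub_self, sub_zero, jacobiWeight_reflect]
  simp

theorem polyInt_one_sub_X_pow_le {a b : ℝ} (ha : 0 < a) (hb : 0 < b) {k : ℕ} (hk : 1 ≤ k) :
    polyInt (b - 1) (a - 1) ((1 - X) ^ k * (1 - X) ^ k) ≤ (1 / (k : ℝ)) ^ a * Real.Gamma a := by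
  have hk1 : (1 : ℝ) ≤ k := by exact_mod_cast hk
  refine le_trans (le_of_eq ?_) (integral_jacobiWeight_le (e := b - 1 + (k + k : ℕ)) (k := k) ha
    (by linarith) (by push_cast; linarith))
  rw [polyInt_eq (by linarith) (by linarith)]
  refine setIntegral_congr_fun measurableSet_Ioo fun x hx => ?_
  have h1 : 0 < 1 - x := by linarith [hx.2]
  simp only [jacobiWeight, eval_mul, eval_pow, eval_sub, eval_one, eval_X]
  rw [Real.rpow_add_natCast h1.ne', pow_add]
  ring

/-- The exponent b + 2(k − 1) reaches the k required by the Gamma comparison once k ≥ 2. -/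
theorem polyInt_derivative_one_sub_X_pow_le {a b : ℝ} (ha : 0 < a) (hb : 0 < b) {k : ℕ}
    (hk : 2 ≤ k) :
    polyInt b a (derivative ((1 - X) ^ k) * derivative ((1 - X) ^ k)) ≤
      (k : ℝ) ^ 2 * ((1 / (k : ℝ)) ^ (a + 1) * Real.Gamma (a + 1)) := by
  have hk1 : (2 : ℝ) ≤ k := by exact_mod_cast hk
  have hc : ((k - 1 : ℕ) : ℝ) = k - 1 := by push_cast [show 1 ≤ k by omega]; ring
  refine le_trans (le_of_eq ?_) (mul_le_mul_of_nonneg_left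
    (integral_jacobiWeight_le (e := b + ((k - 1) + (k - 1) : ℕ)) (k := k) (a := a + 1) (by linarith)
    (by linarith) (by rw [Nat.cast_add, hc]; linarith)) (sq_nonneg _))
  rw [polyInt_eq (by linarith) (by linarith), ← integral_const_mul]
  refine setIntegral_congr_fun measurableSet_Ioo fun x hx => ?_
  have h1 : 0 < 1 - x := by linarith [hx.2]
  simp only [jacobiWeight, derivative_pow, eval_mul, eval_pow, eval_sub, eval_one, eval_X,
    derivative_sub, derivative_one, derivative_X, add_sub_cancel_right, eval_C, zero_sub,
    eval_neg]
  rw [Real.rpow_add_natCast h1.ne', pow_add]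
  ring

theorem polyInt_X_pow_le {a b : ℝ} (ha : 0 < a) (hb : 0 < b) {k : ℕ} (hk : 1 ≤ k) :
    polyInt (b - 1) (a - 1) (X ^ k * X ^ k) ≤ (1 / (k : ℝ)) ^ b * Real.Gamma b := by
  rw [← polyInt_reflect (by linarith) (by linarith)]
  simpa using polyInt_one_sub_X_pow_le hb ha hk

theorem polyInt_derivative_X_pow_le {a b : ℝ} (ha : 0 < a) (hb : 0 < b) {k : ℕ} (hk : 2 ≤ k) :
    polyInt b a (derivative (X ^ k) * derivative (X ^ k)) ≤
      (k : ℝ) ^ 2 * ((1 / (k : ℝ)) ^ (b + 1) * Real.Gamma (b + 1)) := by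
  rw [← polyInt_reflect (by linarith) (by linarith)]
  refine le_trans (le_of_eq ?_) (polyInt_derivative_one_sub_X_pow_le hb ha hk)
  congr 1
  have e : derivative ((1 - X : ℝ[X]) ^ k) = -(derivative (X ^ k)).comp (1 - X) := by
    rw [← X_pow_comp, derivative_comp]
    simp
  rw [e, mul_comp]
  ring

theorem tendsto_zero_of_sq_le {x y : ℕ → ℝ} (h : ∀ᶠ k in atTop, x k ^ 2 ≤ y k)
    (hy : Tendsto y atTop (𝓝 0)) : Tendsto x atTop (𝓝 0) := by
  have h1 : Tendsto (fun k => Real.sqrt (y k)) atTop (𝓝 0) := by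
    have := (Real.continuous_sqrt.tendsto 0).comp hy
    rwa [Real.sqrt_zero] at this
  refine squeeze_zero_norm' ?_ h1
  filter_upwards [h] with k hk
  exact Real.abs_le_sqrt hk

theorem integral_mul_add_smul {μ : Measure ℝ} {w : ℝ → ℝ} (hw : MemLp w 2 μ)
    (hf : ∀ f : ℝ[X], MemLp (fun x => f.eval x) 2 μ) :
    ∃ Λ : ℝ[X] →ₗ[ℝ] ℝ, ∀ f : ℝ[X], Λ f = ∫ x, w x * f.eval x ∂μ := by
  have hi : ∀ f : ℝ[X], Integrable (fun x => w x * f.eval x) μ := fun f => hw.integrable_mul (hf f)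
  refine ⟨⟨⟨fun f => ∫ x, w x * f.eval x ∂μ, fun f g => ?_⟩, fun k f => ?_⟩, fun f => rfl⟩
  · simp only [eval_add, mul_add]
    exact integral_add (hi f) (hi g)
  · simp only [eval_smul, smul_eq_mul, RingHom.id_apply, ← integral_const_mul]
    exact integral_congr_ae (ae_of_all _ fun x => by simp only; ring)

/-! ### The pairing identity for all polynomials, and duality -/

section Duality

variable {a b r c c' : ℝ} {Q Q' : ℝ[X] →ₗ[ℝ] ℝ[X]} {w v : ℝ → ℝ}

/-- S lowers the degree by one and multiplies leading coefficients by (n + 1) c π_(n+1) ≠ 0, so the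
leading term of p can be removed and the degree decreases. -/
theorem exists_derivative_potential_eq (h : Admissible a b r) (hQ : IsPotentialMap a b r c Q)
    (hc : 0 < c) (p : ℝ[X]) : ∃ q : ℝ[X], derivative (Q q) = p := by
  have main : ∀ n : ℕ, ∀ p ∈ degreeLT ℝ n, ∃ q : ℝ[X], derivative (Q q) = p := by
    intro n
    induction n with
    | zero =>
      intro p hp
      refine ⟨0, ?_⟩
      rw [mem_degreeLT] at hp
      have : p = 0 := by simpa using hp
      simp [this]
    | succ n ih =>
      intro p hp
      obtain ⟨h1, h2⟩ := hQ.isTriangular (n + 1)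
      set σ := (derivative (Q (X ^ (n + 1)))).coeff n with hσ
      have hσ0 : σ ≠ 0 := by
        rw [add_zero] at h2
        rw [hσ, coeff_derivative, h2]
        have := potentialCoeff_pos h.one_lt (n + 1)
        positivity
      have hmem : p - (p.coeff n / σ) • derivative (Q (X ^ (n + 1))) ∈ degreeLT ℝ n := by
        rw [mem_degreeLT, degree_lt_iff_coeff_zero]
        intro m hm
        rw [coeff_sub, coeff_smul, smul_eq_mul]
        rcases hm.eq_or_lt with rfl | hm
        · rw [← hσ, div_mul_cancel₀ _ hσ0, sub_self]
        · rw [mem_degreeLT, degree_lt_iff_coeff_zero] at hp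
          have h3 : (derivative (Q (X ^ (n + 1)))).natDegree ≤ n :=
            (natDegree_derivative_le _).trans (by omega)
          rw [hp m (by omega), coeff_eq_zero_of_natDegree_lt (p := derivative _) (by omega),
            mul_zero, sub_zero]
      obtain ⟨q, hq⟩ := ih _ hmem
      refine ⟨q + (p.coeff n / σ) • X ^ (n + 1), ?_⟩
      rw [map_add, map_smul, derivative_add, derivative_smul, hq, sub_add_cancel]
  refine main (p.natDegree + 1) p ?_
  rw [mem_degreeLT]
  exact lt_of_le_of_lt degree_le_natDegree (by exact_mod_cast Nat.lt_succ_self _)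

/-- The q k tend to 0 in norm, while S(q k) need only stay bounded: the upper bound at scale k gives
terms of order k^(a+b−1−e). Against a fixed polynomial p, ⟨p, S(q k)⟩ = ⟨S* p, q k⟩ tends to 0, so
boundedness and density give weak convergence. In the limiting case e = a + b − 1 this bound
provides no decay, so the weak argument is needed. -/
theorem tendsto_pairing_zero (h : Admissible a b r) (hQ : IsPotentialMap a b r c Q)
    (hQ' : IsPotentialMap b a (1 - r) c' Q') (hc : 0 < c) (hc' : 0 < c')
    (hw : MemLp w 2 (jacobiMeasure (b - 1) (a - 1))) (hv : MemLp v 2 (jacobiMeasure a b))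
    {q : ℕ → ℝ[X]} {e : ℝ} (he : 0 < e) (hse : a + b - 1 ≤ e)
    (h1 : ∀ k : ℕ, 2 ≤ k → polyInt (b - 1) (a - 1) (q k * q k) ≤ (1 / (k : ℝ)) ^ e * Real.Gamma e)
    (h2 : ∀ k : ℕ, 2 ≤ k → polyInt b a (derivative (q k) * derivative (q k)) ≤
      (k : ℝ) ^ 2 * ((1 / (k : ℝ)) ^ (e + 1) * Real.Gamma (e + 1))) :
    Tendsto (fun k => (∫ x, w x * (q k).eval x ∂(jacobiMeasure (b - 1) (a - 1))) +
      ∫ x, v x * (derivative (Q (q k))).eval x ∂(jacobiMeasure a b)) atTop (𝓝 0) := by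
  have ha := h.a_pos
  have hb := h.b_pos
  set μ₁ := jacobiMeasure (b - 1) (a - 1) with hμ₁
  set μ₂ := jacobiMeasure a b with hμ₂
  have m1 : ∀ f : ℝ[X], MemLp (fun x => f.eval x) 2 μ₁ := memLp_eval (by linarith) (by linarith)
  have m2 : ∀ f : ℝ[X], MemLp (fun x => f.eval x) 2 μ₂ := memLp_eval (by linarith) (by linarith)
  have i1 : ∀ f g : ℝ[X], polyInt (b - 1) (a - 1) (f * g) = ∫ x, f.eval x * g.eval x ∂μ₁ :=
    polyInt_mul_eq (by linarith) (by linarith)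
  have i2 : ∀ f g : ℝ[X], polyInt a b (f * g) = ∫ x, f.eval x * g.eval x ∂μ₂ :=
    polyInt_mul_eq (by linarith) (by linarith)
  have i1s : ∀ f : ℝ[X], polyInt (b - 1) (a - 1) (f * f) = ∫ x, f.eval x ^ 2 ∂μ₁ := fun f => by
    rw [i1]; simp only [← pow_two]
  have i2s : ∀ f : ℝ[X], polyInt a b (f * f) = ∫ x, f.eval x ^ 2 ∂μ₂ := fun f => by
    rw [i2]; simp only [← pow_two]
  have hlim : Tendsto (fun k => polyInt (b - 1) (a - 1) (q k * q k)) atTop (𝓝 0) := by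
    have hp : Tendsto (fun k : ℕ => (1 / (k : ℝ)) ^ e * Real.Gamma e) atTop (𝓝 0) := by
      have := (tendsto_one_div_atTop_nhds_zero_nat (𝕜 := ℝ)).rpow_const (p := e) (Or.inr he.le)
      rw [Real.zero_rpow he.ne'] at this
      simpa using this.mul_const (Real.Gamma e)
    refine squeeze_zero' (Eventually.of_forall fun k => ?_) ?_ hp
    · rw [i1]; exact integral_nonneg fun x => mul_self_nonneg _
    · filter_upwards [eventually_ge_atTop 2] with k hk using h1 k hk
  have hw1 : ∀ g : ℝ → ℝ, MemLp g 2 μ₁ →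
      Tendsto (fun k => ∫ x, g x * (q k).eval x ∂μ₁) atTop (𝓝 0) := by
    intro g hg
    refine tendsto_zero_of_sq_le (Eventually.of_forall fun k => sq_integral_mul_le hg (m1 (q k))) ?_
    have := hlim.const_mul (∫ x, g x ^ 2 ∂μ₁)
    simpa only [i1s, mul_zero] using this
  set K := c * c' * (Real.Gamma e + Real.Gamma (e + 1)) with hK
  have hΓ1 := Real.Gamma_pos_of_pos he
  have hΓ2 := Real.Gamma_pos_of_pos (s := e + 1) (by linarith)
  have hK0 : 0 < K := by positivity
  have hbd : ∀ k : ℕ, 2 ≤ k → ∫ x, (derivative (Q (q k))).eval x ^ 2 ∂μ₂ ≤ K := by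
    intro k hk
    have hk1 : (1 : ℝ) ≤ k := by exact_mod_cast (by omega : 1 ≤ k)
    have hk0 : (0 : ℝ) < k := by linarith
    have h3 := polyInt_derivative_potential_le h hQ hQ' hc hc' hk0 (q k)
    rw [i2s] at h3
    refine h3.trans ?_
    rw [hK]
    refine mul_le_mul_of_nonneg_left ?_ (mul_pos hc hc').le
    have e1 : (k : ℝ) ^ (a + b - 1) * (1 / (k : ℝ)) ^ e ≤ 1 := by
      rw [one_div, Real.inv_rpow hk0.le, ← Real.rpow_neg hk0.le, ← Real.rpow_add hk0]
      exact Real.rpow_le_one_of_one_le_of_nonpos hk1 (by linarith)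
    have e2 : (k : ℝ) ^ (a + b - 2) * ((k : ℝ) ^ 2 * (1 / (k : ℝ)) ^ (e + 1)) ≤ 1 := by
      rw [one_div, Real.inv_rpow hk0.le, ← Real.rpow_neg hk0.le, ← Real.rpow_natCast (k : ℝ) 2,
        ← Real.rpow_add hk0, ← Real.rpow_add hk0]
      refine Real.rpow_le_one_of_one_le_of_nonpos hk1 ?_
      push_cast
      linarith
    have p1 := Real.rpow_nonneg hk0.le (a + b - 1)
    have p2 := Real.rpow_nonneg hk0.le (a + b - 2)
    have h4 := mul_le_mul_of_nonneg_left (h1 k hk) p1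
    have h5 := mul_le_mul_of_nonneg_left (h2 k hk) p2
    nlinarith [mul_le_mul_of_nonneg_right e1 hΓ1.le, mul_le_mul_of_nonneg_right e2 hΓ2.le]
  have hv1 : Tendsto (fun k => ∫ x, v x * (derivative (Q (q k))).eval x ∂μ₂) atTop (𝓝 0) := by
    rw [Metric.tendsto_nhds]
    intro η hη
    obtain ⟨p, hp⟩ := exists_polynomial_integral_sq_sub_le (by linarith) (by linarith) hv
      (ε := (η / 2) ^ 2 / K) (by positivity)
    have hps : Tendsto (fun k => ∫ x, p.eval x * (derivative (Q (q k))).eval x ∂μ₂) atTop (𝓝 0) := by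
      have hA := hw1 _ (m1 (-Q' (weightedDeriv a b p)))
      refine hA.congr fun k => ?_
      rw [← i1, ← i2, mul_comm, ← polyInt_potential_adjoint h hQ hQ', mul_comm]
    filter_upwards [eventually_ge_atTop 2, (Metric.tendsto_nhds.1 hps) (η / 2) (by linarith)]
      with k hk hk2
    rw [Real.dist_eq, sub_zero] at hk2 ⊢
    have hvp : MemLp (fun x => v x - p.eval x) 2 μ₂ := hv.sub (m2 p)
    have hcs := sq_integral_mul_le hvp (m2 (derivative (Q (q k))))
    have hcs2 : (∫ x, (v x - p.eval x) * (derivative (Q (q k))).eval x ∂μ₂) ^ 2 ≤ (η / 2) ^ 2 := by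
      refine hcs.trans ((mul_le_mul hp (hbd k hk) (integral_nonneg fun x => sq_nonneg _)
        (by positivity)).trans (le_of_eq ?_))
      field_simp
    have hcs3 := abs_le_of_sq_le_sq hcs2 (by linarith)
    have hsplit : ∫ x, v x * (derivative (Q (q k))).eval x ∂μ₂ =
        (∫ x, (v x - p.eval x) * (derivative (Q (q k))).eval x ∂μ₂) +
          ∫ x, p.eval x * (derivative (Q (q k))).eval x ∂μ₂ := by
      have j1 : Integrable (fun x => (v x - p.eval x) * (derivative (Q (q k))).eval x) μ₂ :=
        hvp.integrable_mul (m2 _)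
      have j2 : Integrable (fun x => p.eval x * (derivative (Q (q k))).eval x) μ₂ :=
        (m2 p).integrable_mul (m2 _)
      rw [← integral_add j1 j2]
      refine integral_congr_ae (ae_of_all _ fun x => ?_)
      simp only
      ring
    rw [hsplit]
    exact (abs_add_le _ _).trans_lt (by linarith)
  simpa using (hw1 w hw).add hv1

theorem pairing_eq_zero (h : Admissible a b r) (hQ : IsPotentialMap a b r c Q)
    (hQ' : IsPotentialMap b a (1 - r) c' Q') (hc : 0 < c) (hc' : 0 < c')
    (hw : MemLp w 2 (jacobiMeasure (b - 1) (a - 1))) (hv : MemLp v 2 (jacobiMeasure a b))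
    (h0 : ∀ p : ℝ[X], (∫ x, w x * (X ^ 2 * (1 - X) ^ 2 * p).eval x
        ∂(jacobiMeasure (b - 1) (a - 1))) +
      ∫ x, v x * (derivative (Q (X ^ 2 * (1 - X) ^ 2 * p))).eval x ∂(jacobiMeasure a b) = 0)
    (q : ℝ[X]) : (∫ x, w x * q.eval x ∂(jacobiMeasure (b - 1) (a - 1))) +
      ∫ x, v x * (derivative (Q q)).eval x ∂(jacobiMeasure a b) = 0 := by
  have ha := h.a_pos
  have hb := h.b_pos
  obtain ⟨Λ₁, hΛ₁⟩ := integral_mul_add_smul hw (memLp_eval (by linarith) (by linarith))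
  obtain ⟨Λ₂, hΛ₂⟩ := integral_mul_add_smul hv (memLp_eval (by linarith) (by linarith))
  have hΛ : ∀ f, (Λ₁ + Λ₂ ∘ₗ derivative ∘ₗ Q) f =
      (∫ x, w x * f.eval x ∂(jacobiMeasure (b - 1) (a - 1))) +
      ∫ x, v x * (derivative (Q f)).eval x ∂(jacobiMeasure a b) := fun f => by
    rw [← hΛ₁, ← hΛ₂]; rfl
  have hzero : Λ₁ + Λ₂ ∘ₗ derivative ∘ₗ Q = 0 := by
    refine eq_zero_of_tendsto_eval_pow _ (fun p => by rw [hΛ]; exact h0 p) ?_ ?_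
    · simp only [hΛ]
      -- For x^k the decay exponent is e = b, and b ≥ a + b − 1 because a ≤ 1; (1−x)^k is symmetric,
      -- with e = a.
      exact tendsto_pairing_zero h hQ hQ' hc hc' hw hv hb (by linarith [h.a_le])
        (fun k hk => polyInt_X_pow_le ha hb (by omega))
        (fun k hk => polyInt_derivative_X_pow_le ha hb hk)
    · simp only [hΛ]
      exact tendsto_pairing_zero h hQ hQ' hc hc' hw hv ha (by linarith [h.b_le])
        (fun k hk => polyInt_one_sub_X_pow_le ha hb (by omega))
        (fun k hk => polyInt_derivative_one_sub_X_pow_le ha hb hk)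
  rw [← hΛ, hzero, LinearMap.zero_apply]

/-- The potential of q = 1 is constant, so only the w term survives. This condition is what later
eliminates the unknown constant of the equation. -/
theorem integral_eq_zero_of_pairing (hQ : IsPotentialMap a b r c Q)
    (hpair : ∀ q : ℝ[X], (∫ x, w x * q.eval x ∂(jacobiMeasure (b - 1) (a - 1))) +
      ∫ x, v x * (derivative (Q q)).eval x ∂(jacobiMeasure a b) = 0) :
    ∫ x, w x ∂(jacobiMeasure (b - 1) (a - 1)) = 0 := by
  have h1 := hpair (X ^ 0)
  have h2 : derivative (Q (X ^ 0)) = 0 := by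
    rw [eq_C_of_natDegree_le_zero (hQ.natDegree_le 0), derivative_C]
  rw [h2] at h1
  simpa using h1

/-- Every polynomial p is S q with q of mean zero, so |⟨v, p⟩| = |⟨w, q⟩| ≤ κ^(−1/2) ‖w‖ ‖p‖ by the
lower bound for S; polynomials being dense, this bounds ‖v‖. -/
theorem integral_sq_le_of_pairing (h : Admissible a b r) (hQ : IsPotentialMap a b r c Q)
    (hQ' : IsPotentialMap b a (1 - r) c' Q') (hc : 0 < c) (hc' : 0 < c')
    (hw : MemLp w 2 (jacobiMeasure (b - 1) (a - 1))) (hv : MemLp v 2 (jacobiMeasure a b))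
    (hpair : ∀ q : ℝ[X], (∫ x, w x * q.eval x ∂(jacobiMeasure (b - 1) (a - 1))) +
      ∫ x, v x * (derivative (Q q)).eval x ∂(jacobiMeasure a b) = 0) :
    ∫ x, v x ^ 2 ∂(jacobiMeasure a b) ≤
      (c * c' * (a + b - 1) ^ 2)⁻¹ * ∫ x, w x ^ 2 ∂(jacobiMeasure (b - 1) (a - 1)) := by
  have ha := h.a_pos
  have hb := h.b_pos
  set κ := c * c' * (a + b - 1) ^ 2 with hκ
  have hκ0 : 0 < κ := mul_pos (mul_pos hc hc') (pow_pos (by linarith [h.one_lt]) 2)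
  set W := ∫ x, w x ^ 2 ∂(jacobiMeasure (b - 1) (a - 1)) with hW
  have hW0 : 0 ≤ W := integral_nonneg fun x => sq_nonneg _
  have hL1 : 0 < polyInt (b - 1) (a - 1) 1 := by
    have := polyInt_mul_self_pos (p := b - 1) (q := a - 1) (f := 1) (by linarith) (by linarith)
      one_ne_zero
    rwa [mul_one] at this
  have bound : ∀ p : ℝ[X], (∫ x, v x * p.eval x ∂(jacobiMeasure a b)) ^ 2 ≤
      κ⁻¹ * W * ∫ x, p.eval x ^ 2 ∂(jacobiMeasure a b) := by
    intro p
    obtain ⟨q, hq⟩ := exists_derivative_potential_eq h hQ hc p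
    -- S does not see constants, so the mean of q may be subtracted.
    set q₀ := q - (polyInt (b - 1) (a - 1) q / polyInt (b - 1) (a - 1) 1) • X ^ 0 with hq₀
    have hS : derivative (Q q₀) = p := by
      have h2 : derivative (Q (X ^ 0)) = 0 := by
        rw [eq_C_of_natDegree_le_zero (hQ.natDegree_le 0), derivative_C]
      rw [hq₀, map_sub, map_smul, derivative_sub, derivative_smul, h2, smul_zero, sub_zero, hq]
    have hm : polyInt (b - 1) (a - 1) q₀ = 0 := by
      rw [hq₀, map_sub, map_smul, pow_zero, smul_eq_mul, div_mul_cancel₀ _ hL1.ne', sub_self]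
    have h3 := le_polyInt_derivative_potential h hQ hQ' hc hc' hm
    rw [hS, polyInt_mul_eq (by linarith) (by linarith), polyInt_mul_eq (by linarith)
      (by linarith), ← hκ] at h3
    simp only [← pow_two] at h3
    have h4 := hpair q₀
    rw [hS] at h4
    have h5 := sq_integral_mul_le hw (memLp_eval (by linarith) (by linarith) q₀)
    have h6 : (∫ x, v x * p.eval x ∂(jacobiMeasure a b)) ^ 2 =
        (∫ x, w x * q₀.eval x ∂(jacobiMeasure (b - 1) (a - 1))) ^ 2 := by
      rw [eq_neg_of_add_eq_zero_right h4, neg_sq]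
    rw [h6]
    refine h5.trans ?_
    rw [← hW, mul_comm κ⁻¹, mul_assoc]
    refine mul_le_mul_of_nonneg_left ?_ hW0
    rwa [inv_mul_eq_div, le_div_iff₀ hκ0, mul_comm]
  refine le_of_forall_pos_le_add fun ε hε => ?_
  obtain ⟨p, hp⟩ := exists_polynomial_integral_sq_sub_le (by linarith) (by linarith) hv hε
  have hpL := memLp_eval (p := a) (q := b) (by linarith) (by linarith) p
  have hexp : ∫ x, (v x - p.eval x) ^ 2 ∂(jacobiMeasure a b) =
      (∫ x, v x ^ 2 ∂(jacobiMeasure a b)) + (∫ x, p.eval x ^ 2 ∂(jacobiMeasure a b)) -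
        2 * ∫ x, v x * p.eval x ∂(jacobiMeasure a b) := by
    rw [← integral_const_mul, ← integral_add hv.integrable_sq hpL.integrable_sq,
      ← integral_sub]
    · exact integral_congr_ae (ae_of_all _ fun x => by simp only; ring)
    · exact hv.integrable_sq.add hpL.integrable_sq
    · exact (hv.integrable_mul hpL).const_mul 2
  have hb := bound p
  have hP : 0 ≤ ∫ x, p.eval x ^ 2 ∂(jacobiMeasure a b) := integral_nonneg fun x => sq_nonneg _
  have hT : 0 ≤ κ⁻¹ * W := mul_nonneg (inv_nonneg.2 hκ0.le) hW0
  generalize ∫ x, v x * p.eval x ∂(jacobiMeasure a b) = I at *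
  generalize ∫ x, p.eval x ^ 2 ∂(jacobiMeasure a b) = P at *
  generalize ∫ x, v x ^ 2 ∂(jacobiMeasure a b) = V at *
  generalize κ⁻¹ * W = T at *
  rw [hexp] at hp
  by_contra hcon
  push Not at hcon
  -- From ‖v − p‖² ≤ ε and I² ≤ T P follows (V − ε + P)² ≤ 4 T P, against the lower bound 4 (V − ε)
  -- P, strict unless P = V − ε; this contradicts V − ε > T.
  have h7 : V - ε + P ≤ 2 * I := by linarith
  have h8 : (V - ε + P) ^ 2 ≤ 4 * (T * P) := by nlinarith
  have h9 : 4 * ((V - ε) * P) < (V - ε + P) ^ 2 ∨ P = V - ε := by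
    by_cases hPV : P = V - ε
    · exact Or.inr hPV
    · left
      have := sq_pos_of_ne_zero (sub_ne_zero.2 hPV)
      nlinarith
  rcases h9 with h9 | h9
  · nlinarith
  · nlinarith

end Duality

/-! ### Smooth truncation and differentiation of potentials -/

theorem hasDerivAt_max_rpow {c : ℝ} (hc : 1 < c) (y : ℝ) :
    HasDerivAt (fun y : ℝ => (max y 0) ^ c) (c * (max y 0) ^ (c - 1)) y := by
  have hcont : ∀ e : ℝ, 0 ≤ e → Continuous fun y : ℝ => (max y 0) ^ e := fun e he =>
    (continuous_id.max continuous_const).rpow_const fun _ => Or.inr he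
  have hne : ∀ y : ℝ, y ≠ 0 →
      HasDerivAt (fun y : ℝ => (max y 0) ^ c) (c * (max y 0) ^ (c - 1)) y := by
    intro y hy
    rcases lt_or_gt_of_ne hy with hy | hy
    · rw [max_eq_right hy.le, Real.zero_rpow (by linarith), mul_zero]
      refine (hasDerivAt_const y (0 : ℝ)).congr_of_eventuallyEq ?_
      filter_upwards [eventually_lt_nhds hy] with z hz
      rw [max_eq_right hz.le, Real.zero_rpow (by linarith)]
    · rw [max_eq_left hy.le]
      refine (Real.hasDerivAt_rpow_const (Or.inl hy.ne')).congr_of_eventuallyEq ?_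
      filter_upwards [eventually_gt_nhds hy] with z hz
      rw [max_eq_left hz.le]
  rcases eq_or_ne y 0 with rfl | hy
  · exact hasDerivAt_of_hasDerivAt_of_ne hne (hcont c (by linarith)).continuousAt
      ((hcont (c - 1) (by linarith)).const_mul c).continuousAt
  · exact hne y hy

theorem contDiff_max_rpow {c : ℝ} (hc : 1 < c) : ContDiff ℝ 1 fun y : ℝ => (max y 0) ^ c := by
  rw [contDiff_one_iff_deriv]
  refine ⟨fun y => (hasDerivAt_max_rpow hc y).differentiableAt, ?_⟩
  have : deriv (fun y : ℝ => (max y 0) ^ c) = fun y => c * (max y 0) ^ (c - 1) :=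
    funext fun y => (hasDerivAt_max_rpow hc y).deriv
  rw [this]
  exact ((continuous_id.max continuous_const).rpow_const fun _ => Or.inr (by linarith)).const_mul c

/-- A smooth truncation: zero on `[-1, 1]` and the identity off `(-√2, √2)`. -/
noncomputable def smoothTrunc (y : ℝ) : ℝ := y * Real.smoothTransition (y ^ 2 - 1)

theorem contDiff_smoothTrunc : ContDiff ℝ ∞ smoothTrunc :=
  contDiff_id.mul (Real.smoothTransition.contDiff.comp ((contDiff_id.pow 2).sub contDiff_const))

theorem smoothTrunc_eq_zero {y : ℝ} (hy : |y| ≤ 1) : smoothTrunc y = 0 := by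
  rw [smoothTrunc, Real.smoothTransition.zero_of_nonpos, mul_zero]
  have := sq_le_one_iff_abs_le_one y |>.2 hy
  linarith

theorem smoothTrunc_eq_self {y : ℝ} (hy : 2 < |y|) : smoothTrunc y = y := by
  rw [smoothTrunc, Real.smoothTransition.one_of_one_le, mul_one]
  have : |y| ^ 2 = y ^ 2 := sq_abs y
  nlinarith

theorem abs_smoothTrunc_le (y : ℝ) : |smoothTrunc y| ≤ |y| := by
  rw [smoothTrunc, abs_mul, abs_of_nonneg (Real.smoothTransition.nonneg _)]
  exact mul_le_of_le_one_right (abs_nonneg y) (Real.smoothTransition.le_one _)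

theorem deriv_smoothTrunc_eq_one {y : ℝ} (hy : 2 < |y|) : deriv smoothTrunc y = 1 := by
  have h : smoothTrunc =ᶠ[𝓝 y] id := by
    filter_upwards [continuous_abs.continuousAt.eventually (lt_mem_nhds hy)] with z hz
    exact smoothTrunc_eq_self hz
  rw [h.deriv_eq, deriv_id]

theorem exists_deriv_smoothTrunc_le : ∃ M : ℝ, ∀ y, |deriv smoothTrunc y| ≤ M := by
  have hc : Continuous (deriv smoothTrunc) := contDiff_smoothTrunc.continuous_deriv (by simp)
  obtain ⟨M, hM⟩ := (isCompact_Icc (a := (-2 : ℝ)) (b := 2)).exists_bound_of_continuousOn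
    hc.continuousOn
  refine ⟨max M 1, fun y => ?_⟩
  by_cases hy : 2 < |y|
  · rw [deriv_smoothTrunc_eq_one hy]; simp
  · exact (hM y (abs_le.1 (not_lt.1 hy))).trans (le_max_left _ _)

theorem integral_eq_setIntegral_Ioo {g : ℝ → ℝ} (hg : ∀ t, t ∉ Icc (0 : ℝ) 1 → g t = 0) :
    ∫ t, g t = ∫ t in Ioo (0 : ℝ) 1, g t := by
  rw [← integral_Icc_eq_integral_Ioo, setIntegral_eq_integral_of_forall_compl_eq_zero hg]

theorem deriv_eq_zero_of_notMem_Icc {g : ℝ → ℝ} (hg : ∀ t, t ∉ Icc (0 : ℝ) 1 → g t = 0) {t : ℝ}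
    (ht : t ∉ Icc (0 : ℝ) 1) : deriv g t = 0 := by
  have h : g =ᶠ[𝓝 t] fun _ => 0 := by
    filter_upwards [isClosed_Icc.isOpen_compl.mem_nhds ht] with z hz using hg z hz
  rw [h.deriv_eq, deriv_const]

/-- The kernel is only locally integrable, so the derivative of the convolution is put on the C¹
density. -/
theorem hasDerivAt_potential {a b r : ℝ} (h1 : 1 < a + b) (h2 : a + b < 2) {g : ℝ → ℝ}
    (hg : ContDiff ℝ 1 g) (hg0 : ∀ t, t ∉ Icc (0 : ℝ) 1 → g t = 0) (x : ℝ) :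
    HasDerivAt (fun x => ∫ t in Ioo (0 : ℝ) 1, twoSidedKernel a b r (x - t) * g t)
      (∫ t in Ioo (0 : ℝ) 1, twoSidedKernel a b r (x - t) * deriv g t) x := by
  have hcs : HasCompactSupport g := HasCompactSupport.intro isCompact_Icc hg0
  have h := hcs.hasDerivAt_convolution_right (ContinuousLinearMap.mul ℝ ℝ)
    (locallyIntegrable_twoSidedKernel (r := r) h1 h2) hg x
  have e : ∀ f : ℝ → ℝ, (∀ t, t ∉ Icc (0 : ℝ) 1 → f t = 0) → ∀ x,
      convolution (twoSidedKernel a b r) f (ContinuousLinearMap.mul ℝ ℝ) volume x =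
      ∫ t in Ioo (0 : ℝ) 1, twoSidedKernel a b r (x - t) * f t := by
    intro f hf x
    rw [← integral_eq_setIntegral_Ioo (fun t ht => by rw [hf t ht, mul_zero]), convolution,
      ← integral_sub_left_eq_self _ volume x]
    simp
  rw [e _ (fun t ht => deriv_eq_zero_of_notMem_Icc hg0 ht)] at h
  exact h.congr_of_eventuallyEq (Eventually.of_forall fun x => (e g hg0 x).symm)

theorem integrableOn_twoSidedKernel_sub {a b r : ℝ} (h1 : 1 < a + b) (h2 : a + b < 2) (x : ℝ) :
    IntegrableOn (fun t => twoSidedKernel a b r (x - t)) (Ioo 0 1) := by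
  have := (intervalIntegrable_twoSidedKernel (r := r) h1 h2 (x - 0) (x - 1)).comp_sub_left x
  simp only [sub_sub_cancel] at this
  exact (intervalIntegrable_iff_integrableOn_Ioo_of_le zero_le_one).1 this

theorem integral_twoSidedKernel_sub_le {a b r : ℝ} (h : Admissible a b r) {x : ℝ}
    (hx : x ∈ Ioo (0 : ℝ) 1) : ∫ t in Ioo (0 : ℝ) 1, twoSidedKernel a b r (x - t) ≤
      ∫ y in (-1 : ℝ)..1, twoSidedKernel a b r y := by
  rw [← integral_Ioc_eq_integral_Ioo, ← intervalIntegral.integral_of_le zero_le_one,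
    intervalIntegral.integral_comp_sub_left (twoSidedKernel a b r) x]
  refine intervalIntegral.integral_mono_interval (by linarith [hx.1]) (by linarith)
    (by linarith [hx.2]) (ae_of_all _ fun y => twoSidedKernel_nonneg h y)
    (intervalIntegrable_twoSidedKernel h.one_lt h.lt_two _ _)

theorem twoSidedFracInt_eq_potential {a b r : ℝ} (h1 : 1 < a + b) (h2 : a + b < 2) {φ : ℝ → ℝ}
    (hφ : Continuous φ) {x : ℝ} (hx : x ∈ Ioo (0 : ℝ) 1) :
    twoSidedFracInt (1 - r) (2 - (a + b)) φ x = 1 / Real.Gamma (2 - (a + b)) *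
      ∫ t in Ioo (0 : ℝ) 1, twoSidedKernel a b r (x - t) * φ t := by
  obtain ⟨M, hM⟩ := (isCompact_Icc (a := (0 : ℝ)) (b := 1)).exists_bound_of_continuousOn
    hφ.continuousOn
  have hi : IntegrableOn (fun t => twoSidedKernel a b r (x - t) * φ t) (Ioo 0 1) := by
    refine Integrable.mul_bdd (c := M) (integrableOn_twoSidedKernel_sub h1 h2 x)
      hφ.aestronglyMeasurable ?_
    filter_upwards [ae_restrict_mem measurableSet_Ioo] with t ht using hM t ⟨ht.1.le, ht.2.le⟩
  have e : (2 - (a + b) - 1 : ℝ) = 1 - a - b := by ring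
  have hs : Ioo (0 : ℝ) 1 = Ioc 0 x ∪ Ioo x 1 := (Ioc_union_Ioo_eq_Ioo hx.1.le hx.2).symm
  have hl : ∫ t in Ioc 0 x, twoSidedKernel a b r (x - t) * φ t =
      (1 - r) * ∫ t in (0 : ℝ)..x, φ t * (x - t) ^ (1 - a - b) := by
    rw [intervalIntegral.integral_of_le hx.1.le, ← integral_const_mul,
      integral_Ioc_eq_integral_Ioo, integral_Ioc_eq_integral_Ioo]
    refine setIntegral_congr_fun measurableSet_Ioo fun t ht => ?_
    simp only [twoSidedKernel]
    rw [if_pos (by linarith [ht.2])]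
    ring
  have hr : ∫ t in Ioo x 1, twoSidedKernel a b r (x - t) * φ t =
      r * ∫ t in x..(1 : ℝ), φ t * (t - x) ^ (1 - a - b) := by
    rw [intervalIntegral.integral_of_le hx.2.le, ← integral_const_mul,
      integral_Ioc_eq_integral_Ioo]
    refine setIntegral_congr_fun measurableSet_Ioo fun t ht => ?_
    simp only [twoSidedKernel]
    rw [if_neg (by linarith [ht.1]), neg_sub]
    ring
  rw [hs] at hi ⊢
  rw [setIntegral_union (disjoint_left.2 fun t h3 h4 => absurd h4.1 (not_lt.2 h3.2))
    measurableSet_Ioo (hi.mono_set subset_union_left) (hi.mono_set subset_union_right), hl, hr,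
    twoSidedFracInt, leftFracInt, rightFracInt, e]
  ring

section Truncation

variable {g : ℝ → ℝ} {N : ℝ}

/-- By continuity N g is small near each point outside (0,1), so the truncation vanishes there, and
smoothness of g is needed only inside. -/
theorem contDiff_truncate (hg : Continuous g) (hg0 : ∀ x, x ∉ Ioo (0 : ℝ) 1 → g x = 0)
    (hgs : ∀ x ∈ Ioo (0 : ℝ) 1, ContDiffAt ℝ ∞ g x) :
    ContDiff ℝ ∞ fun x => N⁻¹ * smoothTrunc (N * g x) := by
  rw [contDiff_iff_contDiffAt]
  intro x
  by_cases hx : x ∈ Ioo (0 : ℝ) 1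
  · exact contDiffAt_const.mul
      (contDiff_smoothTrunc.contDiffAt.comp x (contDiffAt_const.mul (hgs x hx)))
  · have h1 : ∀ᶠ z in 𝓝 x, |N * g z| < 1 := by
      have hc : Continuous fun z => |N * g z| := by fun_prop
      refine hc.continuousAt.eventually (gt_mem_nhds ?_)
      simp [hg0 x hx]
    refine contDiffAt_const (c := (0 : ℝ)) |>.congr_of_eventuallyEq ?_
    filter_upwards [h1] with z hz
    rw [smoothTrunc_eq_zero hz.le, mul_zero]

theorem tsupport_truncate_subset (hg : Continuous g) (hg0 : ∀ x, x ∉ Ioo (0 : ℝ) 1 → g x = 0) :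
    tsupport (fun x => N⁻¹ * smoothTrunc (N * g x)) ⊆ Ioo 0 1 := by
  have h1 : tsupport (fun x => N⁻¹ * smoothTrunc (N * g x)) ⊆ {x | 1 ≤ |N * g x|} := by
    refine closure_minimal (fun x hx => ?_) (isClosed_le (by fun_prop) (by fun_prop))
    by_contra hlt
    rw [mem_ofPred_eq, not_le] at hlt
    exact hx (by simp only [smoothTrunc_eq_zero hlt.le, mul_zero])
  refine h1.trans fun x hx => ?_
  by_contra hx0
  rw [mem_ofPred_eq, hg0 x hx0, mul_zero, abs_zero] at hx
  linarith

theorem hasDerivAt_truncate (hg : Differentiable ℝ g) (hN : 0 < N) (x : ℝ) :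
    HasDerivAt (fun x => N⁻¹ * smoothTrunc (N * g x)) (deriv smoothTrunc (N * g x) * deriv g x) x := by
  have h1 : HasDerivAt smoothTrunc (deriv smoothTrunc (N * g x)) (N * g x) :=
    (contDiff_smoothTrunc.differentiable (by simp)).differentiableAt.hasDerivAt
  have h2 := (h1.comp x ((hg x).hasDerivAt.const_mul N)).const_mul N⁻¹
  refine h2.congr_deriv ?_
  field_simp

theorem abs_truncate_le (hN : 0 < N) (x : ℝ) : |N⁻¹ * smoothTrunc (N * g x)| ≤ |g x| := by
  rw [abs_mul, abs_of_pos (inv_pos.2 hN), inv_mul_le_iff₀ hN]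
  refine (abs_smoothTrunc_le _).trans (le_of_eq ?_)
  rw [abs_mul, abs_of_pos hN]

end Truncation

theorem eventually_lt_abs_mul {y : ℝ} (hy : y ≠ 0) :
    ∀ᶠ n : ℕ in atTop, 2 < |((n : ℝ) + 1) * y| := by
  have h1 : Tendsto (fun n : ℕ => ((n : ℝ) + 1) * |y|) atTop atTop :=
    (tendsto_natCast_atTop_atTop.atTop_add tendsto_const_nhds).atTop_mul_const (abs_pos.2 hy)
  filter_upwards [h1.eventually_gt_atTop 2] with n hn
  rwa [abs_mul, abs_of_pos (by positivity)]

/-! ### From test functions to weighted polynomials -/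

section WeakIdentity

variable {a b r c : ℝ} {Q : ℝ[X] →ₗ[ℝ] ℝ[X]}

theorem contDiff_eval (n : ℕ∞ω) (f : ℝ[X]) : ContDiff ℝ n fun x => f.eval x := by
  simpa using f.contDiff_aeval (𝕜 := ℝ) n

/-- The factor x²(1−x)² raises the exponents a − 1, b − 1 to a + 1, b + 1, which exceed 1, so the
extension by zero is C¹. -/
theorem exists_extension (ha : 0 < a) (hb : 0 < b) (p : ℝ[X]) :
    ∃ g : ℝ → ℝ, ContDiff ℝ 1 g ∧ (∀ x, x ∉ Ioo (0 : ℝ) 1 → g x = 0) ∧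
      (∀ x ∈ Ioo (0 : ℝ) 1, ContDiffAt ℝ ∞ g x) ∧
      (∀ x ∈ Ioo (0 : ℝ) 1, g x = jacobiWeight (b - 1) (a - 1) x *
        (X ^ 2 * (1 - X) ^ 2 * p).eval x) := by
  have heq : ∀ x ∈ Ioo (0 : ℝ) 1, (max (1 - x) 0) ^ (b + 1) * (max x 0) ^ (a + 1) * p.eval x =
      jacobiWeight (b - 1) (a - 1) x * (X ^ 2 * (1 - X) ^ 2 * p).eval x := by
    intro x hx
    have h1 : 0 < 1 - x := by linarith [hx.2]
    rw [max_eq_left h1.le, max_eq_left hx.1.le, jacobiWeight]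
    have e1 : (1 - x) ^ (b + 1) = (1 - x) ^ (b - 1) * (1 - x) ^ 2 := by
      rw [← Real.rpow_add_natCast h1.ne']; congr 1; push_cast; ring
    have e2 : x ^ (a + 1) = x ^ (a - 1) * x ^ 2 := by
      rw [← Real.rpow_add_natCast hx.1.ne']; congr 1; push_cast; ring
    simp only [eval_mul, eval_pow, eval_sub, eval_one, eval_X]
    rw [e1, e2]
    ring
  refine ⟨fun x => (max (1 - x) 0) ^ (b + 1) * (max x 0) ^ (a + 1) * p.eval x, ?_, ?_, ?_, heq⟩
  · exact (((contDiff_max_rpow (by linarith)).comp (contDiff_const.sub contDiff_id)).mul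
      (contDiff_max_rpow (by linarith))).mul (contDiff_eval 1 p)
  · intro x hx
    rcases not_and_or.1 hx with h | h
    · simp only
      rw [max_eq_right (not_lt.1 h), Real.zero_rpow (by linarith)]; ring
    · simp only
      rw [max_eq_right (by linarith [not_lt.1 h] : 1 - x ≤ 0), Real.zero_rpow (by linarith)]; ring
  · intro x hx
    have h1 : 0 < 1 - x := by linarith [hx.2]
    have hc : ContDiffAt ℝ ∞ (fun x => jacobiWeight (b - 1) (a - 1) x *
        (X ^ 2 * (1 - X) ^ 2 * p).eval x) x :=
      (((contDiffAt_const.sub contDiffAt_id).rpow_const_of_ne h1.ne').mul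
        (contDiffAt_id.rpow_const_of_ne hx.1.ne')).mul (contDiff_eval ∞ _).contDiffAt
    refine hc.congr_of_eventuallyEq ?_
    filter_upwards [isOpen_Ioo.mem_nhds hx] with z hz using heq z hz

/-- The truncations φ n of the extended weighted polynomial g are valid test functions with |φ n| ≤
|g|. Their derivatives θ'((n+1) g) g', θ being `smoothTrunc`, are uniformly bounded on (0,1) and
converge to g' off the zeros of g, so dominated convergence applies to both sides. -/
theorem pairing_eq_zero_of_weak (h : Admissible a b r) (hQ : IsPotentialMap a b r c Q) {u w : ℝ → ℝ}
    (hu : IntegrableOn u (Ioo 0 1)) (hwm : AEStronglyMeasurable w (volume.restrict (Ioo 0 1)))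
    (hw : MemLp w 2 (jacobiMeasure (b - 1) (a - 1)))
    (hweak : ∀ φ : ℝ → ℝ, ContDiff ℝ ∞ φ → HasCompactSupport φ → tsupport φ ⊆ Ioo 0 1 →
      ∫ x in Ioo (0 : ℝ) 1, w x * φ x =
        -∫ x in Ioo (0 : ℝ) 1, u x * deriv (twoSidedFracInt (1 - r) (2 - (a + b)) φ) x)
    (p : ℝ[X]) :
    (∫ x, w x * (X ^ 2 * (1 - X) ^ 2 * p).eval x ∂(jacobiMeasure (b - 1) (a - 1))) +
      1 / Real.Gamma (2 - (a + b)) * ∫ x in Ioo (0 : ℝ) 1,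
        u x * (derivative (Q (X ^ 2 * (1 - X) ^ 2 * p))).eval x = 0 := by
  have ha := h.a_pos
  have hb := h.b_pos
  -- For p ≠ 0 the zeros of g in (0,1) are roots of a nonzero polynomial, hence a null set.
  rcases eq_or_ne p 0 with rfl | hp
  · simp
  set f : ℝ[X] := X ^ 2 * (1 - X) ^ 2 * p with hf
  have hf0 : f ≠ 0 := by
    have hX1 : (1 - X : ℝ[X]) ≠ 0 := by
      rw [← neg_ne_zero, neg_sub, ← C_1]
      exact X_sub_C_ne_zero 1
    exact mul_ne_zero (mul_ne_zero (pow_ne_zero _ X_ne_zero) (pow_ne_zero _ hX1)) hp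
  obtain ⟨g, hg1, hg0, hgs, hgf⟩ := exists_extension ha hb p
  rw [← hf] at hgf
  have hgc := hg1.continuous
  have hg0' : ∀ x, x ∉ Icc (0 : ℝ) 1 → g x = 0 := fun x hx =>
    hg0 x fun h => hx ⟨h.1.le, h.2.le⟩
  set γ := 1 / Real.Gamma (2 - (a + b)) with hγ
  set φ : ℕ → ℝ → ℝ := fun n x => ((n : ℝ) + 1)⁻¹ * smoothTrunc (((n : ℝ) + 1) * g x) with hφ
  have hpos : ∀ n : ℕ, (0 : ℝ) < n + 1 := fun n => by positivity
  have hφs : ∀ n, ContDiff ℝ ∞ (φ n) := fun n => contDiff_truncate hgc hg0 hgs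
  have hφt : ∀ n, tsupport (φ n) ⊆ Ioo 0 1 := fun n => tsupport_truncate_subset hgc hg0
  have hφc : ∀ n, HasCompactSupport (φ n) := fun n =>
    HasCompactSupport.of_support_subset_isCompact isCompact_Icc
      ((subset_tsupport _).trans ((hφt n).trans Ioo_subset_Icc_self))
  have hφ0 : ∀ n x, x ∉ Icc (0 : ℝ) 1 → φ n x = 0 := fun n x hx => by
    simp [hφ, hg0' x hx, smoothTrunc]
  have hφd : ∀ n x, deriv (φ n) x = deriv smoothTrunc (((n : ℝ) + 1) * g x) * deriv g x :=
    fun n x => (hasDerivAt_truncate (hg1.differentiable one_ne_zero) (hpos n) x).deriv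
  obtain ⟨M, hM⟩ := exists_deriv_smoothTrunc_le
  obtain ⟨M', hM'⟩ := (isCompact_Icc (a := (0 : ℝ)) (b := 1)).exists_bound_of_continuousOn
    (hg1.continuous_deriv le_rfl).continuousOn
  have hM0 : 0 ≤ M := (abs_nonneg _).trans (hM 0)
  have hφb : ∀ n, ∀ x ∈ Ioo (0 : ℝ) 1, |deriv (φ n) x| ≤ M * M' := fun n x hx => by
    rw [hφd, abs_mul]
    exact mul_le_mul (hM _) (hM' x ⟨hx.1.le, hx.2.le⟩) (abs_nonneg _) hM0
  have hlimd : ∀ᵐ x ∂(volume.restrict (Ioo (0 : ℝ) 1)),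
      Tendsto (fun n => deriv (φ n) x) atTop (𝓝 (deriv g x)) := by
    have hnull : ∀ᵐ x ∂(volume.restrict (Ioo (0 : ℝ) 1)), x ∉ (f.roots.toFinset : Set ℝ) :=
      ae_restrict_of_ae (measure_eq_zero_iff_ae_notMem.1
        ((Finset.countable_toSet _).measure_zero _))
    filter_upwards [hnull, ae_restrict_mem measurableSet_Ioo] with x hx hxI
    have hne : g x ≠ 0 := by
      rw [hgf x hxI]
      refine mul_ne_zero (jacobiWeight_pos _ _ hxI).ne' fun h0 => hx ?_
      rw [Finset.mem_coe, Multiset.mem_toFinset, mem_roots hf0]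
      exact h0
    refine tendsto_const_nhds.congr' ?_
    filter_upwards [eventually_lt_abs_mul hne] with n hn
    rw [hφd, deriv_smoothTrunc_eq_one hn, one_mul]
  have hlim : ∀ x, Tendsto (fun n => φ n x) atTop (𝓝 (g x)) := by
    intro x
    by_cases hne : g x = 0
    · simp [hφ, hne, smoothTrunc]
    · refine tendsto_const_nhds.congr' ?_
      filter_upwards [eventually_lt_abs_mul hne] with n hn
      simp only [hφ]
      rw [smoothTrunc_eq_self hn]
      have := (hpos n).ne'
      field_simp
  have hder : ∀ n, ∀ x ∈ Ioo (0 : ℝ) 1, deriv (twoSidedFracInt (1 - r) (2 - (a + b)) (φ n)) x =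
      γ * ∫ t in Ioo (0 : ℝ) 1, twoSidedKernel a b r (x - t) * deriv (φ n) t := by
    intro n x hx
    have h1 := (hasDerivAt_potential (r := r) h.one_lt h.lt_two ((hφs n).of_le (by simp))
      (hφ0 n) x).const_mul γ
    refine (h1.congr_of_eventuallyEq ?_).deriv
    filter_upwards [isOpen_Ioo.mem_nhds hx] with z hz
    exact twoSidedFracInt_eq_potential h.one_lt h.lt_two (hφs n).continuous hz
  have hderQ : ∀ x ∈ Ioo (0 : ℝ) 1, (derivative (Q f)).eval x =
      ∫ t in Ioo (0 : ℝ) 1, twoSidedKernel a b r (x - t) * deriv g t := by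
    intro x hx
    have h1 := hasDerivAt_potential (r := r) h.one_lt h.lt_two hg1 hg0' x
    refine ((Q f).hasDerivAt x).unique (h1.congr_of_eventuallyEq ?_)
    filter_upwards [isOpen_Ioo.mem_nhds hx] with z hz
    rw [hQ.eval_eq f z hz]
    refine setIntegral_congr_fun measurableSet_Ioo fun t ht => ?_
    simp only [hgf t ht]
  have hL : Tendsto (fun n => ∫ x in Ioo (0 : ℝ) 1, w x * φ n x) atTop
      (𝓝 (∫ x in Ioo (0 : ℝ) 1, w x * g x)) := by
    have hwi : IntegrableOn (fun x => w x * g x) (Ioo 0 1) := by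
      have h1 : Integrable (fun x => w x * f.eval x) (jacobiMeasure (b - 1) (a - 1)) :=
        hw.integrable_mul (memLp_eval (by linarith) (by linarith) f)
      rw [integrable_jacobiMeasure_iff] at h1
      refine h1.congr_fun (fun x hx => ?_) measurableSet_Ioo
      simp only [hgf x hx]
      ring
    refine tendsto_integral_of_dominated_convergence (fun x => ‖w x * g x‖)
      (fun n => hwm.mul (hφs n).continuous.aestronglyMeasurable) hwi.norm
      (fun n => ae_of_all _ fun x => ?_) (ae_of_all _ fun x => (hlim x).const_mul _)
    rw [norm_mul]
    refine le_trans ?_ (norm_mul _ _).ge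
    exact mul_le_mul_of_nonneg_left (abs_truncate_le (g := g) (hpos n) x) (norm_nonneg _)
  have hR : Tendsto (fun n => ∫ x in Ioo (0 : ℝ) 1,
      u x * deriv (twoSidedFracInt (1 - r) (2 - (a + b)) (φ n)) x) atTop
      (𝓝 (∫ x in Ioo (0 : ℝ) 1, u x * (γ * (derivative (Q f)).eval x))) := by
    set D := ∫ y in (-1 : ℝ)..1, twoSidedKernel a b r y
    refine tendsto_integral_of_dominated_convergence (fun x => ‖u x‖ * (|γ| * (M * M' * D)))
      (fun n => hu.1.mul (measurable_deriv _).aestronglyMeasurable) (hu.norm.mul_const _)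
      (fun n => ?_) ?_
    · filter_upwards [ae_restrict_mem measurableSet_Ioo] with x hx
      rw [norm_mul, hder n x hx, norm_mul]
      refine mul_le_mul_of_nonneg_left (mul_le_mul_of_nonneg_left ?_ (abs_nonneg γ)) (norm_nonneg _)
      have hMM : 0 ≤ M * M' := (abs_nonneg _).trans (hφb n x hx)
      calc ‖∫ t in Ioo (0 : ℝ) 1, twoSidedKernel a b r (x - t) * deriv (φ n) t‖
          ≤ ∫ t in Ioo (0 : ℝ) 1, M * M' * twoSidedKernel a b r (x - t) := by
            refine norm_integral_le_of_norm_le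
              ((integrableOn_twoSidedKernel_sub h.one_lt h.lt_two x).const_mul _) ?_
            filter_upwards [ae_restrict_mem measurableSet_Ioo] with t ht
            rw [norm_mul, Real.norm_of_nonneg (twoSidedKernel_nonneg h _), mul_comm]
            exact mul_le_mul_of_nonneg_right (hφb n t ht) (twoSidedKernel_nonneg h _)
        _ ≤ M * M' * D := by
            rw [integral_const_mul]
            exact mul_le_mul_of_nonneg_left (integral_twoSidedKernel_sub_le h hx) hMM
    · filter_upwards [ae_restrict_mem measurableSet_Ioo] with x hx
      simp only [hder _ x hx, hderQ x hx]
      refine (Tendsto.const_mul γ ?_).const_mul (u x)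
      refine tendsto_integral_of_dominated_convergence
        (fun t => M * M' * twoSidedKernel a b r (x - t)) (fun n => ?_)
        ((integrableOn_twoSidedKernel_sub h.one_lt h.lt_two x).const_mul _) (fun n => ?_) ?_
      · exact Measurable.aestronglyMeasurable (by have := measurable_deriv (φ n); fun_prop)
      · filter_upwards [ae_restrict_mem measurableSet_Ioo] with t ht
        rw [norm_mul, Real.norm_of_nonneg (twoSidedKernel_nonneg h _), mul_comm]
        exact mul_le_mul_of_nonneg_right (hφb n t ht) (twoSidedKernel_nonneg h _)
      · filter_upwards [hlimd] with t ht using ht.const_mul _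
  have hfin := tendsto_nhds_unique
    (hL.congr fun n => hweak (φ n) (hφs n) (hφc n) (hφt n)) hR.neg
  have e1 : ∫ x, w x * f.eval x ∂(jacobiMeasure (b - 1) (a - 1)) =
      ∫ x in Ioo (0 : ℝ) 1, w x * g x := by
    rw [integral_jacobiMeasure]
    refine setIntegral_congr_fun measurableSet_Ioo fun x hx => ?_
    simp only [hgf x hx]
    ring
  have e2 : ∫ x in Ioo (0 : ℝ) 1, u x * (γ * (derivative (Q f)).eval x) =
      γ * ∫ x in Ioo (0 : ℝ) 1, u x * (derivative (Q f)).eval x := by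
    rw [← integral_const_mul]
    exact integral_congr_ae (ae_of_all _ fun x => by simp only; ring)
  rw [e1, hfin, e2]
  ring

end WeakIdentity

/-! ### Weighted bound for the primitive of f -/

theorem abs_log_le_rpow {t x : ℝ} (ht : 0 < t) (hx0 : 0 < x) (hx1 : x ≤ 1) :
    |Real.log x| ≤ 1 / t * x ^ (-t) := by
  have h := Real.abs_log_mul_self_rpow_lt x t hx0 hx1 ht
  have hp := Real.rpow_pos_of_pos hx0 t
  rw [abs_mul, abs_of_pos hp] at h
  rw [Real.rpow_neg hx0.le, ← div_eq_mul_inv, le_div_iff₀ hp]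
  exact h.le

theorem uIoc_half_subset {x : ℝ} (hx : x ∈ Ioo (0 : ℝ) 1) : uIoc (1 / 2) x ⊆ Ioo (0 : ℝ) 1 := by
  intro t ht
  rcases le_total (1 / 2) x with h | h
  · rw [uIoc_of_le h] at ht
    exact ⟨by linarith [ht.1], by linarith [ht.2, hx.2]⟩
  · rw [uIoc_of_ge h] at ht
    exact ⟨by linarith [ht.1, hx.1], by linarith [ht.2]⟩

/-- The antiderivative log t − log(1 − t) vanishes at 1/2, which is why the base point is 1/2. -/
theorem integral_inv_mul_le {x : ℝ} (hx : x ∈ Ioo (0 : ℝ) 1) :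
    IntegrableOn (fun t : ℝ => t⁻¹ + (1 - t)⁻¹) (uIoc (1 / 2) x) ∧
      ∫ t in uIoc (1 / 2) x, (t⁻¹ + (1 - t)⁻¹) ≤ |Real.log x| + |Real.log (1 - x)| := by
  have hsub : ∀ t ∈ uIcc (1 / 2) x, t ∈ Ioo (0 : ℝ) 1 := fun t ht =>
    ordConnected_Ioo.uIcc_subset (by norm_num) hx ht
  have hd : ∀ t ∈ uIcc (1 / 2) x,
      HasDerivAt (fun t => Real.log t - Real.log (1 - t)) (t⁻¹ + (1 - t)⁻¹) t := by
    intro t ht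
    have h1 := hsub t ht
    have h2 : 0 < 1 - t := by linarith [h1.2]
    refine ((Real.hasDerivAt_log h1.1.ne').sub
      (((hasDerivAt_id t).const_sub 1).log h2.ne')).congr_deriv ?_
    simp only [id]
    ring
  have hc : ContinuousOn (fun t : ℝ => t⁻¹ + (1 - t)⁻¹) (uIcc (1 / 2) x) := by
    refine (continuousOn_id.inv₀ fun t ht => (hsub t ht).1.ne').add
      (ContinuousOn.inv₀ (by fun_prop) fun t ht => ?_)
    linarith [(hsub t ht).2]
  have hi : IntervalIntegrable (fun t : ℝ => t⁻¹ + (1 - t)⁻¹) volume (1 / 2) x :=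
    hc.intervalIntegrable
  refine ⟨hi.def', ?_⟩
  have h1 := intervalIntegral.integral_eq_sub_of_hasDerivAt hd hi
  have h2 : (Real.log (1 / 2) - Real.log (1 - 1 / 2) : ℝ) = 0 := by norm_num
  rw [h2, sub_zero] at h1
  have h3 := intervalIntegral.abs_integral_eq_abs_integral_uIoc (μ := volume) (a := 1 / 2) (b := x)
    (fun t : ℝ => t⁻¹ + (1 - t)⁻¹)
  rw [h1] at h3
  refine (le_abs_self _).trans (h3.symm.le.trans ?_)
  exact abs_sub _ _

section Primitive

variable {a b : ℝ} {f : ℝ → ℝ}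

theorem mul_one_sub_le_jacobiWeight (ha : a ≤ 1) (hb : b ≤ 1) {t : ℝ} (ht : t ∈ Ioo (0 : ℝ) 1) :
    (jacobiWeight b a t)⁻¹ ≤ t⁻¹ + (1 - t)⁻¹ := by
  have h1 : 0 < 1 - t := by linarith [ht.2]
  have e : t⁻¹ + (1 - t)⁻¹ = ((1 - t) * t)⁻¹ := by
    have := ht.1.ne'
    have := h1.ne'
    field_simp
    ring
  rw [e]
  refine inv_anti₀ (mul_pos h1 ht.1) (mul_le_mul ?_ ?_ ht.1.le (Real.rpow_nonneg h1.le _))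
  · calc 1 - t = (1 - t) ^ (1 : ℝ) := (Real.rpow_one _).symm
      _ ≤ (1 - t) ^ b := Real.rpow_le_rpow_of_exponent_ge h1 (by linarith [ht.1]) hb
  · calc t = t ^ (1 : ℝ) := (Real.rpow_one _).symm
      _ ≤ t ^ a := Real.rpow_le_rpow_of_exponent_ge ht.1 ht.2.le ha

theorem sq_primitive_le (ha : a ≤ 1) (hb : b ≤ 1) (hf : MemLp f 2 (jacobiMeasure b a)) {x : ℝ}
    (hx : x ∈ Ioo (0 : ℝ) 1) :
    (∫ y in (1 / 2)..x, f y) ^ 2 ≤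
      (∫ y, f y ^ 2 ∂(jacobiMeasure b a)) * (|Real.log x| + |Real.log (1 - x)|) := by
  have hsub := uIoc_half_subset hx
  have hms : MeasurableSet (uIoc (1 / 2) x) := measurableSet_uIoc
  obtain ⟨hi, hle⟩ := integral_inv_mul_le hx
  -- Pairing f with this g in the weighted space gives the unweighted integral of f, and weight
  -- times g² is g again.
  set g : ℝ → ℝ := (uIoc (1 / 2) x).indicator fun t => (jacobiWeight b a t)⁻¹ with hg
  have hinv : IntegrableOn (fun t => (jacobiWeight b a t)⁻¹) (uIoc (1 / 2) x) := by
    refine Integrable.mono' hi (measurable_jacobiWeight b a).inv.aestronglyMeasurable ?_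
    filter_upwards [ae_restrict_mem hms] with t ht
    rw [Real.norm_of_nonneg (inv_nonneg.2 (jacobiWeight_pos b a (hsub ht)).le)]
    exact mul_one_sub_le_jacobiWeight ha hb (hsub ht)
  have hgm : Measurable g := (measurable_jacobiWeight b a).inv.indicator hms
  have hgsq : ∀ t ∈ Ioo (0 : ℝ) 1, jacobiWeight b a t * g t ^ 2 = g t := by
    intro t ht
    have := (jacobiWeight_pos b a ht).ne'
    by_cases hmem : t ∈ uIoc (1 / 2) x
    · simp only [hg, indicator_of_mem hmem]
      field_simp
    · simp only [hg, indicator_of_notMem hmem]; ring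
  have hgi : IntegrableOn g (Ioo 0 1) := ((integrable_indicator_iff hms).2 hinv).integrableOn
  have hgL : MemLp g 2 (jacobiMeasure b a) := by
    refine memLp_jacobiMeasure hgm.aestronglyMeasurable ?_
    exact hgi.congr_fun (fun t ht => (hgsq t ht).symm) measurableSet_Ioo
  have hcs := sq_integral_mul_le hf hgL
  have e1 : ∫ t, f t * g t ∂(jacobiMeasure b a) = ∫ t in uIoc (1 / 2) x, f t := by
    rw [integral_jacobiMeasure]
    calc _ = ∫ t in Ioo (0 : ℝ) 1, (uIoc (1 / 2) x).indicator f t := by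
          refine setIntegral_congr_fun measurableSet_Ioo fun t ht => ?_
          have := (jacobiWeight_pos b a ht).ne'
          by_cases hmem : t ∈ uIoc (1 / 2) x
          · simp only [hg, indicator_of_mem hmem]
            field_simp
          · simp only [hg, indicator_of_notMem hmem]; ring
      _ = _ := by rw [setIntegral_indicator hms, inter_eq_right.2 hsub]
  have e2 : ∫ t, g t ^ 2 ∂(jacobiMeasure b a) ≤ |Real.log x| + |Real.log (1 - x)| := by
    rw [integral_jacobiMeasure, setIntegral_congr_fun measurableSet_Ioo hgsq, hg,
      setIntegral_indicator hms, inter_eq_right.2 hsub]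
    refine le_trans (setIntegral_mono_on hinv hi hms fun t ht => ?_) hle
    exact mul_one_sub_le_jacobiWeight ha hb (hsub ht)
  rw [e1] at hcs
  rw [← sq_abs, intervalIntegral.abs_integral_eq_abs_integral_uIoc, sq_abs]
  exact hcs.trans (mul_le_mul_of_nonneg_left e2 (integral_nonneg fun t => sq_nonneg _))

/-- Cauchy–Schwarz costs |log x| + |log(1 − x)|, absorbed by half of each exponent: |log x| ≤ (2/a)
x^(−a/2) leaves the integrable power x^(a/2−1), and similarly at 1. -/
theorem exists_primitive_bound (ha0 : 0 < a) (hb0 : 0 < b) (ha : a ≤ 1) (hb : b ≤ 1) :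
    ∃ C : ℝ, 0 ≤ C ∧ ∀ f : ℝ → ℝ, MemLp f 2 (jacobiMeasure b a) →
      AEStronglyMeasurable (fun x => ∫ y in (1 / 2)..x, f y) (volume.restrict (Ioo 0 1)) →
      MemLp (fun x => ∫ y in (1 / 2)..x, f y) 2 (jacobiMeasure (b - 1) (a - 1)) ∧
      ∫ x, (∫ y in (1 / 2)..x, f y) ^ 2 ∂(jacobiMeasure (b - 1) (a - 1)) ≤
        C * ∫ y, f y ^ 2 ∂(jacobiMeasure b a) := by
  have i1 := integrableOn_jacobiWeight (p := b - 1) (q := a / 2 - 1) (by linarith) (by linarith)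
  have i2 := integrableOn_jacobiWeight (p := b / 2 - 1) (q := a - 1) (by linarith) (by linarith)
  set H : ℝ → ℝ := fun x => 1 / (a / 2) * jacobiWeight (b - 1) (a / 2 - 1) x +
    1 / (b / 2) * jacobiWeight (b / 2 - 1) (a - 1) x with hH
  have hHi : IntegrableOn H (Ioo 0 1) := (i1.const_mul _).add (i2.const_mul _)
  have hlog : ∀ x ∈ Ioo (0 : ℝ) 1, jacobiWeight (b - 1) (a - 1) x *
      (|Real.log x| + |Real.log (1 - x)|) ≤ H x := by
    intro x hx
    have h1 : 0 < 1 - x := by linarith [hx.2]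
    have l1 := abs_log_le_rpow (t := a / 2) (by linarith) hx.1 hx.2.le
    have l2 := abs_log_le_rpow (t := b / 2) (by linarith) h1 (by linarith [hx.1])
    have e1 : jacobiWeight (b - 1) (a / 2 - 1) x =
        jacobiWeight (b - 1) (a - 1) x * x ^ (-(a / 2)) := by
      rw [jacobiWeight, jacobiWeight, mul_assoc, ← Real.rpow_add hx.1]
      congr 2; ring
    have e2 : jacobiWeight (b / 2 - 1) (a - 1) x =
        jacobiWeight (b - 1) (a - 1) x * (1 - x) ^ (-(b / 2)) := by
      rw [jacobiWeight, jacobiWeight, mul_right_comm, ← Real.rpow_add h1]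
      congr 2; ring
    rw [hH]
    simp only
    rw [e1, e2]
    have := mul_le_mul_of_nonneg_left (add_le_add l1 l2)
      (jacobiWeight_pos (b - 1) (a - 1) hx).le
    linarith
  have hH0 : ∀ x ∈ Ioo (0 : ℝ) 1, 0 ≤ H x := fun x hx =>
    le_trans (mul_nonneg (jacobiWeight_pos _ _ hx).le (by positivity)) (hlog x hx)
  refine ⟨∫ x in Ioo (0 : ℝ) 1, H x, setIntegral_nonneg measurableSet_Ioo hH0,
    fun f hf hm => ?_⟩
  set F := ∫ y, f y ^ 2 ∂(jacobiMeasure b a) with hF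
  have hF0 : 0 ≤ F := integral_nonneg fun _ => sq_nonneg _
  have hle : ∀ x ∈ Ioo (0 : ℝ) 1, jacobiWeight (b - 1) (a - 1) x *
      (∫ y in (1 / 2)..x, f y) ^ 2 ≤ F * H x := by
    intro x hx
    have h1 := mul_le_mul_of_nonneg_left (sq_primitive_le ha hb hf hx)
      (jacobiWeight_pos (b - 1) (a - 1) hx).le
    have h2 := mul_le_mul_of_nonneg_left (hlog x hx) hF0
    linarith
  have hint : IntegrableOn (fun x => jacobiWeight (b - 1) (a - 1) x *
      (∫ y in (1 / 2)..x, f y) ^ 2) (Ioo 0 1) := by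
    refine Integrable.mono' (hHi.const_mul F)
      ((measurable_jacobiWeight _ _).aestronglyMeasurable.mul (hm.pow 2)) ?_
    filter_upwards [ae_restrict_mem measurableSet_Ioo] with x hx
    rw [Real.norm_of_nonneg (mul_nonneg (jacobiWeight_pos _ _ hx).le (sq_nonneg _))]
    exact hle x hx
  refine ⟨memLp_jacobiMeasure hm hint, ?_⟩
  rw [integral_jacobiMeasure, mul_comm, ← integral_const_mul]
  exact setIntegral_mono_on hint (hHi.const_mul F) measurableSet_Ioo hle

end Primitive

/-! ### Elimination of the constant and conclusion -/

/-- Both α − β and β lie in (0,1] and their sum is less than 2, so the two sines are nonnegative and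
not both zero: the denominator is positive. -/
theorem admissible_of_parameters {α r β : ℝ} (hα : 1 < α ∧ α < 2) (hr : 0 ≤ r ∧ r ≤ 1)
    (hβ : α - 1 ≤ β ∧ β ≤ 1)
    (hrβ : r = Real.sin (Real.pi * β) /
      (Real.sin (Real.pi * (α - β)) + Real.sin (Real.pi * β))) : Admissible (α - β) β r := by
  obtain ⟨hα1, hα2⟩ := hα
  obtain ⟨hβ1, hβ2⟩ := hβ
  have nn : ∀ x : ℝ, 0 < x → x ≤ 1 → 0 ≤ Real.sin (Real.pi * x) := fun x h0 h1 =>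
    Real.sin_nonneg_of_nonneg_of_le_pi (by have := Real.pi_pos; positivity)
      (by nlinarith [Real.pi_pos])
  have hD : 0 < Real.sin (Real.pi * (α - β)) + Real.sin (Real.pi * β) := by
    have s1 := nn (α - β) (by linarith) (by linarith)
    have s2 := nn β (by linarith) hβ2
    rcases hβ2.eq_or_lt with h | h
    · have := sin_pi_mul_pos (x := α - β) (by linarith) (by linarith)
      linarith
    · have := sin_pi_mul_pos (x := β) (by linarith) h
      linarith
  refine ⟨by linarith, by linarith, by linarith, hβ2, by linarith, by linarith, hr.1, hr.2, ?_⟩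
  rw [eq_div_iff hD.ne'] at hrβ
  linarith

/-- Testing k w = A − G against w removes A because w has mean zero; k ≥ m gives m ‖w‖² ≤ −⟨w, G⟩,
and Cauchy–Schwarz concludes. -/
theorem integral_sq_le_of_mul_le {μ : Measure ℝ} {w G k : ℝ → ℝ} {A m : ℝ} (hm : 0 < m)
    (hw : MemLp w 2 μ) (hwi : Integrable w μ) (hG : MemLp G 2 μ) (hk : ∀ᵐ x ∂μ, m ≤ k x)
    (hkw : ∀ᵐ x ∂μ, k x * w x = A - G x) (h0 : ∫ x, w x ∂μ = 0) :
    ∫ x, w x ^ 2 ∂μ ≤ (m ^ 2)⁻¹ * ∫ x, G x ^ 2 ∂μ := by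
  have hwG : Integrable (fun x => w x * G x) μ := hw.integrable_mul hG
  have h1 : m * ∫ x, w x ^ 2 ∂μ ≤ -∫ x, w x * G x ∂μ := by
    have e : -∫ x, w x * G x ∂μ = ∫ x, A * w x - w x * G x ∂μ := by
      rw [integral_sub (hwi.const_mul A) hwG, integral_const_mul, h0]
      ring
    rw [e, ← integral_const_mul]
    refine integral_mono_ae (hw.integrable_sq.const_mul m) ((hwi.const_mul A).sub hwG) ?_
    filter_upwards [hk, hkw] with x h1 h2
    have h3 : A * w x - w x * G x = k x * w x ^ 2 := by
      linear_combination (-(w x)) * h2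
    rw [h3]
    exact mul_le_mul_of_nonneg_right h1 (sq_nonneg _)
  have h2 := sq_integral_mul_le hw hG
  have hW : 0 ≤ ∫ x, w x ^ 2 ∂μ := integral_nonneg fun x => sq_nonneg _
  have hG0 : 0 ≤ ∫ x, G x ^ 2 ∂μ := integral_nonneg fun x => sq_nonneg _
  generalize ∫ x, w x ^ 2 ∂μ = W at *
  generalize ∫ x, G x ^ 2 ∂μ = V at *
  generalize ∫ x, w x * G x ∂μ = I at *
  rw [inv_mul_eq_div, le_div_iff₀ (by positivity)]
  rcases hW.eq_or_lt with h | h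
  · rw [← h]; simpa using hG0
  · have h3 : (m * W) ^ 2 ≤ W * V :=
      le_trans (by rw [← neg_sq I]; exact pow_le_pow_left₀ (by positivity) h1 2) h2
    have h4 : W * (W * m ^ 2) ≤ W * V := by linarith
    exact le_of_mul_le_mul_left h4 h

theorem mainTheorem3 (α r β Km KM : ℝ) (hα : 1 < α ∧ α < 2) (hr : 0 ≤ r ∧ r ≤ 1)
    (hβ : α - 1 ≤ β ∧ β ≤ 1)
    (hrβ : r = Real.sin (Real.pi * β) /
      (Real.sin (Real.pi * (α - β)) + Real.sin (Real.pi * β)))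
    (hKm : 0 < Km) :
    ∃ C : ℝ, 0 < C ∧
      ∀ K : ℝ → ℝ, AEMeasurable K (volume.restrict (Ioo (0 : ℝ) 1)) →
        (∀ x ∈ Ioo (0 : ℝ) 1, Km ≤ K x ∧ K x ≤ KM) →
        ∀ f : ℝ → ℝ, MemWeightedL2 β (α - β) f →
          ∀ u : ℝ → ℝ, MemWeightedL2 (-(α - β)) (-β) u → IsSolution α r K f u →
            weightedNorm (-(α - β)) (-β) u ≤ C * weightedNorm β (α - β) f := by
  have h := admissible_of_parameters hα hr hβ hrβ
  obtain ⟨a, ha⟩ : ∃ a, a = α - β := ⟨_, rfl⟩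
  obtain rfl : α = a + β := by linarith
  rw [← ha] at h ⊢
  have ha0 := h.a_pos
  have hb0 := h.b_pos
  obtain ⟨c, hc, Q, hQ⟩ := exists_isPotentialMap h
  obtain ⟨c', hc', Q', hQ'⟩ := exists_isPotentialMap h.symm
  obtain ⟨B, hB0, hB⟩ := exists_primitive_bound ha0 hb0 h.a_le h.b_le
  set κ := c * c' * (a + β - 1) ^ 2 with hκ
  have hκ0 : 0 < κ := mul_pos (mul_pos hc hc') (pow_pos (by linarith [h.one_lt]) 2)
  set γ := 1 / Real.Gamma (2 - (a + β)) with hγ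
  have hγ0 : 0 < γ := one_div_pos.2 (Real.Gamma_pos_of_pos (by linarith [h.lt_two]))
  set T := (γ ^ 2)⁻¹ * (κ⁻¹ * ((Km ^ 2)⁻¹ * B)) with hT
  have hT0 : 0 ≤ T := by positivity
  -- T is the product of the squared constants of the steps u → v → w → G → f; the added 1 only
  -- secures positivity.
  refine ⟨Real.sqrt T + 1, by positivity, fun K hK hKb f hf u hu hsol => ?_⟩
  obtain ⟨hfi, hu0, hu1, w, A, ⟨hui, hwl, hweak⟩, -, heq⟩ := hsol
  have hacL : ∀ p q : ℝ, jacobiMeasure p q ≪ volume.restrict (Ioo 0 1) := fun p q =>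
    withDensity_absolutelyContinuous _ _
  have hwm : AEStronglyMeasurable w (volume.restrict (Ioo 0 1)) := hwl.aestronglyMeasurable
  set G : ℝ → ℝ := fun x => ∫ y in (1 / 2)..x, f y with hG
  -- Moving the base point of the primitive from 0 to 1/2 only changes the constant.
  set A' := A - ∫ y in (0 : ℝ)..(1 / 2), f y with hA'
  have hflux : ∀ᵐ x ∂(volume.restrict (Ioo (0 : ℝ) 1)), K x * w x = A' - G x := by
    filter_upwards [heq, ae_restrict_mem measurableSet_Ioo] with x hx hxI
    have hKx : K x ≠ 0 := (hKm.trans_le (hKb x hxI).1).ne'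
    have hii : ∀ z ∈ Ioo (0 : ℝ) 1, IntervalIntegrable f volume 0 z := fun z hz =>
      (intervalIntegrable_iff_integrableOn_Ioo_of_le hz.1.le).2 (hfi z hz)
    have hadd := intervalIntegral.integral_add_adjacent_intervals (hii (1 / 2) (by norm_num))
      ((hii (1 / 2) (by norm_num)).symm.trans (hii x hxI))
    rw [← hadd] at hx
    field_simp at hx
    simp only [hA', hG]
    linarith
  -- Measurability of the primitive is read off the equation G = A' − K w.
  have hGm : AEStronglyMeasurable G (volume.restrict (Ioo 0 1)) := by
    refine ((aestronglyMeasurable_const (b := A')).sub (hK.aestronglyMeasurable.mul hwm)).congr ?_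
    filter_upwards [hflux] with x hx
    simp only [Pi.sub_apply, Pi.mul_apply, hx]
    ring
  have hfL : MemLp f 2 (jacobiMeasure β a) := memLp_jacobiMeasure hf.1 hf.2
  obtain ⟨hGL, hGB⟩ := hB f hfL hGm
  have hfin : IsFiniteMeasure (jacobiMeasure (β - 1) (a - 1)) :=
    isFiniteMeasure_jacobiMeasure (by linarith) (by linarith)
  have hflux' : ∀ᵐ x ∂(jacobiMeasure (β - 1) (a - 1)), K x * w x = A' - G x :=
    (hacL _ _).ae_le hflux
  have hKae : ∀ᵐ x ∂(jacobiMeasure (β - 1) (a - 1)), Km ≤ K x := by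
    refine (hacL _ _).ae_le ?_
    filter_upwards [ae_restrict_mem measurableSet_Ioo] with x hx using (hKb x hx).1
  have hwL : MemLp w 2 (jacobiMeasure (β - 1) (a - 1)) := by
    refine MemLp.of_le_mul (c := Km⁻¹) ((memLp_const A').sub hGL) (hwm.mono_ac (hacL _ _)) ?_
    filter_upwards [hflux', hKae] with x h1 h2
    have e : A' - (∫ y in (1 / 2)..x, f y) = K x * w x := h1.symm
    rw [Pi.sub_apply, e, norm_mul, inv_mul_eq_div, le_div_iff₀ hKm, mul_comm]
    exact mul_le_mul_of_nonneg_right (h2.trans (le_abs_self _)) (norm_nonneg _)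
  -- With this v, pairing with p in L²(ω^(a,β)) is γ ∫ u p, and ω^(a,β) v² = γ² ω^(−a,−β) u².
  set v : ℝ → ℝ := fun x => γ * u x * (jacobiWeight a β x)⁻¹ with hv
  have hinv : ∀ x ∈ Ioo (0 : ℝ) 1, jacobiWeight (-a) (-β) x = (jacobiWeight a β x)⁻¹ := by
    intro x hx
    rw [jacobiWeight, jacobiWeight, Real.rpow_neg (by linarith [hx.2]), Real.rpow_neg hx.1.le,
      mul_inv]
  have hvsq : ∀ x ∈ Ioo (0 : ℝ) 1,
      jacobiWeight a β x * v x ^ 2 = γ ^ 2 * (jacobiWeight (-a) (-β) x * u x ^ 2) := by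
    intro x hx
    have := (jacobiWeight_pos a β hx).ne'
    rw [hinv x hx, hv]
    field_simp
  have hvL : MemLp v 2 (jacobiMeasure a β) := by
    refine memLp_jacobiMeasure ((hu.1.const_mul γ).mul
      (measurable_jacobiWeight a β).inv.aestronglyMeasurable) ?_
    have hi : IntegrableOn (fun x => γ ^ 2 * (jacobiWeight (-a) (-β) x * u x ^ 2)) (Ioo 0 1) :=
      hu.2.const_mul _
    exact hi.congr_fun (fun x hx => (hvsq x hx).symm) measurableSet_Ioo
  have hvint : ∫ x, v x ^ 2 ∂(jacobiMeasure a β) =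
      γ ^ 2 * ∫ x in Ioo (0 : ℝ) 1, jacobiWeight (-a) (-β) x * u x ^ 2 := by
    rw [integral_jacobiMeasure, ← integral_const_mul]
    exact setIntegral_congr_fun measurableSet_Ioo hvsq
  have hpair := pairing_eq_zero h hQ hQ' hc hc' hwL hvL fun p => by
    have h1 := pairing_eq_zero_of_weak h hQ hui hwm hwL (fun φ h1 h2 h3 => by
      rw [hweak φ h1 h2 h3, derivPairing, hu0, hu1]
      ring) p
    rw [← h1, ← hγ, ← integral_const_mul, integral_jacobiMeasure a β]
    congr 1
    refine setIntegral_congr_fun measurableSet_Ioo fun x hx => ?_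
    have := (jacobiWeight_pos a β hx).ne'
    simp only [hv]
    field_simp
  have hmean := integral_eq_zero_of_pairing hQ hpair
  have b1 := integral_sq_le_of_pairing h hQ hQ' hc hc' hwL hvL hpair
  have b2 := integral_sq_le_of_mul_le hKm hwL (hwL.integrable one_le_two) hGL hKae hflux' hmean
  have hfint : ∫ y, f y ^ 2 ∂(jacobiMeasure β a) =
      ∫ x in Ioo (0 : ℝ) 1, jacobiWeight β a x * f x ^ 2 := integral_jacobiMeasure _ _ _
  have hfinal : ∫ x in Ioo (0 : ℝ) 1, jacobiWeight (-a) (-β) x * u x ^ 2 ≤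
      T * ∫ x in Ioo (0 : ℝ) 1, jacobiWeight β a x * f x ^ 2 := by
    rw [hvint, ← hκ] at b1
    rw [hfint] at hGB
    have hγ2 : 0 < γ ^ 2 := by positivity
    have b3 : γ ^ 2 * ∫ x in Ioo (0 : ℝ) 1, jacobiWeight (-a) (-β) x * u x ^ 2 ≤
        κ⁻¹ * ((Km ^ 2)⁻¹ * (B * ∫ x in Ioo (0 : ℝ) 1, jacobiWeight β a x * f x ^ 2)) := by
      refine b1.trans (mul_le_mul_of_nonneg_left (b2.trans
        (mul_le_mul_of_nonneg_left hGB (by positivity))) (by positivity))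
    rw [hT, mul_assoc, inv_mul_eq_div, le_div_iff₀ hγ2]
    linarith
  rw [weightedNorm, weightedNorm]
  calc _ ≤ Real.sqrt (T * ∫ x in Ioo (0 : ℝ) 1, jacobiWeight β a x * f x ^ 2) :=
        Real.sqrt_le_sqrt hfinal
    _ = Real.sqrt T * Real.sqrt (∫ x in Ioo (0 : ℝ) 1, jacobiWeight β a x * f x ^ 2) :=
        Real.sqrt_mul hT0 _
    _ ≤ _ := mul_le_mul_of_nonneg_right (by linarith) (Real.sqrt_nonneg _)
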